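/- Work in $\mathsf{ZF}$; that is, everything below takes place inside an arbitrary model $M$ of $\mathsf{ZF}$. Let $\lambda$ be a nonzero limit ordinal (for instance an infinite cardinal) and let $k\colon V_{\lambda+2}\to V_{\lambda+2}$ be an elementary embedding of $(V_{\lambda+2},\in)$ into itself, $k$ being a set. Notation. $H(V_{\lambda+2})$ is the union of all transitive sets $N$ such that $N$ is the image of some $S\in V_{\lambda+2}$ under a function. Finite tuples are coded without raising the rank: let $s(x)=2x+1$ for $x\in\omega$ and $s(x)=x$ otherwise, let $f_n(a)=\{s(x)\mid x\in a\}\cup\{2i\mid i<n\}$, put $\lceil a,b\rceil=f_0''[a]\cup f_1''[b]$, and code the tuple $(x_0,\dots,x_{n-1})$ by the flat pair $\lceil n,\ \bigcup_{i<n}f_i''[x_i]\rceil$; the length-one tuple with entry $u$ is written $\lceil u\rceil$. A tree over $V_{\lambda+1}$ is a set $T$ of finite tuples of elements of $V_{\lambda+1}$ that contains the empty tuple and is closed under initial segments. It is suitable if it is well-founded: every non-empty $Z\subseteq T$ has an element $\sigma$ with $\sigma^\frown\lceil u\rceil\notin Z$ for every $u$. For a suitable tree $T$ put $T\downarrow\lceil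 u\rceil=\{\tau\mid\lceil u\rceil^\frown\tau\in T\}$ and define recursively $\operatorname{Tcoll}(T)=\{\operatorname{Tcoll}(T\downarrow\lceil u\rceil)\mid\lceil u\rceil\in T\}$. Theorem. Every $a\in H(V_{\lambda+2})$ is $\operatorname{Tcoll}(T)$ for some suitable tree $T$ over $V_{\lambda+1}$, and there is a unique map $j\colon H(V_{\lambda+2})\to H(V_{\lambda+2})$ such that $j(\operatorname{Tcoll}(T))=\operatorname{Tcoll}(k(T))$ for every suitable tree $T$ over $V_{\lambda+1}$. This map $j$ is cofinal: for every $a\in H(V_{\lambda+2})$ there is $b\in H(V_{\lambda+2})$ with $a\in j(b)$. -/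

import Mathlib

namespace KunenTree

open FirstOrder

universe u

/-! ### Structures for the language of set theory, and models of `ZF` -/

/-- A type with one binary relation `mem`: an arbitrary (possibly ill-founded) structure for the
language of set theory. -/
class SetStructure (M : Type u) where
  mem : M → M → Prop

infix:50 " ∈ₘ " => SetStructure.mem

/-- The relation symbols of the language of set theory: a single binary one. -/
inductive SetRel : ℕ → Type
  | mem : SetRel 2

/-- The first-order language `{∈}` (equality is logical). -/
def setLang : Language := ⟨fun _ => Empty, SetRel⟩

instance instStructure (M : Type u) [SetStructure M] : setLang.Structure M where
  funMap := fun f => Empty.elim f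
  RelMap := fun r xs =>
    match r, xs with
    | SetRel.mem, xs => xs 0 ∈ₘ xs 1

/-- The elements (in the sense of the structure `M`) of `v`, with the membership of `M`. -/
def Ext {M : Type u} [SetStructure M] (v : M) : Type u := {x : M // x ∈ₘ v}

instance instSetStructureExt {M : Type u} [SetStructure M] (v : M) : SetStructure (Ext v) where
  mem := fun x y => x.1 ∈ₘ y.1

section Defs

variable {M : Type u} [SetStructure M]

/-- `a ⊆ b`. -/
def Sub (a b : M) : Prop := ∀ x, x ∈ₘ a → x ∈ₘ b

/-- `M` is a model of `ZF`. The schemes of Separation and Replacement range over all classes that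
are first-order definable over `(M, ∈)` with parameters from `M`. -/
structure ModelsZF (M : Type u) [SetStructure M] : Prop where
  extensionality : ∀ a b : M, (∀ x, x ∈ₘ a ↔ x ∈ₘ b) → a = b
  foundation : ∀ a : M, (∃ x, x ∈ₘ a) → ∃ x, x ∈ₘ a ∧ ∀ y, y ∈ₘ x → ¬ y ∈ₘ a
  pairing : ∀ a b : M, ∃ c, ∀ x, x ∈ₘ c ↔ x = a ∨ x = b
  union : ∀ a : M, ∃ c, ∀ x, x ∈ₘ c ↔ ∃ y, y ∈ₘ a ∧ x ∈ₘ y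
  powerset : ∀ a : M, ∃ c, ∀ x, x ∈ₘ c ↔ Sub x a
  infinity : ∃ w : M, (∃ e, e ∈ₘ w ∧ ∀ x, ¬ x ∈ₘ e) ∧
    ∀ x, x ∈ₘ w → ∃ y, y ∈ₘ w ∧ ∀ z, z ∈ₘ y ↔ z ∈ₘ x ∨ z = x
  separation : ∀ D : Set M, (Set.univ : Set M).Definable₁ setLang D →
    ∀ a : M, ∃ c, ∀ x, x ∈ₘ c ↔ x ∈ₘ a ∧ x ∈ D
  replacement : ∀ R : M → M → Prop, (Set.univ : Set M).Definable₂ setLang {p | R p.1 p.2} →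
    ∀ a : M, (∀ x, x ∈ₘ a → ∃! y, R x y) → ∃ c, ∀ y, y ∈ₘ c ↔ ∃ x, x ∈ₘ a ∧ R x y

/-! ### Basic set theory inside `M`

All quantifiers range over `M`, so every notion below is the set-theoretic notion evaluated in the
structure `M`; in particular natural numbers, finite sequences, functions and well-foundedness are
those of `M`. -/

variable [Nonempty M]

/-- The set `{x | P x}` of `M` (only used where it exists in a model of `ZF`). -/
noncomputable def compr (P : M → Prop) : M := Classical.epsilon fun c => ∀ x, x ∈ₘ c ↔ P x

/-- The empty set. -/
noncomputable def empty : M := compr fun _ => False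

/-- `{a, b}`. -/
noncomputable def upair (a b : M) : M := compr fun x => x = a ∨ x = b

/-- The Kuratowski pair `{{a}, {a, b}}`. -/
noncomputable def kpair (a b : M) : M := upair (upair a a) (upair a b)

/-- `a ∪ {a}`. -/
noncomputable def succ (a : M) : M := compr fun x => x ∈ₘ a ∨ x = a

/-- `a` is a transitive set. -/
def IsTrans (a : M) : Prop := ∀ x, x ∈ₘ a → Sub x a

/-- `a` is an ordinal. -/
def IsOrd (a : M) : Prop := IsTrans a ∧ ∀ x, x ∈ₘ a → IsTrans x

/-- `a` is a (non-zero) limit ordinal. -/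
def IsLimit (a : M) : Prop := IsOrd a ∧ (∃ x, x ∈ₘ a) ∧ ∀ x, x ∈ₘ a → succ x ∈ₘ a

/-- `n` is a natural number: an ordinal such that each ordinal `≤ n` is zero or a successor. -/
def IsNat (n : M) : Prop :=
  IsOrd n ∧ ∀ m, m ∈ₘ succ n → m = empty ∨ ∃ p, m = succ p

/-- `f` is a function (a set of Kuratowski pairs) with domain `A`. -/
def IsFun (f A : M) : Prop :=
  (∀ p, p ∈ₘ f → ∃ x y, x ∈ₘ A ∧ p = kpair x y) ∧ ∀ x, x ∈ₘ A → ∃! y, kpair x y ∈ₘ f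

/-- The value `f(x)`. -/
noncomputable def app (f x : M) : M := Classical.epsilon fun y => kpair x y ∈ₘ f

/-- The level `V_α` of the cumulative hierarchy: the value at `α` of the function `f` on `α + 1`
with `f(β) = ⋃_{γ < β} 𝒫(f(γ))`. -/
noncomputable def V (α : M) : M :=
  Classical.epsilon fun v => ∃ f, IsFun f (succ α) ∧
    (∀ β, β ∈ₘ succ α → ∀ x, x ∈ₘ app f β ↔ ∃ γ, γ ∈ₘ β ∧ Sub x (app f γ)) ∧ app f α = v

/-- `H(X)`: the union of all transitive sets `N` that are images of some `S ∈ X`. -/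
noncomputable def H (X : M) : M :=
  compr fun a => ∃ N, IsTrans N ∧ a ∈ₘ N ∧
    ∃ S f, S ∈ₘ X ∧ IsFun f S ∧ ∀ y, y ∈ₘ N ↔ ∃ x, x ∈ₘ S ∧ kpair x y ∈ₘ f

/-! ### Flat pairs and flat finite tuples -/

/-- `2n`, for a natural number `n`: `0 ↦ 0`, `i + 1 ↦ 2i + 2`. -/
noncomputable def double (n : M) : M :=
  Classical.epsilon fun m => ∃ f, IsFun f (succ n) ∧ app f empty = empty ∧
    (∀ i, i ∈ₘ n → app f (succ i) = succ (succ (app f i))) ∧ app f n = m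

open Classical in
/-- `s(x) = 2x + 1` if `x` is a natural number, and `s(x) = x` otherwise. -/
noncomputable def shift (x : M) : M := if IsNat x then succ (double x) else x

/-- `f_n(a) = s''[a] ∪ {2i | i < n}`. -/
noncomputable def flatF (n a : M) : M :=
  compr fun y => (∃ x, x ∈ₘ a ∧ y = shift x) ∨ ∃ i, i ∈ₘ n ∧ y = double i

/-- The flat pair `⌈a, b⌉ = f_0''[a] ∪ f_1''[b]`. -/
noncomputable def flatPair (a b : M) : M :=
  compr fun z => (∃ x, x ∈ₘ a ∧ z = flatF empty x) ∨ ∃ y, y ∈ₘ b ∧ z = flatF (succ empty) y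

/-- `g` is a finite sequence of length `n`. -/
def IsSeq (n g : M) : Prop := IsNat n ∧ IsFun g n

/-- The flat tuple `⌈g(0), …, g(n-1)⌉`, coded as the flat pair of the length `n` and
`⋃_{i < n} f_i''[g(i)]`. The length has to be recorded, since `⋃_{i < n} f_i''[g(i)]` does not
change when empty sets are appended to the sequence `g`. -/
noncomputable def tup (n g : M) : M :=
  flatPair n (compr fun z => ∃ i x, i ∈ₘ n ∧ x ∈ₘ app g i ∧ z = flatF i x)

/-- The empty tuple `⌈⌉`. -/
noncomputable def nil : M := tup empty empty

/-- The tuple `⌈u⌉` of length one. -/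
noncomputable def tup1 (u : M) : M :=
  tup (succ empty) (upair (kpair empty u) (kpair empty u))

/-- `ρ = σ⌢⌈u⌉`. -/
def IsAppend (σ u ρ : M) : Prop :=
  ∃ n g e, IsSeq n g ∧ IsSeq (succ n) e ∧ σ = tup n g ∧ ρ = tup (succ n) e ∧
    (∀ i, i ∈ₘ n → app e i = app g i) ∧ app e n = u

/-- `ρ = ⌈u⌉⌢τ`. -/
def IsPrepend (u τ ρ : M) : Prop :=
  ∃ n g e, IsSeq n g ∧ IsSeq (succ n) e ∧ τ = tup n g ∧ ρ = tup (succ n) e ∧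
    app e empty = u ∧ ∀ i, i ∈ₘ n → app e (succ i) = app g i

/-! ### Suitable trees and their collapses -/

/-- `T` is a tree over `X`: a set of finite tuples of elements of `X`, closed under initial
segments and containing the empty tuple. -/
def IsTreeOver (X T : M) : Prop :=
  (∀ σ, σ ∈ₘ T → ∃ n g, IsSeq n g ∧ (∀ i, i ∈ₘ n → app g i ∈ₘ X) ∧ σ = tup n g) ∧
  (∀ n g m h, IsSeq n g → tup n g ∈ₘ T → m ∈ₘ n → IsSeq m h →
    (∀ i, i ∈ₘ m → app h i = app g i) → tup m h ∈ₘ T) ∧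
  nil ∈ₘ T

/-- `T` is a suitable tree over `X`: a tree over `X` which is well-founded, i.e. every non-empty
`Z ⊆ T` has an element none of whose one-step extensions is in `Z`. -/
def IsSuitable (X T : M) : Prop :=
  IsTreeOver X T ∧
  ∀ Z, Sub Z T → (∃ σ, σ ∈ₘ Z) → ∃ σ, σ ∈ₘ Z ∧ ∀ u ρ, IsAppend σ u ρ → ¬ ρ ∈ₘ Z

/-- `T ↓ ⌈u⌉ = {τ | ⌈u⌉⌢τ ∈ T}`. -/
noncomputable def down (T u : M) : M := compr fun τ => ∃ ρ, ρ ∈ₘ T ∧ IsPrepend u τ ρ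

/-- `a = Tcoll(T)`, where `Tcoll(T) = {Tcoll(T ↓ ⌈u⌉) | ⌈u⌉ ∈ T}`: some function `F`, whose domain
`D` contains `T` and is closed under `S ↦ S ↓ ⌈u⌉` for `⌈u⌉ ∈ S`, satisfies the recursion on `D`
and takes the value `a` at `T`. -/
def IsTcoll (T a : M) : Prop :=
  ∃ D F, IsFun F D ∧ T ∈ₘ D ∧
    (∀ S u, S ∈ₘ D → tup1 u ∈ₘ S → down S u ∈ₘ D) ∧
    (∀ S, S ∈ₘ D → ∀ x, x ∈ₘ app F S ↔ ∃ u, tup1 u ∈ₘ S ∧ x = app F (down S u)) ∧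
    app F T = a

/-- `j : H(W) → H(W)` is the map induced by `k : W → W` through trees over `X`: every `a` in `H(W)`
is coded by some suitable tree `T ∈ W` over `X`, and `j(a) = Tcoll(k(T))` for every suitable tree
`T ∈ W` over `X` that codes `a`. -/
def IsInduced (X W : M) (k : Ext W → Ext W) (j : Ext (H W) → Ext (H W)) : Prop :=
  ∀ a : Ext (H W),
    (∃ T : Ext W, IsSuitable X T.1 ∧ IsTcoll T.1 a.1) ∧
    ∀ T : Ext W, IsSuitable X T.1 → IsTcoll T.1 a.1 → IsTcoll (k T).1 (j a).1

/-- `j` is cofinal: for every `a` there is `b` with `a ∈ j(b)`. -/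
def IsCofinalMap {N : Type u} [SetStructure N] (j : N → N) : Prop := ∀ a, ∃ b, a ∈ₘ j b

end Defs

end KunenTree

/-! Write `L` for `V_λ`. Then `V_{λ+1}` is `pow L`, and `k` acts on `W = pow (pow L)`. Since tuples
are flat, a tuple of subsets of `L` is again a subset of `L`, so a tree of such tuples is an element
of `W`. The tree notions are first-order over `W` without parameters, hence respected by `k`.

Coding: let a subset `S` of `pow L` be mapped onto a transitive set. Each element `a` of that set is
the collapse of the tree of sequences of codes in `S` whose values descend in the membership
relation, starting below `a`. All codes are kept, so no choice is needed
(`exists_suit_of_surjection`, `mem_H_iff`).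

Well-definedness: two suitable trees have the same collapse exactly when a bisimulation relates
their roots, and a bisimulation is coded by an element of `W` (`bisimilar_of_rootColl_eq`,
`Bisimilar.rootColl_eq`). Hence trees with equal collapses are sent by `k` to trees with equal
collapses. Existence of `j` follows, and uniqueness holds because every `a` has a code
(`existsUnique_isInduced`).

Cofinality: on `pow L` the map `k` is determined by its values on `L`, because a `w` in `L` belongs
to `k(x)` iff it belongs to `k(z)` for some `z ⊆ x` in `L` (`mem_map_iff`). This rests on `v ⊆ k(v)`
for the levels `v` in `L` (`Lev.sub_map`). So one set `e ⊆ L` codes `k` on `pow L` (`exists_code`).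
Given a suitable tree `T` with collapse `a`, let `B` contain, besides the empty tuple, all `⌈d⌉⌢σ`
with `σ` in the preimage of `T` under the map coded by `d`, for all `d` whose preimage is suitable.
By elementarity `k(B)` arises in the same way from `k(T)`. The preimage of `k(T)` under `k` is `T`,
so `e` is one of the admissible codes and `k(B) ↓ ⌈e⌉ = T` (`exists_suit_down_map`). Thus `a` is an
element of the collapse of `k(B)`, which is `j` of the collapse of `B`.

Definability is tracked by the classes `Dfn` and `DTm`: over `M` with parameters, to apply
Separation and Replacement, and over `W` without parameters, to apply elementarity. -/

set_option linter.unusedSectionVars false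
set_option synthInstance.maxSize 2000
set_option synthInstance.maxHeartbeats 400000

namespace KunenTree

open FirstOrder

universe u

/-! ### Definability over a structure and over an embedded substructure -/

section Definability

variable {N M : Type u} [SetStructure N] [SetStructure M]

/-- `ι` is an injection respecting membership. -/
class Emb (ι : N → M) : Prop where
  inj : Function.Injective ι
  mem : ∀ a b, a ∈ₘ b ↔ ι a ∈ₘ ι b

/-- The restriction of `P` to tuples from the range of `ι` is definable over `N`, with parameters
from `A`. -/
class Dfn (ι : N → M) (A : Set N) {α : Type} (P : (α → M) → Prop) : Prop where
  out : A.Definable setLang {v : α → N | P fun a => ι (v a)}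

/-- `t` maps tuples from the range of `ι` into the range of `ι`, and its graph is definable. -/
class DTm (ι : N → M) (A : Set N) {α : Type} (t : (α → M) → M) : Prop where
  total : ∀ v : α → N, ∃ n, ι n = t fun a => ι (v a)
  graph : A.Definable setLang {v : Option α → N | ι (v none) = t fun a => ι (v (some a))}

variable {ι : N → M} {A : Set N} {α β : Type}

theorem Dfn.congr {P Q : (α → M) → Prop} (hP : Dfn ι A P)
    (h : ∀ v : α → N, Q (fun a => ι (v a)) ↔ P fun a => ι (v a)) : Dfn ι A Q :=
  ⟨by
    have := hP.out
    simpa only [h] using this⟩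

instance Dfn.and {P Q : (α → M) → Prop} [hP : Dfn ι A P] [hQ : Dfn ι A Q] :
    Dfn ι A fun v => P v ∧ Q v := ⟨hP.out.inter hQ.out⟩

instance Dfn.or {P Q : (α → M) → Prop} [hP : Dfn ι A P] [hQ : Dfn ι A Q] :
    Dfn ι A fun v => P v ∨ Q v := ⟨hP.out.union hQ.out⟩

instance Dfn.not {P : (α → M) → Prop} [hP : Dfn ι A P] : Dfn ι A fun v => ¬ P v :=
  ⟨hP.out.compl⟩

instance Dfn.imp {P Q : (α → M) → Prop} [hP : Dfn ι A P] [hQ : Dfn ι A Q] :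
    Dfn ι A fun v => P v → Q v :=
  Dfn.congr (P := fun v => ¬ P v ∨ Q v) inferInstance fun _ => imp_iff_not_or

instance Dfn.iff {P Q : (α → M) → Prop} [hP : Dfn ι A P] [hQ : Dfn ι A Q] :
    Dfn ι A fun v => (P v ↔ Q v) :=
  Dfn.congr (P := fun v => (P v → Q v) ∧ (Q v → P v)) inferInstance
    fun _ => iff_iff_implies_and_implies

/-- The quantified tuple ranges over `N`, not over `M`: for the inclusion of `W` this yields
quantifiers relativised to `W`. -/
theorem Dfn.exists_tuple [Finite β] {P : (α ⊕ β → M) → Prop} (hP : Dfn ι A P) :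
    Dfn ι A fun v : α → M => ∃ u : β → N, P (Sum.elim v fun b => ι (u b)) := by
  refine ⟨?_⟩
  convert! hP.out.exists_of_finite using 1
  ext v
  refine exists_congr fun u => ?_
  have : (fun a => ι (Sum.elim v u a)) = Sum.elim (fun a => ι (v a)) fun b => ι (u b) := by
    funext a; cases a <;> rfl
  change _ ↔ P _
  rw [this]

theorem Dfn.rename {P : (α → M) → Prop} (hP : Dfn ι A P) (f : α → β) :
    Dfn ι A fun v : β → M => P fun a => v (f a) := ⟨hP.out.preimage_comp f⟩

theorem DTm.eq_var {t : (α → M) → M} (ht : DTm ι A t) (f : α → β) (b : β) :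
    Dfn ι A fun v : β → M => v b = t fun a => v (f a) :=
  ⟨ht.graph.preimage_comp fun o : Option α => o.elim b f⟩

theorem Dfn.all_finite [Finite β] {P : β → (α → M) → Prop} (hP : ∀ b, Dfn ι A (P b)) :
    Dfn ι A fun v => ∀ b, P b v := by
  refine ⟨?_⟩
  have := Set.definable_iInter_of_finite fun b => (hP b).out
  convert! this using 1
  ext v
  simp

/-- Substitution of definable terms. -/
theorem Dfn.comp [Finite β] {P : (β → M) → Prop} (hP : Dfn ι A P) {t : β → (α → M) → M}
    (ht : ∀ b, DTm ι A (t b)) : Dfn ι A fun v => P fun b => t b v := by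
  -- `P(t(v))` is read as `∃ u, u = t(v) ∧ P(u)`; totality of the terms supplies such a `u` in the
  -- range of `ι`.
  have h1 : Dfn ι A fun w : α ⊕ β → M =>
      (∀ b, w (Sum.inr b) = t b fun a => w (Sum.inl a)) ∧ P fun b => w (Sum.inr b) := by
    have := Dfn.all_finite fun b => (ht b).eq_var (β := α ⊕ β) Sum.inl (Sum.inr b)
    have := hP.rename (Sum.inr : β → α ⊕ β)
    infer_instance
  refine (h1.exists_tuple).congr fun v => ?_
  constructor
  · intro h
    choose u hu using fun b => (ht b).total v
    refine ⟨u, fun b => hu b, ?_⟩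
    simpa only [Sum.elim_inr, hu] using h
  · rintro ⟨u, hu, h⟩
    simpa only [Sum.elim_inr, Sum.elim_inl, hu] using h

theorem Dfn.comp1 {p : M → Prop} (h : Dfn ι A fun v : Fin 1 → M => p (v 0))
    {t : (α → M) → M} [ht : DTm ι A t] : Dfn ι A fun v => p (t v) :=
  h.comp (t := ![t]) (by intro b; fin_cases b; exact ht)

theorem Dfn.comp2 {p : M → M → Prop} (h : Dfn ι A fun v : Fin 2 → M => p (v 0) (v 1))
    {t s : (α → M) → M} [ht : DTm ι A t] [hs : DTm ι A s] : Dfn ι A fun v => p (t v) (s v) :=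
  h.comp (t := ![t, s]) (by intro b; fin_cases b; exacts [ht, hs])

theorem Dfn.comp3 {p : M → M → M → Prop}
    (h : Dfn ι A fun v : Fin 3 → M => p (v 0) (v 1) (v 2))
    {t s r : (α → M) → M} [ht : DTm ι A t] [hs : DTm ι A s] [hr : DTm ι A r] :
    Dfn ι A fun v => p (t v) (s v) (r v) :=
  h.comp (t := ![t, s, r]) (by intro b; fin_cases b; exacts [ht, hs, hr])

instance DTm.var [Emb ι] (a : α) : DTm ι A fun v : α → M => v a := by
  refine ⟨fun v => ⟨v a, rfl⟩, ?_⟩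
  refine ⟨(Language.Term.var none).equal (Language.Term.var (some a)), ?_⟩
  ext v
  simp [(Emb.inj (ι := ι)).eq_iff]

theorem DTm.weaken {t : (α → M) → M} (ht : DTm ι A t) (f : α → β) :
    DTm ι A fun v : β → M => t fun a => v (f a) := by
  refine ⟨fun v => ht.total fun a => v (f a), ?_⟩
  exact (ht.eq_var (fun a => some (f a)) none).out

theorem DTm.comp [Emb ι] [Finite β] {g : (β → M) → M} (hg : DTm ι A g) {t : β → (α → M) → M}
    (ht : ∀ b, DTm ι A (t b)) : DTm ι A fun v => g fun b => t b v := by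
  constructor
  · intro v
    choose u hu using fun b => (ht b).total v
    obtain ⟨n, hn⟩ := hg.total u
    exact ⟨n, by simpa only [hu] using hn⟩
  · have := Dfn.comp (P := fun w : Option β → M => w none = g fun b => w (some b)) ⟨hg.graph⟩
      (t := fun o : Option β => o.elim (fun v : Option α → M => v none)
        fun b v => t b fun a => v (some a)) (by
          intro o
          cases o with
          | none => exact DTm.var none
          | some b => exact (ht b).weaken some)
    exact this.out

theorem DTm.comp1 [Emb ι] {g : M → M} (h : DTm ι A fun v : Fin 1 → M => g (v 0))
    {t : (α → M) → M} [ht : DTm ι A t] : DTm ι A fun v => g (t v) :=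
  h.comp (t := ![t]) (by intro b; fin_cases b; exact ht)

theorem DTm.comp2 [Emb ι] {g : M → M → M} (h : DTm ι A fun v : Fin 2 → M => g (v 0) (v 1))
    {t s : (α → M) → M} [ht : DTm ι A t] [hs : DTm ι A s] : DTm ι A fun v => g (t v) (s v) :=
  h.comp (t := ![t, s]) (by intro b; fin_cases b; exacts [ht, hs])

theorem DTm.comp3 [Emb ι] {g : M → M → M → M}
    (h : DTm ι A fun v : Fin 3 → M => g (v 0) (v 1) (v 2))
    {t s r : (α → M) → M} [ht : DTm ι A t] [hs : DTm ι A s] [hr : DTm ι A r] :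
    DTm ι A fun v => g (t v) (s v) (r v) :=
  h.comp (t := ![t, s, r]) (by intro b; fin_cases b; exacts [ht, hs, hr])

instance Dfn.eq [Emb ι] {s t : (α → M) → M} [hs : DTm ι A s] [ht : DTm ι A t] :
    Dfn ι A fun v => s v = t v :=
  Dfn.comp2 (p := fun a b => a = b) ⟨⟨(Language.Term.var 0).equal (Language.Term.var 1), by
    ext v
    simp [(Emb.inj (ι := ι)).eq_iff]⟩⟩

instance Dfn.mem [Emb ι] {s t : (α → M) → M} [hs : DTm ι A s] [ht : DTm ι A t] :
    Dfn ι A fun v => s v ∈ₘ t v :=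
  Dfn.comp2 (p := fun a b => a ∈ₘ b) <| by
    have h : (∅ : Set N).Definable setLang {v : Fin 2 → N | ι (v 0) ∈ₘ ι (v 1)} := by
      rw [Set.empty_definable_iff]
      refine ⟨Language.Relations.formula (L := setLang) (n := 2) SetRel.mem
        ![Language.Term.var 0, Language.Term.var 1], ?_⟩
      ext v
      simp only [Set.mem_ofPred_eq]
      exact (Emb.mem (ι := ι) _ _).symm
    exact ⟨h.mono (Set.empty_subset _)⟩

theorem Dfn.ex_range [Finite α] {P : (α → M) → M → Prop}
    (h : Dfn ι A fun w : Option α → M => P (fun a => w (some a)) (w none)) :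
    Dfn ι A fun v => ∃ n, P v (ι n) := by
  have h1 := (h.rename fun o : Option α => o.elim (Sum.inr ()) Sum.inl).exists_tuple (β := Unit)
  refine h1.congr fun v => ⟨?_, ?_⟩
  · rintro ⟨n, hn⟩
    exact ⟨fun _ => n, hn⟩
  · rintro ⟨n, hn⟩
    exact ⟨n (), hn⟩

end Definability

/-! ### Definability over a structure with parameters -/

section Params

variable {M : Type u} [SetStructure M] {α : Type}

instance Emb.id : Emb (id : M → M) := ⟨Function.injective_id, fun _ _ => Iff.rfl⟩

/-- Definability of a unary predicate over `M` with parameters. -/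
abbrev MD1 (P : M → Prop) : Prop := Dfn (id : M → M) Set.univ fun v : Fin 1 → M => P (v 0)

/-- Definability of a binary relation over `M` with parameters. -/
abbrev MD2 (R : M → M → Prop) : Prop :=
  Dfn (id : M → M) Set.univ fun v : Fin 2 → M => R (v 0) (v 1)

/-- Definability of a unary operation over `M` with parameters. -/
abbrev MF1 (g : M → M) : Prop := DTm (id : M → M) Set.univ fun v : Fin 1 → M => g (v 0)

instance DTm.const (c : M) : DTm (id : M → M) Set.univ fun _ : α → M => c := by
  refine ⟨fun v => ⟨c, rfl⟩, ?_⟩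
  have h : (Set.univ : Set M).Definable₁ setLang {c} :=
    Set.Definable.singleton_of_mem setLang (Set.mem_univ c)
  exact h.preimage_comp fun _ => none

instance Dfn.ex [Finite α] {P : (α → M) → M → Prop}
    [h : Dfn (id : M → M) Set.univ fun w : Option α → M => P (fun a => w (some a)) (w none)] :
    Dfn (id : M → M) Set.univ fun v => ∃ x, P v x := h.ex_range

instance Dfn.all [Finite α] {P : (α → M) → M → Prop}
    [h : Dfn (id : M → M) Set.univ fun w : Option α → M => P (fun a => w (some a)) (w none)] :
    Dfn (id : M → M) Set.univ fun v => ∀ x, P v x :=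
  Dfn.congr (P := fun v => ¬ ∃ x, ¬ P v x) inferInstance fun _ => by simp

instance Dfn.exUnique [Finite α] {P : (α → M) → M → Prop}
    [h : Dfn (id : M → M) Set.univ fun w : Option α → M => P (fun a => w (some a)) (w none)] :
    Dfn (id : M → M) Set.univ fun v => ∃! x, P v x := by
  have : Dfn (id : M → M) Set.univ fun w : Option (Option α) → M =>
      P (fun a => w (some (some a))) (w none) :=
    h.rename fun o : Option α => o.elim none fun a => some (some a)
  have : Dfn (id : M → M) Set.univ fun w : Option (Option α) → M =>
      P (fun a => w (some (some a))) (w (some none)) :=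
    h.rename fun o : Option α => o.elim (some none) fun a => some (some a)
  refine Dfn.congr (P := fun v => ∃ x, P v x ∧ ∀ y, P v y → y = x) inferInstance fun _ => Iff.rfl

end Params

/-! ### Elementary set theory in a model of `ZF` -/

section Basic

variable {M : Type u} [SetStructure M] {α : Type}

instance MD.sub [Finite α] {s t : (α → M) → M} [DTm id Set.univ s] [DTm id Set.univ t] :
    Dfn id Set.univ fun v => Sub (s v) (t v) :=
  Dfn.comp2 (by unfold Sub; infer_instance)

instance MD.isTrans [Finite α] {t : (α → M) → M} [DTm id Set.univ t] :
    Dfn id Set.univ fun v => IsTrans (t v) :=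
  Dfn.comp1 (by unfold IsTrans; infer_instance)

instance MD.isOrd [Finite α] {t : (α → M) → M} [DTm id Set.univ t] :
    Dfn id Set.univ fun v => IsOrd (t v) :=
  Dfn.comp1 (by unfold IsOrd; infer_instance)

variable [Nonempty M]

theorem mem_compr {P : M → Prop} (h : ∃ c, ∀ x, x ∈ₘ c ↔ P x) (x : M) : x ∈ₘ compr P ↔ P x :=
  Classical.epsilon_spec (p := fun c => ∀ x, x ∈ₘ c ↔ P x) h x

/-- All unsatisfiable predicates coincide, so all failing comprehensions share one default value. -/
theorem epsilon_eq_of_not_exists {p q : M → Prop} (hp : ¬ ∃ x, p x) (hq : ¬ ∃ x, q x) :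
    Classical.epsilon p = Classical.epsilon q := by
  have : p = q := by
    funext x
    exact propext ⟨fun h => (hp ⟨x, h⟩).elim, fun h => (hq ⟨x, h⟩).elim⟩
  rw [this]

variable [hM : Fact (ModelsZF M)]

theorem ext {a b : M} (h : ∀ x, x ∈ₘ a ↔ x ∈ₘ b) : a = b := hM.out.extensionality a b h

theorem Sub.antisymm {a b : M} (h : Sub a b) (h' : Sub b a) : a = b :=
  ext fun x => ⟨h x, h' x⟩

theorem Sub.refl (a : M) : Sub a a := fun _ h => h

theorem Sub.trans {a b c : M} (h : Sub a b) (h' : Sub b c) : Sub a c := fun x hx => h' x (h x hx)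

theorem compr_eq {P : M → Prop} {c : M} (h : ∀ x, x ∈ₘ c ↔ P x) : compr P = c :=
  ext fun x => by rw [mem_compr ⟨c, h⟩, h]

/-- The graph stays definable where the comprehension fails: the term then takes the common default
value, which is named through Russell's class and used as a parameter. -/
instance DTm.compr [Finite α] {P : (α → M) → M → Prop}
    [h : Dfn (id : M → M) Set.univ fun w : Option α → M => P (fun a => w (some a)) (w none)] :
    DTm (id : M → M) Set.univ fun v => compr fun x => P v x := by
  refine ⟨fun v => ⟨_, rfl⟩, ?_⟩
  have h1 : Dfn (id : M → M) Set.univ fun w : Option (Option (Option α)) → M =>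
      P (fun a => w (some (some (some a)))) (w none) :=
    h.rename fun o : Option α => o.elim none fun a => some (some (some a))
  have h2 : Dfn (id : M → M) Set.univ fun w : Option (Option α) → M =>
      P (fun a => w (some (some a))) (w none) :=
    h.rename fun o : Option α => o.elim none fun a => some (some a)
  have : Dfn (id : M → M) Set.univ fun w : Option α → M =>
      (∀ x, x ∈ₘ w none ↔ P (fun a => w (some a)) x) ∨
        (¬ ∃ c, ∀ x, x ∈ₘ c ↔ P (fun a => w (some a)) x) ∧
          w none = KunenTree.compr fun x => x ∉ ({x | x ∈ₘ x} : Set M) := inferInstance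
  refine (this.congr (Q := fun w => w none = KunenTree.compr fun x =>
    P (fun a => w (some a)) x) fun w => ?_).out
  have hR : ¬ ∃ c : M, ∀ x, x ∈ₘ c ↔ x ∉ ({x | x ∈ₘ x} : Set M) := by
    rintro ⟨c, hc⟩
    have : c ∈ₘ c ↔ ¬ c ∈ₘ c := hc c
    tauto
  by_cases hc : ∃ c, ∀ x, x ∈ₘ c ↔ P (fun a => id (w (some a))) x
  · constructor
    · intro e
      left
      intro x
      rw [e, mem_compr hc]
    · rintro (e | ⟨e, -⟩)
      · exact (compr_eq e).symm
      · exact (e hc).elim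
  · have e : KunenTree.compr (fun x => P (fun a => id (w (some a))) x)
        = KunenTree.compr fun x => x ∉ ({x | x ∈ₘ x} : Set M) := epsilon_eq_of_not_exists hc hR
    rw [e]
    constructor
    · intro h
      exact Or.inr ⟨hc, h⟩
    · rintro (h | h)
      · exact (hc ⟨_, h⟩).elim
      · exact h.2

/-! #### Separation, replacement, foundation -/

theorem sep (P : M → Prop) [h : MD1 P] (a : M) : ∃ c, ∀ x, x ∈ₘ c ↔ x ∈ₘ a ∧ P x :=
  hM.out.separation {x | P x} h.out a

theorem compr_sep {P : M → Prop} [h : MD1 P] {a : M} (ha : ∀ x, P x → x ∈ₘ a) (x : M) :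
    x ∈ₘ compr P ↔ P x := by
  obtain ⟨c, hc⟩ := sep P a
  exact mem_compr ⟨c, fun x => by rw [hc]; exact ⟨fun h => h.2, fun h => ⟨ha x h, h⟩⟩⟩ x

/-- Separation first cuts `a` down to the domain of `R`, so that the Replacement axiom, which asks
for total relations, extends to partial ones. -/
theorem repl_rel (R : M → M → Prop) [h : MD2 R] (a : M)
    (hR : ∀ x, x ∈ₘ a → ∀ y z, R x y → R x z → y = z) :
    ∃ c, ∀ y, y ∈ₘ c ↔ ∃ x, x ∈ₘ a ∧ R x y := by
  have h' : ∀ {β : Type} [Finite β] {s t : (β → M) → M} [DTm id Set.univ s] [DTm id Set.univ t],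
    Dfn id Set.univ fun v => R (s v) (t v) := Dfn.comp2 h
  obtain ⟨b, hb⟩ := sep (fun x => ∃ y, R x y) a
  obtain ⟨c, hc⟩ := hM.out.replacement R h.out b (by
    intro x hx
    obtain ⟨hxa, y, hy⟩ := (hb x).1 hx
    exact ⟨y, hy, fun z hz => hR x hxa _ _ hz hy⟩)
  refine ⟨c, fun y => ?_⟩
  rw [hc]
  constructor
  · rintro ⟨x, hx, hy⟩
    exact ⟨x, ((hb x).1 hx).1, hy⟩
  · rintro ⟨x, hx, hy⟩
    exact ⟨x, (hb x).2 ⟨hx, y, hy⟩, hy⟩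

theorem repl (g : M → M) [h : MF1 g] (a : M) : ∃ c, ∀ y, y ∈ₘ c ↔ ∃ x, x ∈ₘ a ∧ y = g x := by
  have h' : ∀ {β : Type} {s : (β → M) → M} [DTm id Set.univ s],
    DTm id Set.univ fun v => g (s v) := DTm.comp1 h
  exact repl_rel (fun x y => y = g x) a (by rintro x - y z rfl rfl; rfl)

theorem exists_minimal (P : M → Prop) [MD1 P] {a x : M} (hx : x ∈ₘ a) (hP : P x) :
    ∃ x, x ∈ₘ a ∧ P x ∧ ∀ y, y ∈ₘ x → y ∈ₘ a → ¬ P y := by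
  obtain ⟨c, hc⟩ := sep P a
  obtain ⟨z, hz, hz'⟩ := hM.out.foundation c ⟨x, (hc x).2 ⟨hx, hP⟩⟩
  refine ⟨z, ((hc z).1 hz).1, ((hc z).1 hz).2, fun y hy hya hPy => hz' y hy ?_⟩
  exact (hc y).2 ⟨hya, hPy⟩

/-! #### Basic operations -/

theorem mem_empty (x : M) : ¬ x ∈ₘ (empty : M) := by
  obtain ⟨w, ⟨e, -, he⟩, -⟩ := hM.out.infinity
  have := mem_compr (P := fun _ : M => False) ⟨e, fun x => by simpa using he x⟩ x
  exact this.1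

theorem eq_empty {a : M} (h : ∀ x, ¬ x ∈ₘ a) : a = empty :=
  ext fun x => ⟨fun hx => (h x hx).elim, fun hx => (mem_empty x hx).elim⟩

@[simp] theorem mem_upair {a b x : M} : x ∈ₘ upair a b ↔ x = a ∨ x = b :=
  mem_compr (P := fun x => x = a ∨ x = b) (hM.out.pairing a b) x

instance MF.upair [Finite α] {s t : (α → M) → M} [DTm id Set.univ s] [DTm id Set.univ t] :
    DTm id Set.univ fun v => upair (s v) (t v) :=
  DTm.comp2 (by unfold KunenTree.upair; infer_instance)

instance MF.kpair [Finite α] {s t : (α → M) → M} [DTm id Set.univ s] [DTm id Set.univ t] :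
    DTm id Set.univ fun v => kpair (s v) (t v) :=
  DTm.comp2 (by unfold KunenTree.kpair; infer_instance)

theorem upair_inj {a b c d : M} (h : upair a b = upair c d) :
    (a = c ∧ b = d) ∨ (a = d ∧ b = c) := by
  have h1 : ∀ x, (x = a ∨ x = b) ↔ (x = c ∨ x = d) := fun x => by
    rw [← mem_upair, ← mem_upair, h]
  have ha := (h1 a).1 (Or.inl rfl)
  have hb := (h1 b).1 (Or.inr rfl)
  have hc := (h1 c).2 (Or.inl rfl)
  have hd := (h1 d).2 (Or.inr rfl)
  grind

theorem kpair_inj {a b c d : M} (h : kpair a b = kpair c d) : a = c ∧ b = d := by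
  unfold kpair at h
  rcases upair_inj h with ⟨h1, h2⟩ | ⟨h1, h2⟩ <;> have h1 := upair_inj h1 <;>
    have h2 := upair_inj h2 <;> grind

@[simp] theorem kpair_inj_iff {a b c d : M} : kpair a b = kpair c d ↔ a = c ∧ b = d :=
  ⟨kpair_inj, by rintro ⟨rfl, rfl⟩; rfl⟩

/-- The union of the elements of `a`. -/
noncomputable def sUnion (a : M) : M := compr fun x => ∃ y, y ∈ₘ a ∧ x ∈ₘ y

@[simp] theorem mem_sUnion {a x : M} : x ∈ₘ sUnion a ↔ ∃ y, y ∈ₘ a ∧ x ∈ₘ y :=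
  mem_compr (P := fun x => ∃ y, y ∈ₘ a ∧ x ∈ₘ y) (hM.out.union a) x

/-- The power set of `a`. -/
noncomputable def pow (a : M) : M := compr fun x => Sub x a

@[simp] theorem mem_pow {a x : M} : x ∈ₘ pow a ↔ Sub x a :=
  mem_compr (P := fun x => Sub x a) (hM.out.powerset a) x

instance MF.pow [Finite α] {t : (α → M) → M} [DTm id Set.univ t] :
    DTm id Set.univ fun v => pow (t v) :=
  DTm.comp1 (by unfold KunenTree.pow; infer_instance)

theorem exists_union (a b : M) : ∃ c, ∀ x, x ∈ₘ c ↔ x ∈ₘ a ∨ x ∈ₘ b :=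
  ⟨sUnion (upair a b), fun x => by simp⟩

theorem exists_insert (a b : M) : ∃ c, ∀ x, x ∈ₘ c ↔ x ∈ₘ a ∨ x = b := by
  obtain ⟨c, hc⟩ := exists_union a (upair b b)
  exact ⟨c, fun x => by simp [hc]⟩

@[simp] theorem mem_succ {a x : M} : x ∈ₘ succ a ↔ x ∈ₘ a ∨ x = a :=
  mem_compr (P := fun x => x ∈ₘ a ∨ x = a) (exists_insert a a) x

instance MF.succ [Finite α] {t : (α → M) → M} [DTm id Set.univ t] :
    DTm id Set.univ fun v => succ (t v) :=
  DTm.comp1 (by unfold KunenTree.succ; infer_instance)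

theorem mem_succ_self (a : M) : a ∈ₘ succ a := mem_succ.2 (Or.inr rfl)

theorem mem_irrefl (a : M) : ¬ a ∈ₘ a := by
  intro h
  obtain ⟨x, hx, h'⟩ := hM.out.foundation (upair a a) ⟨a, by simp⟩
  obtain rfl : x = a := by simpa using hx
  exact h' x h (by simp)

theorem mem_asymm {a b : M} (h : a ∈ₘ b) : ¬ b ∈ₘ a := by
  intro h2
  obtain ⟨x, hx, h'⟩ := hM.out.foundation (upair a b) ⟨a, by simp⟩
  rcases mem_upair.1 hx with rfl | rfl
  · exact h' _ h2 (by simp)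
  · exact h' _ h (by simp)

theorem succ_inj {a b : M} (h : succ a = succ b) : a = b := by
  have h1 : a ∈ₘ succ b := h ▸ mem_succ_self a
  have h2 : b ∈ₘ succ a := h ▸ mem_succ_self b
  rw [mem_succ] at h1 h2
  rcases h1 with h1 | h1
  · rcases h2 with h2 | h2
    · exact (mem_asymm h1 h2).elim
    · exact h2.symm
  · exact h1

theorem succ_ne_empty (a : M) : succ a ≠ empty := fun h => mem_empty a (h ▸ mem_succ_self a)

/-! #### Functions -/

/-- The union of the values of `f` at `x`; for functions this is the value. -/
noncomputable def ap (f x : M) : M := compr fun z => ∃ y, kpair x y ∈ₘ f ∧ z ∈ₘ y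

instance MF.ap [Finite α] {s t : (α → M) → M} [DTm id Set.univ s] [DTm id Set.univ t] :
    DTm id Set.univ fun v => ap (s v) (t v) :=
  DTm.comp2 (by unfold KunenTree.ap; infer_instance)

instance MD.isFun [Finite α] {s t : (α → M) → M} [DTm id Set.univ s] [DTm id Set.univ t] :
    Dfn id Set.univ fun v => IsFun (s v) (t v) :=
  Dfn.comp2 (by unfold IsFun; infer_instance)

theorem IsFun.kpair_app {f A x : M} (hf : IsFun f A) (hx : x ∈ₘ A) : kpair x (app f x) ∈ₘ f :=
  Classical.epsilon_spec (p := fun y => kpair x y ∈ₘ f) (hf.2 x hx).exists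

theorem IsFun.mem_dom {f A x y : M} (hf : IsFun f A) (h : kpair x y ∈ₘ f) : x ∈ₘ A := by
  obtain ⟨x', y', hx, e⟩ := hf.1 _ h
  rwa [(kpair_inj e).1]

theorem IsFun.app_eq {f A x y : M} (hf : IsFun f A) (h : kpair x y ∈ₘ f) : app f x = y :=
  (hf.2 x (hf.mem_dom h)).unique (hf.kpair_app (hf.mem_dom h)) h

theorem IsFun.kpair_mem_iff {f A x y : M} (hf : IsFun f A) :
    kpair x y ∈ₘ f ↔ x ∈ₘ A ∧ app f x = y :=
  ⟨fun h => ⟨hf.mem_dom h, hf.app_eq h⟩, fun h => h.2 ▸ hf.kpair_app h.1⟩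

/-- `app` picks a value by an external choice, while `ap` is a comprehension and therefore covered
by `Dfn` and `DTm`. The pairs `dbl`/`double`, `sh`/`shift`, `fl`/`flatF` and `Vd`/`V` below serve
the same purpose. -/
theorem IsFun.ap_eq {f A x : M} (hf : IsFun f A) (hx : x ∈ₘ A) : ap f x = app f x := by
  refine compr_eq fun z => ?_
  constructor
  · intro h
    exact ⟨_, hf.kpair_app hx, h⟩
  · rintro ⟨y, hy, hz⟩
    rwa [hf.app_eq hy]

theorem exists_fun_rel (R : M → M → Prop) [h : MD2 R] {A : M}
    (hR : ∀ x, x ∈ₘ A → ∃! y, R x y) : ∃ f, IsFun f A ∧ ∀ x, x ∈ₘ A → R x (app f x) := by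
  have h' : ∀ {β : Type} [Finite β] {s t : (β → M) → M} [DTm id Set.univ s] [DTm id Set.univ t],
    Dfn id Set.univ fun v => R (s v) (t v) := Dfn.comp2 h
  obtain ⟨f, hf⟩ := repl_rel (fun x p => ∃ y, R x y ∧ p = kpair x y) A (by
    rintro x hx _ _ ⟨y, hy, rfl⟩ ⟨z, hz, rfl⟩
    rw [(hR x hx).unique hy hz])
  have key : ∀ x y, kpair x y ∈ₘ f ↔ x ∈ₘ A ∧ R x y := by
    intro x y
    rw [hf]
    constructor
    · rintro ⟨x', hx', y', hy', e⟩
      obtain ⟨rfl, rfl⟩ := kpair_inj e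
      exact ⟨hx', hy'⟩
    · rintro ⟨hx, hy⟩
      exact ⟨x, hx, y, hy, rfl⟩
  have hfun : IsFun f A := by
    constructor
    · intro p hp
      obtain ⟨x, hx, y, -, rfl⟩ := (hf p).1 hp
      exact ⟨x, y, hx, rfl⟩
    · intro x hx
      obtain ⟨y, hy, hu⟩ := hR x hx
      exact ⟨y, (key x y).2 ⟨hx, hy⟩, fun z hz => hu z ((key x z).1 hz).2⟩
  exact ⟨f, hfun, fun x hx => ((key x _).1 (hfun.kpair_app hx)).2⟩

theorem exists_fun (g : M → M) [h : MF1 g] (A : M) :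
    ∃ f, IsFun f A ∧ ∀ x, x ∈ₘ A → app f x = g x := by
  have h' : ∀ {β : Type} {s : (β → M) → M} [DTm id Set.univ s],
    DTm id Set.univ fun v => g (s v) := DTm.comp1 h
  exact exists_fun_rel (fun x y => y = g x) fun x _ => ⟨g x, rfl, fun _ h => h⟩

end Basic

/-! ### Ordinals, natural numbers, recursion and the cumulative hierarchy -/

section Ordinals

variable {M : Type u} [SetStructure M] {α : Type} [Nonempty M] [hM : Fact (ModelsZF M)]

theorem IsOrd.mem {a b : M} (ha : IsOrd a) (hb : b ∈ₘ a) : IsOrd b :=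
  ⟨ha.2 b hb, fun x hx => ha.2 x (ha.1 b hb x hx)⟩

theorem IsOrd.succ {a : M} (ha : IsOrd a) : IsOrd (succ a) := by
  constructor
  · intro x hx y hy
    rcases mem_succ.1 hx with hx | rfl
    · exact mem_succ.2 (Or.inl (ha.1 x hx y hy))
    · exact mem_succ.2 (Or.inl hy)
  · intro x hx
    rcases mem_succ.1 hx with hx | rfl
    · exact ha.2 x hx
    · exact ha.1

theorem IsOrd.trichotomy {a b : M} (ha : IsOrd a) (hb : IsOrd b) :
    a ∈ₘ b ∨ a = b ∨ b ∈ₘ a := by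
  by_contra hab
  -- Double minimality: `x` is minimal among the ordinals incomparable with some ordinal up to `b`,
  -- and `z` is minimal among those incomparable with `x`. Then `x` and `z` have the same elements.
  obtain ⟨x, hx, ⟨y, hy, hxy⟩, hmin⟩ := exists_minimal
    (fun x => ∃ y, y ∈ₘ KunenTree.succ b ∧ ¬ (x ∈ₘ y ∨ x = y ∨ y ∈ₘ x)) (mem_succ_self a)
    ⟨b, mem_succ_self b, hab⟩
  obtain ⟨z, hz, hxz, hmin'⟩ := exists_minimal
    (fun y => ¬ (x ∈ₘ y ∨ x = y ∨ y ∈ₘ x)) hy hxy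
  have ox := ha.succ.mem hx
  have oz := hb.succ.mem hz
  apply hxz
  right; left
  apply Sub.antisymm
  · intro t ht
    have := hmin t ht (ha.succ.1 x hx t ht)
    push Not at this
    rcases this z hz with h | rfl | h
    · exact h
    · exact (hxz (Or.inr (Or.inr ht))).elim
    · exact (hxz (Or.inr (Or.inr (ox.1 t ht z h)))).elim
  · intro t ht
    have := hmin' t ht (hb.succ.1 z hz t ht)
    push Not at this
    rcases this with h | rfl | h
    · exact (hxz (Or.inl (oz.1 t ht x h))).elim
    · exact (hxz (Or.inl ht)).elim
    · exact h

theorem IsOrd.mem_succ_of_sub {a b : M} (ha : IsOrd a) (hb : IsOrd b) (h : Sub a b) :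
    a ∈ₘ KunenTree.succ b := by
  rcases ha.trichotomy hb with h' | rfl | h'
  · exact mem_succ.2 (Or.inl h')
  · exact mem_succ_self _
  · exact (mem_irrefl b (h b h')).elim

theorem isOrd_empty : IsOrd (empty : M) :=
  ⟨fun x hx => (mem_empty x hx).elim, fun x hx => (mem_empty x hx).elim⟩

theorem IsLimit.mem {l a : M} (hl : IsLimit l) (ha : a ∈ₘ l) : IsOrd a := hl.1.mem ha

/-- Two elements of a limit ordinal are both below a third one. -/
theorem IsLimit.exists_upper {l a b : M} (hl : IsLimit l) (ha : a ∈ₘ l) (hb : b ∈ₘ l) :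
    ∃ c, c ∈ₘ l ∧ a ∈ₘ c ∧ b ∈ₘ c := by
  rcases (hl.mem ha).trichotomy (hl.mem hb) with h | rfl | h
  · exact ⟨succ b, hl.2.2 b hb, mem_succ.2 (Or.inl h), mem_succ_self b⟩
  · exact ⟨succ a, hl.2.2 a ha, mem_succ_self a, mem_succ_self a⟩
  · exact ⟨succ a, hl.2.2 a ha, mem_succ_self a, mem_succ.2 (Or.inl h)⟩

/-! #### Natural numbers -/

instance MF.empty [Finite α] : DTm id Set.univ fun _ : α → M => (empty : M) := DTm.const _

instance MD.isNat [Finite α] {t : (α → M) → M} [DTm id Set.univ t] :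
    Dfn id Set.univ fun v => IsNat (t v) :=
  Dfn.comp1 (by unfold IsNat; infer_instance)

theorem isNat_empty : IsNat (empty : M) := by
  refine ⟨isOrd_empty, fun m hm => ?_⟩
  rcases mem_succ.1 hm with h | rfl
  · exact (mem_empty m h).elim
  · exact Or.inl rfl

theorem IsNat.succ {n : M} (hn : IsNat n) : IsNat (succ n) := by
  refine ⟨hn.1.succ, fun m hm => ?_⟩
  rcases mem_succ.1 hm with h | rfl
  · exact hn.2 m h
  · exact Or.inr ⟨n, rfl⟩

theorem IsNat.mem_succ {n m : M} (hn : IsNat n) (hm : m ∈ₘ KunenTree.succ n) : IsNat m := by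
  refine ⟨hn.1.succ.mem hm, fun p hp => hn.2 p ?_⟩
  rcases KunenTree.mem_succ.1 hp with h | rfl
  · exact hn.1.succ.1 m hm p h
  · exact hm

theorem IsNat.mem {n m : M} (hn : IsNat n) (hm : m ∈ₘ n) : IsNat m :=
  hn.mem_succ (KunenTree.mem_succ.2 (Or.inl hm))

theorem IsNat.cases {n : M} (hn : IsNat n) : n = empty ∨ ∃ p, IsNat p ∧ n = KunenTree.succ p := by
  rcases hn.2 n (mem_succ_self n) with h | ⟨p, rfl⟩
  · exact Or.inl h
  · exact Or.inr ⟨p, hn.mem (mem_succ_self p), rfl⟩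

/-- Foundation gives a minimal counterexample inside `n + 1`, so the set of all natural numbers is
not needed. Definability of `P` is essential, since `M` may have nonstandard natural numbers. -/
theorem IsNat.induct (P : M → Prop) [MD1 P] (h0 : P empty)
    (hs : ∀ n, IsNat n → P n → P (KunenTree.succ n)) {n : M} (hn : IsNat n) : P n := by
  by_contra hP
  have : MD1 fun x => ¬ P x := Dfn.not
  obtain ⟨m, hm, hPm, hmin⟩ := exists_minimal (fun x => ¬ P x) (mem_succ_self n) hP
  rcases (hn.mem_succ hm).cases with rfl | ⟨p, hp, rfl⟩
  · exact hPm h0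
  · refine hPm (hs p hp ?_)
    have := hmin p (mem_succ_self p) (hn.1.succ.1 _ hm p (mem_succ_self p))
    exact not_not.1 this

theorem IsNat.succ_mem_succ {n i : M} (hn : IsNat n) (hi : i ∈ₘ n) :
    KunenTree.succ i ∈ₘ KunenTree.succ n := by
  refine (hn.1.mem hi).succ.mem_succ_of_sub hn.1 fun x hx => ?_
  rcases KunenTree.mem_succ.1 hx with h | rfl
  · exact hn.1.1 i hi x h
  · exact hi

theorem IsOrd.of_succ_mem_succ {n i : M} (hn : IsOrd n)
    (hi : KunenTree.succ i ∈ₘ KunenTree.succ n) : i ∈ₘ n := by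
  rcases KunenTree.mem_succ.1 hi with h | h
  · exact hn.1 _ h i (mem_succ_self i)
  · exact h ▸ mem_succ_self i

theorem IsNat.empty_mem_succ {n : M} (hn : IsNat n) : empty ∈ₘ KunenTree.succ n :=
  isOrd_empty.mem_succ_of_sub hn.1 fun x hx => (mem_empty x hx).elim

/-- An element of `n + 1` is zero or the successor of an element of `n`. -/
theorem IsNat.mem_succ_cases {n i : M} (hn : IsNat n) (hi : i ∈ₘ KunenTree.succ n) :
    i = empty ∨ ∃ p, p ∈ₘ n ∧ i = KunenTree.succ p := by
  rcases (hn.mem_succ hi).cases with rfl | ⟨p, hp, rfl⟩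
  · exact Or.inl rfl
  · exact Or.inr ⟨p, hn.1.of_succ_mem_succ hi, rfl⟩

theorem IsLimit.empty_mem {l : M} (hl : IsLimit l) : empty ∈ₘ l := by
  obtain ⟨x, hx⟩ := hl.2.1
  rcases isOrd_empty.trichotomy hl.1 with h | h | h
  · exact h
  · exact (mem_empty x (h ▸ hx)).elim
  · exact (mem_empty l h).elim

theorem IsLimit.nat_mem {l : M} (hl : IsLimit l) {n : M} (hn : IsNat n) : n ∈ₘ l :=
  IsNat.induct (fun n => n ∈ₘ l) hl.empty_mem (fun n _ h => hl.2.2 n h) hn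

theorem IsOrd.nat_mem_of_not_isNat {a : M} (ha : IsOrd a) (h : ¬ IsNat a) {n : M}
    (hn : IsNat n) : n ∈ₘ a := by
  rcases hn.1.trichotomy ha with h' | rfl | h'
  · exact h'
  · exact (h hn).elim
  · exact (h (hn.mem h')).elim

/-! #### Recursion along a well-founded relation on a set -/

/-- `f` satisfies on `D` the recursion `f(x) = ⋃_{y < x} h(f(y))`. -/
def SolvesRec (lt : M → M → Prop) (h : M → M) (D f : M) : Prop :=
  ∀ x, x ∈ₘ D → ∀ z, z ∈ₘ ap f x ↔ ∃ y, y ∈ₘ D ∧ lt y x ∧ z ∈ₘ h (ap f y)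

/-- At a minimal point of disagreement the predecessors carry equal values. The domains may differ,
provided their common elements have the same predecessors in both; this permits gluing of partial
solutions. -/
theorem SolvesRec.agree {lt : M → M → Prop} {h : M → M} {D D' f f' : M}
    (hf : SolvesRec lt h D f) (hf' : SolvesRec lt h D' f')
    (hD : ∀ x y, x ∈ₘ D → x ∈ₘ D' → lt y x → (y ∈ₘ D ↔ y ∈ₘ D'))
    (wf : ∀ Z, Sub Z D → (∃ x, x ∈ₘ Z) → ∃ x, x ∈ₘ Z ∧ ∀ y, y ∈ₘ Z → ¬ lt y x)
    {x : M} (hx : x ∈ₘ D) (hx' : x ∈ₘ D') : ap f x = ap f' x := by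
  by_contra hne
  obtain ⟨Z, hZ⟩ := sep (fun x => x ∈ₘ D' ∧ ap f x ≠ ap f' x) D
  obtain ⟨x, hxZ, hmin⟩ := wf Z (fun x hx => ((hZ x).1 hx).1) ⟨x, (hZ x).2 ⟨hx, hx', hne⟩⟩
  obtain ⟨hx, hx', hne⟩ := (hZ x).1 hxZ
  refine hne (ext fun z => ?_)
  rw [hf x hx, hf' x hx']
  have key : ∀ y, y ∈ₘ D → lt y x → ap f y = ap f' y := by
    intro y hy hlt
    by_contra h
    exact hmin y ((hZ y).2 ⟨hy, (hD x y hx hx' hlt).1 hy, h⟩) hlt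
  constructor
  · rintro ⟨y, hy, hlt, h⟩
    exact ⟨y, (hD x y hx hx' hlt).1 hy, hlt, key y hy hlt ▸ h⟩
  · rintro ⟨y, hy, hlt, h⟩
    have hy' := (hD x y hx hx' hlt).2 hy
    exact ⟨y, hy', hlt, (key y hy' hlt).symm ▸ h⟩

/-- This serves three recursions: the cumulative hierarchy (`h = pow`), doubling (`h` adds two) and
the collapse of nodes (`h(y) = {y}`, along one-step extension). Attempts, which are solutions on
downward closed subsets of `A`, agree where both are defined, so they glue to a largest attempt. If
its domain were not `A`, it could be extended at a minimal missing point. -/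
theorem exists_solvesRec (lt : M → M → Prop) [hlt : MD2 lt] (h : M → M) [hh : MF1 h] {A : M}
    (wf : ∀ Z, Sub Z A → (∃ x, x ∈ₘ Z) → ∃ x, x ∈ₘ Z ∧ ∀ y, y ∈ₘ Z → ¬ lt y x) :
    ∃ f, IsFun f A ∧ SolvesRec lt h A f := by
  have i1 : ∀ {β : Type} [Finite β] {s t : (β → M) → M} [DTm id Set.univ s] [DTm id Set.univ t],
    Dfn id Set.univ fun v => lt (s v) (t v) := Dfn.comp2 hlt
  have i2 : ∀ {β : Type} {s : (β → M) → M} [DTm id Set.univ s],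
    DTm id Set.univ fun v => h (s v) := DTm.comp1 hh
  have i3 : ∀ {β : Type} [Finite β] {s t : (β → M) → M} [DTm id Set.univ s] [DTm id Set.univ t],
    Dfn id Set.univ fun v => SolvesRec lt h (s v) (t v) :=
      Dfn.comp2 (by unfold SolvesRec; infer_instance)
  let Att : M → M → Prop := fun D f => IsFun f D ∧ Sub D A ∧
    (∀ x, x ∈ₘ D → ∀ y, y ∈ₘ A → lt y x → y ∈ₘ D) ∧ SolvesRec lt h D f
  have i4 : ∀ {β : Type} [Finite β] {s t : (β → M) → M} [DTm id Set.univ s] [DTm id Set.univ t],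
    Dfn id Set.univ fun v => Att (s v) (t v) :=
      Dfn.comp2 (by simp only [Att]; infer_instance)
  have agree : ∀ {D f D' f' x}, Att D f → Att D' f' → x ∈ₘ D → x ∈ₘ D' → ap f x = ap f' x := by
    rintro D f D' f' x ⟨-, hD, hd, hr⟩ ⟨-, hD', hd', hr'⟩ hx hx'
    exact hr.agree hr' (fun x y hx hx' hlt => ⟨fun hy => hd' x hx' y (hD y hy) hlt,
      fun hy => hd x hx y (hD' y hy) hlt⟩) (fun Z hZ => wf Z (hZ.trans hD)) hx hx'
  obtain ⟨D, hD⟩ := sep (fun x => ∃ D f, Att D f ∧ x ∈ₘ D) A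
  obtain ⟨F, hF, hFv⟩ := exists_fun_rel (fun x y => ∃ D f, Att D f ∧ x ∈ₘ D ∧ y = ap f x)
    (A := D) (by
      intro x hx
      obtain ⟨-, D', f, hf, hxD⟩ := (hD x).1 hx
      refine ⟨ap f x, ⟨D', f, hf, hxD, rfl⟩, ?_⟩
      rintro _ ⟨D'', f', hf', hx', rfl⟩
      exact agree hf' hf hx' hxD)
  have hFa : ∀ {D' f x}, Att D' f → x ∈ₘ D' → ap F x = ap f x ∧ x ∈ₘ D := by
    intro D' f x hf hx
    have hxD : x ∈ₘ D := (hD x).2 ⟨hf.2.1 x hx, D', f, hf, hx⟩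
    obtain ⟨D'', f', hf', hx', e⟩ := hFv x hxD
    rw [hF.ap_eq hxD, e]
    exact ⟨agree hf' hf hx' hx, hxD⟩
  have hAttF : Att D F := by
    refine ⟨hF, fun x hx => ((hD x).1 hx).1, ?_, ?_⟩
    · intro x hx y hy hlt
      obtain ⟨-, D', f, hf, hxD⟩ := (hD x).1 hx
      exact (hFa hf (hf.2.2.1 x hxD y hy hlt)).2
    · intro x hx z
      obtain ⟨-, D', f, hf, hxD⟩ := (hD x).1 hx
      rw [(hFa hf hxD).1, hf.2.2.2 x hxD]
      constructor
      · rintro ⟨y, hy, hlt, hz⟩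
        exact ⟨y, (hFa hf hy).2, hlt, (hFa hf hy).1.symm ▸ hz⟩
      · rintro ⟨y, hy, hlt, hz⟩
        have hy' := hf.2.2.1 x hxD y ((hD y).1 hy).1 hlt
        exact ⟨y, hy', hlt, (hFa hf hy').1 ▸ hz⟩
  by_cases hDA : Sub A D
  · have : D = A := Sub.antisymm hAttF.2.1 hDA
    subst this
    exact ⟨F, hF, hAttF.2.2.2⟩
  exfalso
  obtain ⟨Z, hZ⟩ := sep (fun x => ¬ x ∈ₘ D) A
  obtain ⟨x, hxZ, hmin⟩ := wf Z (fun x hx => ((hZ x).1 hx).1) (by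
    by_contra! hne
    refine hDA fun x hx => ?_
    by_contra hxD
    exact hne x ((hZ x).2 ⟨hx, hxD⟩))
  obtain ⟨hxA, hxD⟩ := (hZ x).1 hxZ
  have hpred : ∀ y, y ∈ₘ A → lt y x → y ∈ₘ D := by
    intro y hy hlt
    by_contra hyD
    exact hmin y ((hZ y).2 ⟨hy, hyD⟩) hlt
  obtain ⟨P, hP⟩ := sep (fun y => lt y x) D
  obtain ⟨I, hI⟩ := repl (fun y => h (ap F y)) P
  obtain ⟨D', hD'⟩ := exists_insert D x
  -- The new value at `x` is the union of the `h(F(y))` over the predecessors `y` of `x`. The case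
  -- distinction sits inside one comprehension, which keeps it definable.
  obtain ⟨F', hF', hFv'⟩ := exists_fun
    (fun y => compr fun z => (y = x ∧ z ∈ₘ sUnion I) ∨ (y ≠ x ∧ z ∈ₘ ap F y)) D'
  have e1 : ap F' x = sUnion I := by
    have hx' : x ∈ₘ D' := (hD' x).2 (Or.inr rfl)
    rw [hF'.ap_eq hx', hFv' x hx']
    exact compr_eq fun z => by simp
  have e2 : ∀ y, y ∈ₘ D → ap F' y = ap F y := by
    intro y hy
    have hyx : y ≠ x := by rintro rfl; exact hxD hy
    have hy' : y ∈ₘ D' := (hD' y).2 (Or.inl hy)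
    rw [hF'.ap_eq hy', hFv' y hy']
    exact compr_eq fun z => by simp [hyx]
  have hdown : ∀ z, z ∈ₘ D' → ∀ y, y ∈ₘ A → lt y z → y ∈ₘ D := by
    intro z hz y hy hlt
    rcases (hD' z).1 hz with hz | rfl
    · exact hAttF.2.2.1 z hz y hy hlt
    · exact hpred y hy hlt
  have hD'A : Sub D' A := by
    intro z hz
    rcases (hD' z).1 hz with hz | rfl
    · exact hAttF.2.1 z hz
    · exact hxA
  have : Att D' F' := by
    refine ⟨hF', hD'A, fun z hz y hy hlt => (hD' y).2 (Or.inl (hdown z hz y hy hlt)), ?_⟩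
    intro y hy z
    have hr : (∃ w, w ∈ₘ D' ∧ lt w y ∧ z ∈ₘ h (ap F' w)) ↔
        ∃ w, w ∈ₘ D ∧ lt w y ∧ z ∈ₘ h (ap F w) := by
      constructor
      · rintro ⟨w, hw, hlt, hz⟩
        have hwD := hdown y hy w (hD'A w hw) hlt
        exact ⟨w, hwD, hlt, e2 w hwD ▸ hz⟩
      · rintro ⟨w, hw, hlt, hz⟩
        exact ⟨w, (hD' w).2 (Or.inl hw), hlt, (e2 w hw).symm ▸ hz⟩
    rw [hr]
    rcases (hD' y).1 hy with hyD | rfl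
    · rw [e2 y hyD]
      exact hAttF.2.2.2 y hyD z
    · rw [e1, mem_sUnion]
      constructor
      · rintro ⟨_, hi, hz⟩
        obtain ⟨w, hw, rfl⟩ := (hI _).1 hi
        exact ⟨w, ((hP w).1 hw).1, ((hP w).1 hw).2, hz⟩
      · rintro ⟨w, hw, hlt, hz⟩
        exact ⟨_, (hI _).2 ⟨w, (hP w).2 ⟨hw, hlt⟩, rfl⟩, hz⟩
  exact hxD ((hD x).2 ⟨hxA, D', F', this, (hD' x).2 (Or.inr rfl)⟩)

theorem mem_wf (A : M) :
    ∀ Z, Sub Z A → (∃ x, x ∈ₘ Z) → ∃ x, x ∈ₘ Z ∧ ∀ y, y ∈ₘ Z → ¬ y ∈ₘ x := by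
  intro Z _ h
  obtain ⟨x, hx, h⟩ := hM.out.foundation Z h
  exact ⟨x, hx, fun y hy hyx => h y hyx hy⟩

/-! #### The cumulative hierarchy -/

/-- `f` is the hierarchy function on `α + 1`. -/
def IsHier (a f : M) : Prop := IsFun f (succ a) ∧
  ∀ b, b ∈ₘ succ a → ∀ x, x ∈ₘ ap f b ↔ ∃ c, c ∈ₘ b ∧ Sub x (ap f c)

instance MD.isHier [Finite α] {s t : (α → M) → M} [DTm id Set.univ s] [DTm id Set.univ t] :
    Dfn id Set.univ fun v => IsHier (s v) (t v) :=
  Dfn.comp2 (by unfold IsHier; infer_instance)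

theorem isHier_iff {a f : M} (ha : IsOrd a) : IsHier a f ↔ IsFun f (succ a) ∧
    ∀ b, b ∈ₘ succ a → ∀ x, x ∈ₘ app f b ↔ ∃ c, c ∈ₘ b ∧ Sub x (app f c) := by
  refine and_congr_right fun hf => forall₂_congr fun b hb => forall_congr' fun x => ?_
  rw [hf.ap_eq hb]
  refine iff_congr Iff.rfl (exists_congr fun c => and_congr_right fun hc => ?_)
  rw [hf.ap_eq (ha.succ.1 b hb c hc)]

theorem exists_isHier {a : M} (ha : IsOrd a) : ∃ f, IsHier a f := by
  obtain ⟨f, hf, hr⟩ := exists_solvesRec (fun x y : M => x ∈ₘ y) pow (mem_wf (succ a))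
  refine ⟨f, hf, fun b hb x => ?_⟩
  rw [hr b hb]
  simp only [mem_pow]
  refine exists_congr fun c => ⟨fun h => h.2, fun h => ⟨ha.succ.1 b hb c h.1, h⟩⟩

theorem IsHier.agree {a a' f f' b : M} (ha : IsOrd a) (ha' : IsOrd a') (hf : IsHier a f)
    (hf' : IsHier a' f') (hb : b ∈ₘ succ a) (hb' : b ∈ₘ succ a') : ap f b = ap f' b := by
  by_contra hne
  obtain ⟨x, hx, ⟨hx', hne⟩, hmin⟩ := exists_minimal
    (fun b => b ∈ₘ succ a' ∧ ap f b ≠ ap f' b) hb ⟨hb', hne⟩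
  refine hne (ext fun z => ?_)
  rw [hf.2 x hx, hf'.2 x hx']
  refine exists_congr fun c => and_congr_right fun hc => ?_
  have := hmin c hc (ha.succ.1 x hx c hc)
  push Not at this
  rw [this (ha'.succ.1 x hx' c hc)]

theorem exists_isHier_V {a : M} (ha : IsOrd a) : ∃ f, IsHier a f ∧ ap f a = V a := by
  obtain ⟨f, hf⟩ := exists_isHier ha
  have : ∃ v, ∃ f, IsFun f (succ a) ∧
    (∀ β, β ∈ₘ succ a → ∀ x, x ∈ₘ app f β ↔ ∃ γ, γ ∈ₘ β ∧ Sub x (app f γ)) ∧ app f a = v :=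
    ⟨app f a, f, hf.1, ((isHier_iff ha).1 hf).2, rfl⟩
  obtain ⟨g, h1, h2, h3⟩ := Classical.epsilon_spec this
  exact ⟨g, (isHier_iff ha).2 ⟨h1, h2⟩, (h1.ap_eq (mem_succ_self a)).trans h3⟩

theorem IsHier.ap_eq_V {a f b : M} (ha : IsOrd a) (hf : IsHier a f) (hb : b ∈ₘ succ a) :
    ap f b = V b := by
  have ob := ha.succ.mem hb
  obtain ⟨g, hg, e⟩ := exists_isHier_V ob
  rw [← e]
  exact hf.agree ha ob hg hb (mem_succ_self b)

theorem mem_V {a x : M} (ha : IsOrd a) : x ∈ₘ V a ↔ ∃ c, c ∈ₘ a ∧ Sub x (V c) := by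
  obtain ⟨f, hf⟩ := exists_isHier ha
  rw [← hf.ap_eq_V ha (mem_succ_self a), hf.2 a (mem_succ_self a)]
  refine exists_congr fun c => and_congr_right fun hc => ?_
  rw [hf.ap_eq_V ha (mem_succ.2 (Or.inl hc))]

theorem V_mono {a b : M} (ha : IsOrd a) (hb : b ∈ₘ a) : Sub (V b) (V a) := by
  intro x hx
  obtain ⟨c, hc, h⟩ := (mem_V (ha.mem hb)).1 hx
  exact (mem_V ha).2 ⟨c, ha.1 b hb c hc, h⟩

theorem V_mem {a b : M} (ha : IsOrd a) (hb : b ∈ₘ a) : V b ∈ₘ V a :=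
  (mem_V ha).2 ⟨b, hb, Sub.refl _⟩

theorem V_trans {a : M} (ha : IsOrd a) : IsTrans (V a) := by
  intro x hx y hy
  obtain ⟨c, hc, h⟩ := (mem_V ha).1 hx
  exact V_mono ha hc y (h y hy)

theorem V_succ {a : M} (ha : IsOrd a) : V (succ a) = pow (V a) := by
  refine ext fun x => ?_
  rw [mem_V ha.succ, mem_pow]
  constructor
  · rintro ⟨c, hc, h⟩
    rcases mem_succ.1 hc with hc | rfl
    · exact h.trans (V_mono ha hc)
    · exact h
  · exact fun h => ⟨a, mem_succ_self a, h⟩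

theorem V_sub_closed {a x y : M} (ha : IsOrd a) (hx : x ∈ₘ V a) (h : Sub y x) : y ∈ₘ V a := by
  obtain ⟨c, hc, h'⟩ := (mem_V ha).1 hx
  exact (mem_V ha).2 ⟨c, hc, h.trans h'⟩

theorem IsOrd.sub_V {a : M} (ha : IsOrd a) : Sub a (V a) := by
  by_contra hne
  obtain ⟨f, hf⟩ := exists_isHier ha
  have e := fun b (hb : b ∈ₘ KunenTree.succ a) => hf.ap_eq_V ha hb
  obtain ⟨x, hx, hne, hmin⟩ := exists_minimal (fun b => ¬ Sub b (ap f b)) (mem_succ_self a)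
    (by rwa [e a (mem_succ_self a)])
  refine hne ?_
  rw [e x hx]
  intro y hy
  have hy' := ha.succ.1 x hx y hy
  have := hmin y hy hy'
  rw [e y hy', not_not] at this
  exact (mem_V (ha.succ.mem hx)).2 ⟨y, hy, this⟩

end Ordinals

/-! ### The flat coding operations -/

section Flat

variable {M : Type u} [SetStructure M] {α : Type} [Nonempty M] [hM : Fact (ModelsZF M)]

/-- `f` is the doubling function on `n + 1`. -/
def IsDblFun (n f : M) : Prop := IsFun f (succ n) ∧ ap f empty = empty ∧
  ∀ i, i ∈ₘ n → ap f (succ i) = succ (succ (ap f i))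

instance MD.isDblFun [Finite α] {s t : (α → M) → M} [DTm id Set.univ s] [DTm id Set.univ t] :
    Dfn id Set.univ fun v => IsDblFun (s v) (t v) :=
  Dfn.comp2 (by unfold IsDblFun; infer_instance)

theorem isDblFun_iff {n f : M} (hn : IsNat n) : IsDblFun n f ↔ IsFun f (succ n) ∧
    app f empty = empty ∧ ∀ i, i ∈ₘ n → app f (succ i) = succ (succ (app f i)) := by
  refine and_congr_right fun hf => ?_
  rw [hf.ap_eq hn.empty_mem_succ]
  refine and_congr_right fun _ => forall₂_congr fun i hi => ?_
  rw [hf.ap_eq (hn.succ_mem_succ hi), hf.ap_eq (mem_succ.2 (Or.inl hi))]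

/-- The recursion gives `f(i+1)` as the union of the `f(y) + 2` for `y ≤ i`. The terms with `y < i`
are already contained in `f(i)`, so only `f(i) + 2` remains; at `0` the union is empty. -/
theorem exists_isDblFun {n : M} (hn : IsNat n) : ∃ f, IsDblFun n f := by
  obtain ⟨f, hf, hr⟩ := exists_solvesRec (fun x y : M => x ∈ₘ y) (fun y => succ (succ y))
    (mem_wf (succ n))
  refine ⟨f, hf, ?_, fun i hi => ext fun z => ?_⟩
  · refine eq_empty fun x hx => ?_
    obtain ⟨y, -, hy, -⟩ := (hr _ hn.empty_mem_succ x).1 hx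
    exact mem_empty y hy
  · have hi' : i ∈ₘ succ n := mem_succ.2 (Or.inl hi)
    rw [hr _ (hn.succ_mem_succ hi)]
    constructor
    · rintro ⟨y, hy, hyi, hz⟩
      rcases mem_succ.1 hyi with hyi | rfl
      · exact mem_succ.2 (Or.inl (mem_succ.2 (Or.inl ((hr i hi' z).2 ⟨y, hy, hyi, hz⟩))))
      · exact hz
    · intro hz
      exact ⟨i, hi', mem_succ_self i, hz⟩

theorem IsDblFun.agree {n n' f f' i : M} (hn : IsNat n) (hn' : IsNat n') (hf : IsDblFun n f)
    (hf' : IsDblFun n' f') (hi : i ∈ₘ succ n) (hi' : i ∈ₘ succ n') : ap f i = ap f' i := by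
  refine IsNat.induct (fun i => i ∈ₘ succ n → i ∈ₘ succ n' → ap f i = ap f' i) ?_ ?_
    (hn.mem_succ hi) hi hi'
  · intro _ _
    rw [hf.2.1, hf'.2.1]
  · intro i _ ih hi hi'
    have h := hn.1.of_succ_mem_succ hi
    have h' := hn'.1.of_succ_mem_succ hi'
    rw [hf.2.2 i h, hf'.2.2 i h', ih (mem_succ.2 (Or.inl h)) (mem_succ.2 (Or.inl h'))]

theorem IsDblFun.ap_self {n f : M} (hn : IsNat n) (hf : IsDblFun n f) : ap f n = double n := by
  have : ∃ v, ∃ f, IsFun f (succ n) ∧ app f empty = empty ∧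
      (∀ i, i ∈ₘ n → app f (succ i) = succ (succ (app f i))) ∧ app f n = v := by
    obtain ⟨h1, h2, h3⟩ := (isDblFun_iff hn).1 hf
    exact ⟨app f n, f, h1, h2, h3, rfl⟩
  obtain ⟨g, h1, h2, h3, h4⟩ := Classical.epsilon_spec this
  have hg := (isDblFun_iff hn).2 ⟨h1, h2, h3⟩
  rw [hf.agree hn hn hg (mem_succ_self n) (mem_succ_self n), h1.ap_eq (mem_succ_self n)]
  exact h4

/-- A definable total version of `double`. -/
noncomputable def dbl (n : M) : M := compr fun z => ∃ f, IsDblFun n f ∧ z ∈ₘ ap f n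

instance MF.dbl [Finite α] {t : (α → M) → M} [DTm id Set.univ t] :
    DTm id Set.univ fun v => dbl (t v) :=
  DTm.comp1 (by unfold KunenTree.dbl; infer_instance)

theorem dbl_eq {n : M} (hn : IsNat n) : dbl n = double n := by
  refine compr_eq fun z => ?_
  constructor
  · intro hz
    obtain ⟨f, hf⟩ := exists_isDblFun hn
    exact ⟨f, hf, (hf.ap_self hn).symm ▸ hz⟩
  · rintro ⟨f, hf, hz⟩
    exact hf.ap_self hn ▸ hz

theorem dbl_empty : dbl (empty : M) = empty := by
  obtain ⟨f, hf⟩ := exists_isDblFun (isNat_empty (M := M))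
  rw [dbl_eq isNat_empty, ← hf.ap_self isNat_empty, hf.2.1]

theorem dbl_succ {n : M} (hn : IsNat n) : dbl (succ n) = succ (succ (dbl n)) := by
  obtain ⟨f, hf⟩ := exists_isDblFun hn.succ
  obtain ⟨g, hg⟩ := exists_isDblFun hn
  rw [dbl_eq hn.succ, dbl_eq hn, ← hf.ap_self hn.succ, ← hg.ap_self hn,
    hf.2.2 n (mem_succ_self n), hf.agree hn.succ hn hg _ (mem_succ_self n)]
  exact mem_succ.2 (Or.inl (mem_succ_self n))

theorem IsNat.dbl {n : M} (hn : IsNat n) : IsNat (dbl n) := by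
  refine IsNat.induct (fun n => IsNat (KunenTree.dbl n)) ?_ ?_ hn
  · rw [dbl_empty]; exact isNat_empty
  · intro n hn h
    rw [dbl_succ hn]
    exact h.succ.succ

theorem dbl_inj {n m : M} (hn : IsNat n) (hm : IsNat m) (h : dbl n = dbl m) : n = m := by
  refine IsNat.induct (fun n => ∀ m, IsNat m → dbl n = dbl m → n = m) ?_ ?_ hn m hm h
  · intro m hm h
    rcases hm.cases with rfl | ⟨p, hp, rfl⟩
    · rfl
    · rw [dbl_empty, dbl_succ hp] at h
      exact (succ_ne_empty _ h.symm).elim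
  · intro n hn ih m hm h
    rcases hm.cases with rfl | ⟨p, hp, rfl⟩
    · rw [dbl_empty, dbl_succ hn] at h
      exact (succ_ne_empty _ h).elim
    · rw [dbl_succ hn, dbl_succ hp] at h
      rw [ih p hp (succ_inj (succ_inj h))]

theorem dbl_ne_succ_dbl {n m : M} (hn : IsNat n) (hm : IsNat m) : dbl n ≠ succ (dbl m) := by
  refine IsNat.induct (fun n => ∀ m, IsNat m → dbl n ≠ succ (dbl m)) ?_ ?_ hn m hm
  · intro m hm h
    rw [dbl_empty] at h
    exact succ_ne_empty _ h.symm
  · intro n hn ih m hm h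
    rw [dbl_succ hn] at h
    rcases hm.cases with rfl | ⟨p, hp, rfl⟩
    · rw [dbl_empty] at h
      exact succ_ne_empty _ (succ_inj h)
    · rw [dbl_succ hp] at h
      exact ih p hp (succ_inj (succ_inj h))

/-- A definable version of `shift`. -/
noncomputable def sh (x : M) : M :=
  compr fun z => (IsNat x ∧ z ∈ₘ succ (dbl x)) ∨ (¬ IsNat x ∧ z ∈ₘ x)

instance MF.sh [Finite α] {t : (α → M) → M} [DTm id Set.univ t] :
    DTm id Set.univ fun v => sh (t v) :=
  DTm.comp1 (by unfold KunenTree.sh; infer_instance)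

theorem sh_of_isNat {x : M} (hx : IsNat x) : sh x = succ (dbl x) :=
  compr_eq fun z => by simp [hx]

theorem sh_of_not_isNat {x : M} (hx : ¬ IsNat x) : sh x = x :=
  compr_eq fun z => by simp [hx]

theorem shift_eq (x : M) : shift x = sh x := by
  by_cases hx : IsNat x
  · rw [sh_of_isNat hx, dbl_eq hx, shift, if_pos hx]
  · rw [sh_of_not_isNat hx, shift, if_neg hx]

theorem sh_inj {x y : M} (h : sh x = sh y) : x = y := by
  by_cases hx : IsNat x <;> by_cases hy : IsNat y
  · rw [sh_of_isNat hx, sh_of_isNat hy] at h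
    exact dbl_inj hx hy (succ_inj h)
  · rw [sh_of_isNat hx, sh_of_not_isNat hy] at h
    exact (hy (h ▸ hx.dbl.succ)).elim
  · rw [sh_of_not_isNat hx, sh_of_isNat hy] at h
    exact (hx (h ▸ hy.dbl.succ)).elim
  · rwa [sh_of_not_isNat hx, sh_of_not_isNat hy] at h

/-- Shifted elements are odd or not natural, while the markers are even. This separation is what
allows `n` and `a` to be recovered from `fl n a`. -/
theorem sh_ne_dbl {x i : M} (hi : IsNat i) : sh x ≠ dbl i := by
  intro h
  by_cases hx : IsNat x
  · rw [sh_of_isNat hx] at h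
    exact dbl_ne_succ_dbl hi hx h.symm
  · rw [sh_of_not_isNat hx] at h
    exact hx (h ▸ hi.dbl)

/-- A definable version of `flatF`. -/
noncomputable def fl (n a : M) : M :=
  compr fun y => (∃ x, x ∈ₘ a ∧ y = sh x) ∨ ∃ i, i ∈ₘ n ∧ IsNat i ∧ y = dbl i

instance MF.fl [Finite α] {s t : (α → M) → M} [DTm id Set.univ s] [DTm id Set.univ t] :
    DTm id Set.univ fun v => fl (s v) (t v) :=
  DTm.comp2 (by unfold KunenTree.fl; infer_instance)

theorem mem_fl {n a y : M} :
    y ∈ₘ fl n a ↔ (∃ x, x ∈ₘ a ∧ y = sh x) ∨ ∃ i, i ∈ₘ n ∧ IsNat i ∧ y = dbl i := by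
  obtain ⟨b, hb⟩ := repl (sh : M → M) a
  obtain ⟨c, hc⟩ := repl_rel (fun i y : M => IsNat i ∧ y = dbl i) n
    (by rintro i - _ _ ⟨-, rfl⟩ ⟨-, rfl⟩; rfl)
  obtain ⟨d, hd⟩ := exists_union b c
  exact mem_compr (P := fun y => (∃ x, x ∈ₘ a ∧ y = sh x) ∨ ∃ i, i ∈ₘ n ∧ IsNat i ∧ y = dbl i)
    ⟨d, fun y => by rw [hd, hb, hc]⟩ y

theorem flatF_eq {n : M} (hn : IsNat n) (a : M) : flatF n a = fl n a := by
  refine compr_eq fun y => ?_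
  rw [mem_fl]
  simp only [shift_eq]
  refine or_congr Iff.rfl (exists_congr fun i => ?_)
  constructor
  · rintro ⟨hi, h, rfl⟩
    exact ⟨hi, dbl_eq h⟩
  · rintro ⟨hi, rfl⟩
    exact ⟨hi, hn.mem hi, (dbl_eq (hn.mem hi)).symm⟩

theorem sh_mem_fl {n a x : M} : sh x ∈ₘ fl n a ↔ x ∈ₘ a := by
  rw [mem_fl]
  constructor
  · rintro (⟨y, hy, e⟩ | ⟨i, -, hi, e⟩)
    · exact sh_inj e ▸ hy
    · exact (sh_ne_dbl hi e).elim
  · exact fun h => Or.inl ⟨x, h, rfl⟩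

theorem dbl_mem_fl {n a i : M} (hi : IsNat i) : dbl i ∈ₘ fl n a ↔ i ∈ₘ n := by
  rw [mem_fl]
  constructor
  · rintro (⟨y, hy, e⟩ | ⟨j, hj, hj', e⟩)
    · exact (sh_ne_dbl hi e.symm).elim
    · exact dbl_inj hi hj' e ▸ hj
  · exact fun h => Or.inr ⟨i, h, hi, rfl⟩

theorem fl_inj {n m a b : M} (hn : IsNat n) (hm : IsNat m) (h : fl n a = fl m b) :
    n = m ∧ a = b := by
  constructor
  · refine ext fun i => ⟨fun hi => ?_, fun hi => ?_⟩
    · rw [← dbl_mem_fl (n := m) (a := b) (hn.mem hi), ← h, dbl_mem_fl (hn.mem hi)]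
      exact hi
    · rw [← dbl_mem_fl (n := n) (a := a) (hm.mem hi), h, dbl_mem_fl (hm.mem hi)]
      exact hi
  · exact ext fun x => by rw [← sh_mem_fl (n := n), h, sh_mem_fl]

end Flat

/-! ### Limit levels of the cumulative hierarchy -/

section Ambient

variable {M : Type u} [SetStructure M] {α : Type} [Nonempty M]

/-- `v` is a level of the cumulative hierarchy, as witnessed by the set `h ∈ L` of all the
previous levels. -/
def Lev (L v : M) : Prop := ∃ h, h ∈ₘ L ∧
  (∀ x, x ∈ₘ h → ∀ y, y ∈ₘ L → (y ∈ₘ x ↔ ∃ c, c ∈ₘ h ∧ c ∈ₘ x ∧ Sub y c)) ∧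
  ∀ y, y ∈ₘ L → (y ∈ₘ v ↔ ∃ c, c ∈ₘ h ∧ Sub y c)

/-- The closure properties of a level `V_λ`, for `λ` a limit ordinal, used below. -/
class Ambient (L : M) : Prop where
  trans : IsTrans L
  sub : ∀ x y : M, x ∈ₘ L → Sub y x → y ∈ₘ L
  nat : ∀ n : M, IsNat n → n ∈ₘ L
  upair : ∀ a b : M, a ∈ₘ L → b ∈ₘ L → upair a b ∈ₘ L
  insert : ∀ a b c : M, a ∈ₘ L → b ∈ₘ L → (∀ x, x ∈ₘ c ↔ x ∈ₘ a ∨ x = b) → c ∈ₘ L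
  fl : ∀ n a : M, IsNat n → a ∈ₘ L → fl n a ∈ₘ L
  exists_lev : ∀ a : M, a ∈ₘ L → ∃ v, v ∈ₘ L ∧ Lev L v ∧ a ∈ₘ v
  lev_total : ∀ v w : M, v ∈ₘ L → w ∈ₘ L → Lev L v → Lev L w → Sub v w ∨ w ∈ₘ v

variable [hM : Fact (ModelsZF M)]

/-- A definable version of `V`. -/
noncomputable def Vd (a : M) : M := compr fun z => ∃ f, IsHier a f ∧ z ∈ₘ ap f a

instance MF.Vd [Finite α] {t : (α → M) → M} [DTm id Set.univ t] :
    DTm id Set.univ fun v => Vd (t v) :=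
  DTm.comp1 (by unfold KunenTree.Vd; infer_instance)

theorem Vd_eq {a : M} (ha : IsOrd a) : Vd a = V a := by
  refine compr_eq fun z => ?_
  constructor
  · intro hz
    obtain ⟨f, hf⟩ := exists_isHier ha
    exact ⟨f, hf, (hf.ap_eq_V ha (mem_succ_self a)).symm ▸ hz⟩
  · rintro ⟨f, hf, hz⟩
    exact hf.ap_eq_V ha (mem_succ_self a) ▸ hz

variable {l : M} (hl : IsLimit l)
include hl

/-! ### Closure of `V_λ` under the coding operations -/

theorem mem_V_of_sub {a b : M} (hb : b ∈ₘ l) (h : Sub a (V b)) : a ∈ₘ V l :=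
  (mem_V hl.1).2 ⟨b, hb, h⟩

theorem exists_V_upper {a b : M} (ha : a ∈ₘ l) (hb : b ∈ₘ l) :
    ∃ c, c ∈ₘ l ∧ Sub (V a) (V c) ∧ Sub (V b) (V c) := by
  obtain ⟨c, hc, h1, h2⟩ := hl.exists_upper ha hb
  exact ⟨c, hc, V_mono (hl.mem hc) h1, V_mono (hl.mem hc) h2⟩

theorem upair_mem_V {a b : M} (ha : a ∈ₘ V l) (hb : b ∈ₘ V l) : upair a b ∈ₘ V l := by
  obtain ⟨c, hc, h1⟩ := (mem_V hl.1).1 ha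
  obtain ⟨d, hd, h2⟩ := (mem_V hl.1).1 hb
  obtain ⟨e, he, h3, h4⟩ := exists_V_upper hl hc hd
  refine mem_V_of_sub hl (hl.2.2 e he) fun x hx => ?_
  rw [V_succ (hl.mem he), mem_pow]
  rcases mem_upair.1 hx with rfl | rfl
  · exact h1.trans h3
  · exact h2.trans h4

theorem insert_mem_V {a b c : M} (ha : a ∈ₘ V l) (hb : b ∈ₘ V l)
    (h : ∀ x, x ∈ₘ c ↔ x ∈ₘ a ∨ x = b) : c ∈ₘ V l := by
  obtain ⟨d, hd, h1⟩ := (mem_V hl.1).1 ha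
  obtain ⟨e, he, h2⟩ := (mem_V hl.1).1 hb
  obtain ⟨i, hi, h3, h4⟩ := exists_V_upper hl hd he
  refine mem_V_of_sub hl (hl.2.2 i hi) fun x hx => ?_
  rcases (h x).1 hx with hx | rfl
  · exact V_mono (hl.mem hi).succ (mem_succ_self i) x (h3 x (h1 x hx))
  · rw [V_succ (hl.mem hi), mem_pow]
    exact h2.trans h4

omit hl in
theorem succ_mem_V_succ {a b : M} (hb : IsOrd b) (h : a ∈ₘ V b) : succ a ∈ₘ V (succ b) := by
  rw [V_succ hb, mem_pow]
  intro x hx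
  rcases mem_succ.1 hx with hx | rfl
  · exact V_trans hb a h x hx
  · exact h

/-- If `b` is not a natural number, it contains all of them and the shift maps `V_b` into itself.
For natural `b` the shift can raise the rank, and a bound is found by induction: the shift of `y +
1` is the shift of `y` plus two, so two further levels take care of successors. -/
theorem exists_sh_mem_V {b : M} (hb : b ∈ₘ l) :
    ∃ c, c ∈ₘ l ∧ ∀ x, x ∈ₘ V b → sh x ∈ₘ V c := by
  have hV : ∀ {c : M}, c ∈ₘ l → Vd c = V c := fun hc => Vd_eq (hl.mem hc)
  by_cases hbn : IsNat b
  · have : ∃ c, c ∈ₘ l ∧ ∀ x, x ∈ₘ Vd b → sh x ∈ₘ Vd c := by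
      refine IsNat.induct (fun b => ∃ c, c ∈ₘ l ∧ ∀ x, x ∈ₘ Vd b → sh x ∈ₘ Vd c) ?_ ?_ hbn
      · refine ⟨empty, hl.empty_mem, fun x hx => ?_⟩
        rw [Vd_eq isOrd_empty, mem_V isOrd_empty] at hx
        obtain ⟨c, hc, -⟩ := hx
        exact (mem_empty c hc).elim
      · rintro m hm ⟨c, hc, ih⟩
        have hml := hl.nat_mem hm
        obtain ⟨d, hd, h1, h2⟩ := exists_V_upper hl (hl.2.2 _ (hl.2.2 c hc)) (hl.2.2 m hml)
        obtain ⟨e, he, h3, h4⟩ := exists_V_upper hl hd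
          (hl.nat_mem (isNat_empty (M := M)).succ.succ)
        refine ⟨e, he, fun x hx => ?_⟩
        rw [hV (hl.2.2 m hml)] at hx
        rw [hV he]
        by_cases hxn : IsNat x
        · rcases hxn.cases with rfl | ⟨y, hy, rfl⟩
          · rw [sh_of_isNat isNat_empty, dbl_empty]
            exact h4 _ (isNat_empty.succ.succ.1.sub_V _ (mem_succ_self _))
          · rw [V_succ hm.1, mem_pow] at hx
            have := ih y (by rw [hV hml]; exact hx y (mem_succ_self y))
            rw [hV hc, sh_of_isNat hy] at this
            rw [sh_of_isNat hy.succ, dbl_succ hy]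
            exact h3 _ (h1 _ (succ_mem_V_succ (hl.mem hc).succ (succ_mem_V_succ (hl.mem hc) this)))
        · rw [sh_of_not_isNat hxn]
          exact h3 _ (h2 _ hx)
    obtain ⟨c, hc, h⟩ := this
    rw [hV hb, hV hc] at h
    exact ⟨c, hc, h⟩
  · refine ⟨b, hb, fun x hx => ?_⟩
    by_cases hxn : IsNat x
    · rw [sh_of_isNat hxn]
      exact (hl.mem hb).sub_V _ ((hl.mem hb).nat_mem_of_not_isNat hbn hxn.dbl.succ)
    · rwa [sh_of_not_isNat hxn]

theorem fl_mem_V {n a : M} (hn : IsNat n) (ha : a ∈ₘ V l) : fl n a ∈ₘ V l := by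
  obtain ⟨b, hb, h⟩ := (mem_V hl.1).1 ha
  obtain ⟨c, hc, h1, h2⟩ := exists_V_upper hl hb (hl.nat_mem hn)
  obtain ⟨d, hd, h3⟩ := exists_sh_mem_V hl hc
  refine mem_V_of_sub hl hd fun y hy => ?_
  rcases mem_fl.1 hy with ⟨x, hx, rfl⟩ | ⟨i, hi, hin, rfl⟩
  · exact h3 x (h1 x (h x hx))
  -- The marker `2i` is an element of `sh i = 2i + 1`, so transitivity bounds it as well.
  · have := h3 i (h2 i (hn.1.sub_V i hi))
    rw [sh_of_isNat hin] at this
    exact V_trans (hl.mem hd) _ this _ (mem_succ_self _)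

/-! ### Recognising the levels `V_α` inside `V_λ` -/

omit hl in
theorem V_inj {a b : M} (ha : IsOrd a) (hb : IsOrd b) (h : V a = V b) : a = b := by
  rcases ha.trichotomy hb with h' | h' | h'
  · exact (mem_irrefl (V a) (by conv_rhs => rw [h]
                                exact V_mem hb h')).elim
  · exact h'
  · exact (mem_irrefl (V a) (by conv_lhs => rw [h]
                                exact V_mem ha h')).elim

omit hl in
/-- The sets of subsets of the elements of a set of levels is a level. -/
theorem exists_V_of_levels {C : M} (hC : ∀ c, c ∈ₘ C → ∃ a, IsOrd a ∧ c = V a) :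
    ∃ a, IsOrd a ∧ ∀ y, y ∈ₘ V a ↔ ∃ c, c ∈ₘ C ∧ Sub y c := by
  obtain ⟨B, hB⟩ := repl_rel (fun c b : M => IsOrd b ∧ c = Vd b) C (by
    rintro c - a b ⟨ha, e1⟩ ⟨hb, e2⟩
    rw [Vd_eq ha] at e1
    rw [Vd_eq hb] at e2
    exact V_inj ha hb (e1.symm.trans e2))
  have hBo : ∀ b, b ∈ₘ B → IsOrd b ∧ V b ∈ₘ C := by
    intro b hb
    obtain ⟨c, hc, ho, rfl⟩ := (hB b).1 hb
    rw [Vd_eq ho] at hc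
    exact ⟨ho, hc⟩
  -- The required index is the supremum of the `b + 1` for `b` in `B`, that is, the union of these
  -- successors.
  obtain ⟨S, hS⟩ := repl (succ : M → M) B
  have hmem : ∀ x, x ∈ₘ sUnion S ↔ ∃ b, b ∈ₘ B ∧ x ∈ₘ succ b := by
    intro x
    rw [mem_sUnion]
    constructor
    · rintro ⟨_, hs, hx⟩
      obtain ⟨b, hb, rfl⟩ := (hS _).1 hs
      exact ⟨b, hb, hx⟩
    · rintro ⟨b, hb, hx⟩
      exact ⟨_, (hS _).2 ⟨b, hb, rfl⟩, hx⟩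
  have ho : IsOrd (sUnion S) := by
    constructor
    · intro x hx y hy
      obtain ⟨b, hb, hx⟩ := (hmem x).1 hx
      exact (hmem y).2 ⟨b, hb, (hBo b hb).1.succ.1 x hx y hy⟩
    · intro x hx
      obtain ⟨b, hb, hx⟩ := (hmem x).1 hx
      exact (hBo b hb).1.succ.2 x hx
  refine ⟨sUnion S, ho, fun y => ?_⟩
  rw [mem_V ho]
  constructor
  · rintro ⟨c, hc, hy⟩
    obtain ⟨b, hb, hc⟩ := (hmem c).1 hc
    refine ⟨V b, (hBo b hb).2, ?_⟩
    rcases mem_succ.1 hc with hc | rfl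
    · exact hy.trans (V_mono (hBo b hb).1 hc)
    · exact hy
  · rintro ⟨c, hc, hy⟩
    obtain ⟨a, ha, rfl⟩ := hC c hc
    refine ⟨a, (hmem a).2 ⟨a, (hB a).2 ⟨_, hc, ha, (Vd_eq ha).symm⟩, mem_succ_self a⟩, hy⟩

/-- Induction along membership on the elements `x` of the history `h`: those members of `h` that lie
in `x` are levels, `x` consists of their subsets, and `exists_V_of_levels` applies. Restricting
quantifiers to `V_λ` loses nothing, since it contains all subsets of its elements. -/
theorem Lev.exists_eq_V {v : M} (hv : v ∈ₘ V l) (h : Lev (V l) v) : ∃ a, IsOrd a ∧ v = V a := by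
  have htr : IsTrans (V l) := V_trans hl.1
  obtain ⟨h, hhl, hh, hvh⟩ := h
  have hsub : ∀ {C a : M}, Sub C h → ∀ x, x ∈ₘ V l → IsOrd a →
      (∀ y, y ∈ₘ V l → (y ∈ₘ x ↔ ∃ c, c ∈ₘ C ∧ Sub y c)) →
      (∀ y, y ∈ₘ V a ↔ ∃ c, c ∈ₘ C ∧ Sub y c) → x = V a := by
    intro C a hC x hx ha h1 h2
    refine ext fun y => ?_
    rw [h2]
    constructor
    · intro hy
      exact (h1 y (htr x hx y hy)).1 hy
    · rintro ⟨c, hc, hy⟩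
      exact (h1 y (V_sub_closed hl.1 (htr h hhl c (hC c hc)) hy)).2 ⟨c, hc, hy⟩
  have hlev : ∀ x, x ∈ₘ h → ∃ a, IsOrd a ∧ x = Vd a := by
    by_contra! hne
    obtain ⟨x0, hx0, hne⟩ := hne
    obtain ⟨x, hx, hne, hmin⟩ := exists_minimal (fun x : M => ¬ ∃ a, IsOrd a ∧ x = Vd a) hx0
      (by push Not; exact hne)
    obtain ⟨C, hC⟩ := sep (fun c => c ∈ₘ x) h
    obtain ⟨a, ha, hVa⟩ := exists_V_of_levels (C := C) fun c hc => by
      obtain ⟨hch, hcx⟩ := (hC c).1 hc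
      obtain ⟨a, ha, e⟩ := not_not.1 (hmin c hcx hch)
      exact ⟨a, ha, by rw [e, Vd_eq ha]⟩
    refine hne ⟨a, ha, ?_⟩
    rw [Vd_eq ha]
    refine hsub (fun c hc => ((hC c).1 hc).1) x (htr h hhl x hx) ha (fun y hy => ?_) hVa
    rw [hh x hx y hy]
    simp only [hC, and_assoc]
  obtain ⟨a, ha, hVa⟩ := exists_V_of_levels (C := h) fun c hc => by
    obtain ⟨a, ha, e⟩ := hlev c hc
    exact ⟨a, ha, by rw [e, Vd_eq ha]⟩
  exact ⟨a, ha, hsub (Sub.refl h) v hv ha hvh hVa⟩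

theorem ambient_V : Ambient (V l) where
  trans := V_trans hl.1
  sub x y hx h := V_sub_closed hl.1 hx h
  nat n hn := hl.1.sub_V n (hl.nat_mem hn)
  upair a b ha hb := upair_mem_V hl ha hb
  insert a b c ha hb h := insert_mem_V hl ha hb h
  fl n a hn ha := fl_mem_V hl hn ha
  exists_lev a ha := by
    obtain ⟨b, hb, h⟩ := (mem_V hl.1).1 ha
    have hb' := (hl.mem hb).succ
    refine ⟨V (succ b), V_mem hl.1 (hl.2.2 b hb), ?_, by rwa [V_succ (hl.mem hb), mem_pow]⟩
    -- The history of `V_{b+1}` is the set of all `V_c` with `c ≤ b`.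
    obtain ⟨h, hh⟩ := repl (Vd : M → M) (succ b)
    have hh' : ∀ x, x ∈ₘ h ↔ ∃ c, c ∈ₘ succ b ∧ x = V c := by
      intro x
      rw [hh]
      exact exists_congr fun c => and_congr_right fun hc => by rw [Vd_eq (hb'.mem hc)]
    refine ⟨h, mem_V_of_sub hl (hl.2.2 b hb) fun x hx => ?_, ?_, ?_⟩
    · obtain ⟨c, hc, rfl⟩ := (hh' x).1 hx
      exact V_mem hb' hc
    · intro x hx y _
      obtain ⟨c, hc, rfl⟩ := (hh' x).1 hx
      rw [mem_V (hb'.mem hc)]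
      constructor
      · rintro ⟨d, hd, hy⟩
        exact ⟨V d, (hh' _).2 ⟨d, hb'.1 c hc d hd, rfl⟩, V_mem (hb'.mem hc) hd, hy⟩
      · rintro ⟨e, -, he, hy⟩
        obtain ⟨d, hd, he⟩ := (mem_V (hb'.mem hc)).1 he
        exact ⟨d, hd, hy.trans he⟩
    · intro y _
      rw [mem_V hb']
      constructor
      · rintro ⟨d, hd, hy⟩
        exact ⟨V d, (hh' _).2 ⟨d, hd, rfl⟩, hy⟩
      · rintro ⟨e, he, hy⟩
        obtain ⟨d, hd, rfl⟩ := (hh' _).1 he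
        exact ⟨d, hd, hy⟩
  lev_total v w hv hw h1 h2 := by
    obtain ⟨a, ha, rfl⟩ := h1.exists_eq_V hl hv
    obtain ⟨b, hb, rfl⟩ := h2.exists_eq_V hl hw
    rcases ha.trichotomy hb with h | rfl | h
    · exact Or.inl (V_mono hb h)
    · exact Or.inl (Sub.refl _)
    · exact Or.inr (V_mem ha h)

end Ambient

/-! ### Flat tuples of subsets of an ambient level -/

section Tuples

variable {M : Type u} [SetStructure M] {α : Type} [Nonempty M]

/-- `σ` is a flat tuple of length `n` of subsets of `L`. -/
def IsT (L n σ : M) : Prop := IsNat n ∧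
  (∀ z, z ∈ₘ σ → (∃ i, i ∈ₘ n ∧ z = fl empty i) ∨
    ∃ i, i ∈ₘ n ∧ ∃ x, x ∈ₘ L ∧ z = fl (succ empty) (fl i x)) ∧
  ∀ i, i ∈ₘ n → fl empty i ∈ₘ σ

/-- The entry of index `i` of the flat tuple `σ`. -/
noncomputable def co (L σ i : M) : M := compr fun x => x ∈ₘ L ∧ fl (succ empty) (fl i x) ∈ₘ σ

/-- `ρ = σ⌢⌈u⌉`, for tuples of subsets of `L`. -/
def App (L σ u ρ : M) : Prop := ∃ n, IsT L n σ ∧ IsT L (succ n) ρ ∧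
  (∀ i, i ∈ₘ n → co L ρ i = co L σ i) ∧ co L ρ n = u

/-- `ρ = ⌈u⌉⌢τ`, for tuples of subsets of `L`. -/
def Pre (L u τ ρ : M) : Prop := ∃ n, IsT L n τ ∧ IsT L (succ n) ρ ∧
  co L ρ empty = u ∧ ∀ i, i ∈ₘ n → co L ρ (succ i) = co L τ i

/-- `σ` is a proper initial segment of `ρ`. -/
def Ini (L σ ρ : M) : Prop := ∃ m n, IsT L m σ ∧ IsT L n ρ ∧ m ∈ₘ n ∧
  ∀ i, i ∈ₘ m → co L σ i = co L ρ i

variable [hM : Fact (ModelsZF M)]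

instance MD.isT [Finite α] {r s t : (α → M) → M} [DTm id Set.univ r] [DTm id Set.univ s]
    [DTm id Set.univ t] : Dfn id Set.univ fun v => IsT (r v) (s v) (t v) :=
  Dfn.comp3 (by unfold IsT; infer_instance)

instance MF.co [Finite α] {r s t : (α → M) → M} [DTm id Set.univ r] [DTm id Set.univ s]
    [DTm id Set.univ t] : DTm id Set.univ fun v => co (r v) (s v) (t v) :=
  DTm.comp3 (by unfold KunenTree.co; infer_instance)

instance MD.app [Finite α] {L : M} {r s t : (α → M) → M} [DTm id Set.univ r] [DTm id Set.univ s]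
    [DTm id Set.univ t] : Dfn id Set.univ fun v => App L (r v) (s v) (t v) :=
  Dfn.comp3 (by unfold App; infer_instance)

instance MD.pre [Finite α] {L : M} {r s t : (α → M) → M} [DTm id Set.univ r] [DTm id Set.univ s]
    [DTm id Set.univ t] : Dfn id Set.univ fun v => Pre L (r v) (s v) (t v) :=
  Dfn.comp3 (by unfold Pre; infer_instance)

instance MD.ini [Finite α] {L : M} {s t : (α → M) → M} [DTm id Set.univ s]
    [DTm id Set.univ t] : Dfn id Set.univ fun v => Ini L (s v) (t v) :=
  Dfn.comp2 (by unfold Ini; infer_instance)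

theorem mem_co {L σ i x : M} : x ∈ₘ co L σ i ↔ x ∈ₘ L ∧ fl (succ empty) (fl i x) ∈ₘ σ :=
  compr_sep (P := fun x => x ∈ₘ L ∧ fl (succ empty) (fl i x) ∈ₘ σ) (fun _ h => h.1) x

theorem co_sub (L σ i : M) : Sub (co L σ i) L := fun _ h => (mem_co.1 h).1

theorem isNat_one : IsNat (succ (empty : M)) := isNat_empty.succ

theorem fl_empty_inj {a b : M} (h : fl empty a = fl empty b) : a = b :=
  (fl_inj isNat_empty isNat_empty h).2

theorem fl_empty_ne_fl_one {a b : M} : fl empty a ≠ fl (succ empty) b := fun h =>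
  succ_ne_empty _ (fl_inj isNat_empty isNat_one h).1.symm

theorem fl_one_inj {i j x y : M} (hi : IsNat i) (hj : IsNat j)
    (h : fl (succ empty) (fl i x) = fl (succ empty) (fl j y)) : i = j ∧ x = y :=
  fl_inj hi hj (fl_inj isNat_one isNat_one h).2

variable {L : M}

theorem IsT.fl_empty_mem {n σ i : M} (h : IsT L n σ) : fl empty i ∈ₘ σ ↔ i ∈ₘ n := by
  refine ⟨fun hi => ?_, h.2.2 i⟩
  rcases h.2.1 _ hi with ⟨j, hj, e⟩ | ⟨j, hj, x, hx, e⟩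
  · exact fl_empty_inj e ▸ hj
  · exact (fl_empty_ne_fl_one e).elim

theorem IsT.len_unique {n m σ : M} (h : IsT L n σ) (h' : IsT L m σ) : n = m :=
  ext fun i => by rw [← h.fl_empty_mem, h'.fl_empty_mem]

theorem IsT.fl_one_mem {n σ i x : M} (hi : IsNat i) (h : IsT L n σ) :
    fl (succ empty) (fl i x) ∈ₘ σ ↔ i ∈ₘ n ∧ x ∈ₘ co L σ i := by
  constructor
  · intro hx
    rcases h.2.1 _ hx with ⟨j, hj, e⟩ | ⟨j, hj, y, hy, e⟩
    · exact (fl_empty_ne_fl_one e.symm).elim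
    · obtain ⟨rfl, rfl⟩ := fl_one_inj hi (h.1.mem hj) e
      exact ⟨hj, mem_co.2 ⟨hy, hx⟩⟩
  · exact fun hx => (mem_co.1 hx.2).2

theorem IsT.ext {n σ τ : M} (h : IsT L n σ) (h' : IsT L n τ)
    (he : ∀ i, i ∈ₘ n → co L σ i = co L τ i) : σ = τ := by
  have : ∀ {σ τ : M}, IsT L n σ → IsT L n τ → (∀ i, i ∈ₘ n → co L σ i = co L τ i) → Sub σ τ := by
    intro σ τ h h' he z hz
    rcases h.2.1 z hz with ⟨i, hi, rfl⟩ | ⟨i, hi, x, hx, rfl⟩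
    · exact h'.2.2 i hi
    · have hin := h.1.mem hi
      rw [h.fl_one_mem hin, he i hi] at hz
      exact (h'.fl_one_mem hin).2 hz
  exact (this h h' he).antisymm (this h' h fun i hi => (he i hi).symm)

/-- This is the purpose of flat coding. Trees become elements of `pow (pow L)`, and a node, being a
subset of `L`, may itself be an entry of another tuple; `Bisimilar` exploits the latter to code
pairs of nodes. -/
theorem IsT.sub [hL : Ambient L] {n σ : M} (h : IsT L n σ) : Sub σ L := by
  intro z hz
  rcases h.2.1 z hz with ⟨i, hi, rfl⟩ | ⟨i, hi, x, hx, rfl⟩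
  · exact hL.fl _ _ isNat_empty (hL.nat i (h.1.mem hi))
  · exact hL.fl _ _ isNat_one (hL.fl _ _ (h.1.mem hi) hx)

/-- Tuples may be defined entry by entry. -/
theorem exists_isT_rel [hL : Ambient L] (C : M → M → Prop) [hC : MD2 C] {n : M} (hn : IsNat n) :
    ∃ σ, IsT L n σ ∧ ∀ i, i ∈ₘ n → ∀ x, x ∈ₘ co L σ i ↔ x ∈ₘ L ∧ C i x := by
  have i1 : ∀ {β : Type} [Finite β] {s t : (β → M) → M} [DTm id Set.univ s] [DTm id Set.univ t],
    Dfn id Set.univ fun v => C (s v) (t v) := Dfn.comp2 hC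
  obtain ⟨σ, hσ⟩ := sep (fun z => (∃ i, i ∈ₘ n ∧ z = fl empty i) ∨
    ∃ i, i ∈ₘ n ∧ ∃ x, (x ∈ₘ L ∧ C i x) ∧ z = fl (succ empty) (fl i x)) L
  have h : IsT L n σ := by
    refine ⟨hn, fun z hz => ?_, fun i hi => ?_⟩
    · rcases ((hσ z).1 hz).2 with h | ⟨i, hi, x, hx, e⟩
      · exact Or.inl h
      · exact Or.inr ⟨i, hi, x, hx.1, e⟩
    · exact (hσ _).2 ⟨hL.fl _ _ isNat_empty (hL.nat i (hn.mem hi)), Or.inl ⟨i, hi, rfl⟩⟩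
  refine ⟨σ, h, fun i hi x => ?_⟩
  have hin := hn.mem hi
  rw [mem_co]
  refine and_congr_right fun hx => ?_
  rw [hσ]
  constructor
  · rintro ⟨-, ⟨j, hj, e⟩ | ⟨j, hj, y, hy, e⟩⟩
    · exact (fl_empty_ne_fl_one e.symm).elim
    · obtain ⟨rfl, rfl⟩ := fl_one_inj hin (hn.mem hj) e
      exact hy.2
  · intro hc
    exact ⟨hL.fl _ _ isNat_one (hL.fl _ _ hin hx), Or.inr ⟨i, hi, x, ⟨hx, hc⟩, rfl⟩⟩

theorem exists_isT [hL : Ambient L] (g : M → M) [hg : MF1 g] {n : M} (hn : IsNat n)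
    (h : ∀ i, i ∈ₘ n → Sub (g i) L) : ∃ σ, IsT L n σ ∧ ∀ i, i ∈ₘ n → co L σ i = g i := by
  have h' : ∀ {β : Type} {s : (β → M) → M} [DTm id Set.univ s],
    DTm id Set.univ fun v => g (s v) := DTm.comp1 hg
  obtain ⟨σ, hσ, hc⟩ := exists_isT_rel (L := L) (fun i x => x ∈ₘ g i) hn
  refine ⟨σ, hσ, fun i hi => KunenTree.ext fun x => ?_⟩
  rw [hc i hi]
  exact ⟨fun h => h.2, fun hx => ⟨h i hi x hx, hx⟩⟩

/-! #### Comparison with sequences -/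

theorem mem_tup {n g z : M} (hg : IsSeq n g) : z ∈ₘ tup n g ↔ (∃ i, i ∈ₘ n ∧ z = fl empty i) ∨
    ∃ i, i ∈ₘ n ∧ ∃ x, x ∈ₘ app g i ∧ z = fl (succ empty) (fl i x) := by
  obtain ⟨U, hU⟩ := repl (ap g) n
  obtain ⟨A, hA⟩ := repl (fun i => compr fun z => ∃ x, x ∈ₘ ap g i ∧ z = fl i x) n
  have h1 : ∀ i z, z ∈ₘ (compr fun z => ∃ x, x ∈ₘ ap g i ∧ z = fl i x) ↔
      ∃ x, x ∈ₘ ap g i ∧ z = fl i x := fun i z => by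
    obtain ⟨c, hc⟩ := repl (fun x : M => fl i x) (ap g i)
    exact mem_compr ⟨c, hc⟩ z
  have h2 : ∀ z, z ∈ₘ (compr fun z => ∃ i x, i ∈ₘ n ∧ x ∈ₘ app g i ∧ z = flatF i x) ↔
      ∃ i, i ∈ₘ n ∧ ∃ x, x ∈ₘ app g i ∧ z = fl i x := by
    have : ∀ z, (∃ i x, i ∈ₘ n ∧ x ∈ₘ app g i ∧ z = flatF i x) ↔
        ∃ i, i ∈ₘ n ∧ ∃ x, x ∈ₘ app g i ∧ z = fl i x := by
      intro z
      constructor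
      · rintro ⟨i, x, hi, hx, e⟩
        exact ⟨i, hi, x, hx, by rw [e, flatF_eq (hg.1.mem hi)]⟩
      · rintro ⟨i, hi, x, hx, e⟩
        exact ⟨i, x, hi, hx, by rw [e, flatF_eq (hg.1.mem hi)]⟩
    intro z
    rw [mem_compr ⟨sUnion A, fun z => ?_⟩ z, this]
    rw [this, mem_sUnion]
    constructor
    · rintro ⟨_, ha, hz⟩
      obtain ⟨i, hi, rfl⟩ := (hA _).1 ha
      rw [h1, hg.2.ap_eq hi] at hz
      exact ⟨i, hi, hz⟩
    · rintro ⟨i, hi, hz⟩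
      exact ⟨_, (hA _).2 ⟨i, hi, rfl⟩, by rwa [h1, hg.2.ap_eq hi]⟩
  have h3 : ∀ a b z : M, z ∈ₘ flatPair a b ↔
      (∃ x, x ∈ₘ a ∧ z = fl empty x) ∨ ∃ y, y ∈ₘ b ∧ z = fl (succ empty) y := by
    intro a b z
    obtain ⟨c, hc⟩ := repl (fun x : M => fl empty x) a
    obtain ⟨d, hd⟩ := repl (fun x : M => fl (succ empty) x) b
    obtain ⟨e, he⟩ := exists_union c d
    unfold flatPair
    simp only [flatF_eq isNat_empty, flatF_eq isNat_one]
    exact mem_compr (P := fun z =>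
      (∃ x, x ∈ₘ a ∧ z = fl empty x) ∨ ∃ y, y ∈ₘ b ∧ z = fl (succ empty) y)
      ⟨e, fun z => by rw [he, hc, hd]⟩ z
  unfold tup
  rw [h3]
  refine or_congr Iff.rfl ?_
  constructor
  · rintro ⟨y, hy, rfl⟩
    obtain ⟨i, hi, x, hx, rfl⟩ := (h2 y).1 hy
    exact ⟨i, hi, x, hx, rfl⟩
  · rintro ⟨i, hi, x, hx, rfl⟩
    exact ⟨_, (h2 _).2 ⟨i, hi, x, hx, rfl⟩, rfl⟩

theorem isT_tup {n g : M} (hg : IsSeq n g) (h : ∀ i, i ∈ₘ n → Sub (app g i) L) :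
    IsT L n (tup n g) := by
  refine ⟨hg.1, fun z hz => ?_, fun i hi => (mem_tup hg).2 (Or.inl ⟨i, hi, rfl⟩)⟩
  rcases (mem_tup hg).1 hz with h' | ⟨i, hi, x, hx, e⟩
  · exact Or.inl h'
  · exact Or.inr ⟨i, hi, x, h i hi x hx, e⟩

theorem IsT.of_tup {m n g : M} (hg : IsSeq n g) (h : IsT L m (tup n g)) :
    m = n ∧ ∀ i, i ∈ₘ n → Sub (app g i) L := by
  constructor
  · refine KunenTree.ext fun i => ?_
    rw [← h.fl_empty_mem, mem_tup hg]
    constructor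
    · rintro (⟨j, hj, e⟩ | ⟨j, hj, x, -, e⟩)
      · exact fl_empty_inj e ▸ hj
      · exact (fl_empty_ne_fl_one e).elim
    · exact fun hi => Or.inl ⟨i, hi, rfl⟩
  · intro i hi x hx
    have := (mem_tup (z := fl (succ empty) (fl i x)) hg).2 (Or.inr ⟨i, hi, x, hx, rfl⟩)
    rw [h.fl_one_mem (hg.1.mem hi)] at this
    exact co_sub _ _ _ x this.2

theorem co_tup {n g i : M} (hg : IsSeq n g) (hi : i ∈ₘ n) (h : Sub (app g i) L) :
    co L (tup n g) i = app g i := by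
  refine KunenTree.ext fun x => ?_
  rw [mem_co, mem_tup hg]
  constructor
  · rintro ⟨-, ⟨j, hj, e⟩ | ⟨j, hj, y, hy, e⟩⟩
    · exact (fl_empty_ne_fl_one e.symm).elim
    · obtain ⟨rfl, rfl⟩ := fl_one_inj (hg.1.mem hi) (hg.1.mem hj) e
      exact hy
  · exact fun hx => ⟨h x hx, Or.inr ⟨i, hi, x, hx, rfl⟩⟩

theorem IsT.exists_seq {n σ : M} (h : IsT L n σ) :
    ∃ g, IsSeq n g ∧ (∀ i, i ∈ₘ n → app g i = co L σ i) ∧ σ = tup n g := by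
  obtain ⟨g, hg, e⟩ := exists_fun (fun i => co L σ i) n
  have hs : ∀ i, i ∈ₘ n → Sub (app g i) L := fun i hi => by rw [e i hi]; exact co_sub _ _ _
  refine ⟨g, ⟨h.1, hg⟩, e, h.ext (isT_tup ⟨h.1, hg⟩ hs) fun i hi => ?_⟩
  rw [co_tup ⟨h.1, hg⟩ hi (hs i hi), e i hi]

/-- A sequence of subsets of `L`, as a set of Kuratowski pairs, need not belong to `pow (pow L)`, so
`IsAppend` cannot be evaluated there directly; `App` reads the entries off the tuples themselves.
Assuming that `ρ` is a tuple over `L` suffices, because `u` and the entries of `σ` are entries of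
`ρ`. -/
theorem isAppend_iff {m σ u ρ : M} (hρ : IsT L m ρ) : IsAppend σ u ρ ↔ App L σ u ρ := by
  constructor
  · rintro ⟨n, g, e, hg, he, rfl, rfl, h1, h2⟩
    obtain ⟨rfl, hs⟩ := hρ.of_tup he
    have hn : ∀ i, i ∈ₘ n → i ∈ₘ succ n := fun i hi => mem_succ.2 (Or.inl hi)
    have hs' : ∀ i, i ∈ₘ n → Sub (KunenTree.app g i) L := fun i hi => h1 i hi ▸ hs i (hn i hi)
    refine ⟨n, isT_tup hg hs', hρ, fun i hi => ?_, ?_⟩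
    · rw [co_tup he (hn i hi) (hs i (hn i hi)), co_tup hg hi (hs' i hi), h1 i hi]
    · rw [co_tup he (mem_succ_self n) (hs n (mem_succ_self n)), h2]
  · rintro ⟨n, h1, h2, h3, h4⟩
    obtain ⟨g, hg, hg', rfl⟩ := h1.exists_seq
    obtain ⟨e, he, he', rfl⟩ := h2.exists_seq
    refine ⟨n, g, e, hg, he, rfl, rfl, fun i hi => ?_, ?_⟩
    · rw [he' i (mem_succ.2 (Or.inl hi)), hg' i hi, h3 i hi]
    · rw [he' n (mem_succ_self n), h4]

theorem isPrepend_iff {m u τ ρ : M} (hρ : IsT L m ρ) : IsPrepend u τ ρ ↔ Pre L u τ ρ := by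
  constructor
  · rintro ⟨n, g, e, hg, he, rfl, rfl, h1, h2⟩
    obtain ⟨rfl, hs⟩ := hρ.of_tup he
    have h0 := hg.1.empty_mem_succ
    have hn : ∀ i, i ∈ₘ n → succ i ∈ₘ succ n := fun i hi => hg.1.succ_mem_succ hi
    have hs' : ∀ i, i ∈ₘ n → Sub (KunenTree.app g i) L := fun i hi => h2 i hi ▸ hs _ (hn i hi)
    refine ⟨n, isT_tup hg hs', hρ, ?_, fun i hi => ?_⟩
    · rw [co_tup he h0 (hs _ h0), h1]
    · rw [co_tup he (hn i hi) (hs _ (hn i hi)), co_tup hg hi (hs' i hi), h2 i hi]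
  · rintro ⟨n, h1, h2, h3, h4⟩
    obtain ⟨g, hg, hg', rfl⟩ := h1.exists_seq
    obtain ⟨e, he, he', rfl⟩ := h2.exists_seq
    refine ⟨n, g, e, hg, he, rfl, rfl, ?_, fun i hi => ?_⟩
    · rw [he' _ hg.1.empty_mem_succ, h3]
    · rw [he' _ (hg.1.succ_mem_succ hi), hg' i hi, h4 i hi]

theorem isSeq_empty : IsSeq (empty : M) empty :=
  ⟨isNat_empty, fun p hp => (mem_empty p hp).elim, fun p hp => (mem_empty p hp).elim⟩

theorem isT_nil : IsT L empty nil := isT_tup isSeq_empty fun i hi => (mem_empty i hi).elim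

theorem IsT.eq_nil {σ : M} (h : IsT L empty σ) : σ = nil :=
  h.ext isT_nil fun i hi => (mem_empty i hi).elim

theorem isSeq_one (u : M) : IsSeq (succ empty) (upair (kpair empty u) (kpair empty u)) := by
  refine ⟨isNat_one, fun p hp => ⟨empty, u, mem_succ_self _, by simpa using hp⟩, fun x hx => ?_⟩
  rcases mem_succ.1 hx with hx | rfl
  · exact (mem_empty x hx).elim
  · exact ⟨u, by simp, fun y hy => by simpa using hy⟩

theorem app_isSeq_one (u : M) : KunenTree.app (upair (kpair empty u) (kpair empty u)) empty = u :=
  (isSeq_one u).2.app_eq (by simp)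

theorem isT_tup1 {u : M} (hu : Sub u L) : IsT L (succ empty) (tup1 u) ∧
    co L (tup1 u) empty = u := by
  have h : ∀ i, i ∈ₘ succ (empty : M) →
      Sub (KunenTree.app (upair (kpair empty u) (kpair empty u)) i) L := by
    intro i hi
    rcases mem_succ.1 hi with hi | rfl
    · exact (mem_empty i hi).elim
    · rwa [app_isSeq_one]
  refine ⟨isT_tup (isSeq_one u) h, ?_⟩
  rw [tup1, co_tup (isSeq_one u) (mem_succ_self _) (h _ (mem_succ_self _)), app_isSeq_one]

theorem IsT.sub_of_tup1 {m u : M} (h : IsT L m (tup1 u)) : Sub u L := by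
  have := (h.of_tup (isSeq_one u)).2 empty (mem_succ_self _)
  rwa [app_isSeq_one] at this

theorem pre_nil {u : M} (hu : Sub u L) : Pre L u nil (tup1 u) :=
  ⟨empty, isT_nil, (isT_tup1 hu).1, (isT_tup1 hu).2, fun i hi => (mem_empty i hi).elim⟩

theorem app_nil {u : M} (hu : Sub u L) : App L nil u (tup1 u) :=
  ⟨empty, isT_nil, (isT_tup1 hu).1, fun i hi => (mem_empty i hi).elim, (isT_tup1 hu).2⟩

/-! #### Appending and prepending -/

theorem App.isT_right {σ u ρ : M} (h : App L σ u ρ) : ∃ n, IsT L n ρ := ⟨_, h.choose_spec.2.1⟩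

theorem App.sub {σ u ρ : M} (h : App L σ u ρ) : Sub u L := by
  obtain ⟨n, -, -, -, rfl⟩ := h
  exact co_sub _ _ _

theorem Pre.sub {σ u ρ : M} (h : Pre L u σ ρ) : Sub u L := by
  obtain ⟨n, -, -, rfl, -⟩ := h
  exact co_sub _ _ _

theorem Pre.isT_left {σ u ρ : M} (h : Pre L u σ ρ) : ∃ n, IsT L n σ := ⟨_, h.choose_spec.1⟩

theorem Pre.isT_right {σ u ρ : M} (h : Pre L u σ ρ) : ∃ n, IsT L n ρ := ⟨_, h.choose_spec.2.1⟩

theorem App.right_unique {σ u ρ ρ' : M} (h : App L σ u ρ) (h' : App L σ u ρ') : ρ = ρ' := by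
  obtain ⟨n, h1, h2, h3, h4⟩ := h
  obtain ⟨n', h1', h2', h3', h4'⟩ := h'
  obtain rfl := h1.len_unique h1'
  refine h2.ext h2' fun i hi => ?_
  rcases mem_succ.1 hi with hi | rfl
  · rw [h3 i hi, h3' i hi]
  · rw [h4, h4']

theorem App.ne_nil {σ u : M} (h : App L σ u nil) : False := by
  obtain ⟨n, -, h, -⟩ := h
  exact succ_ne_empty n (h.len_unique isT_nil)

theorem exists_app [Ambient L] {n σ u : M} (h : IsT L n σ) (hu : Sub u L) :
    ∃ ρ, App L σ u ρ := by
  obtain ⟨ρ, hρ, hc⟩ := exists_isT_rel (L := L)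
    (fun i x => (i = n ∧ x ∈ₘ u) ∨ (i ≠ n ∧ x ∈ₘ co L σ i)) h.1.succ
  refine ⟨ρ, n, h, hρ, fun i hi => ?_, ?_⟩
  · have : i ≠ n := by rintro rfl; exact mem_irrefl i hi
    refine KunenTree.ext fun x => ?_
    rw [hc i (mem_succ.2 (Or.inl hi))]
    simp only [this, false_and, ne_eq, not_false_eq_true, true_and, false_or]
    exact ⟨fun h => h.2, fun h => ⟨co_sub _ _ _ x h, h⟩⟩
  · refine KunenTree.ext fun x => ?_
    rw [hc n (mem_succ_self n)]
    simp only [true_and, ne_eq, not_true_eq_false, false_and, or_false]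
    exact ⟨fun h => h.2, fun h => ⟨hu x h, h⟩⟩

theorem Pre.right_unique {τ u ρ ρ' : M} (h : Pre L u τ ρ) (h' : Pre L u τ ρ') : ρ = ρ' := by
  obtain ⟨n, h1, h2, h3, h4⟩ := h
  obtain ⟨n', h1', h2', h3', h4'⟩ := h'
  obtain rfl := h1.len_unique h1'
  refine h2.ext h2' fun i hi => ?_
  rcases h1.1.mem_succ_cases hi with rfl | ⟨p, hp, rfl⟩
  · rw [h3, h3']
  · rw [h4 p hp, h4' p hp]

theorem Pre.left_unique {τ u ρ τ' u' : M} (h : Pre L u τ ρ) (h' : Pre L u' τ' ρ) :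
    u = u' ∧ τ = τ' := by
  obtain ⟨n, h1, h2, h3, h4⟩ := h
  obtain ⟨n', h1', h2', h3', h4'⟩ := h'
  obtain rfl := succ_inj (h2.len_unique h2')
  exact ⟨by rw [← h3, ← h3'], h1.ext h1' fun i hi => by rw [← h4 i hi, ← h4' i hi]⟩

theorem Pre.ne_nil {τ u : M} (h : Pre L u τ nil) : False := by
  obtain ⟨n, -, h, -⟩ := h
  exact succ_ne_empty n (h.len_unique isT_nil)

theorem exists_pre [Ambient L] {n τ u : M} (h : IsT L n τ) (hu : Sub u L) :
    ∃ ρ, Pre L u τ ρ := by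
  obtain ⟨ρ, hρ, hc⟩ := exists_isT_rel (L := L)
    (fun i x => (i = empty ∧ x ∈ₘ u) ∨ ∃ p, i = succ p ∧ x ∈ₘ co L τ p) h.1.succ
  refine ⟨ρ, n, h, hρ, ?_, fun i hi => ?_⟩
  · refine KunenTree.ext fun x => ?_
    rw [hc _ h.1.empty_mem_succ]
    constructor
    · rintro ⟨-, h | ⟨p, h, -⟩⟩
      · exact h.2
      · exact (succ_ne_empty p h.symm).elim
    · exact fun h => ⟨hu x h, Or.inl ⟨rfl, h⟩⟩
  · refine KunenTree.ext fun x => ?_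
    rw [hc _ (h.1.succ_mem_succ hi)]
    constructor
    · rintro ⟨-, h | ⟨p, h, hx⟩⟩
      · exact (succ_ne_empty i h.1).elim
      · exact succ_inj h ▸ hx
    · exact fun h => ⟨co_sub _ _ _ x h, Or.inr ⟨i, rfl, h⟩⟩

theorem IsT.exists_pre [Ambient L] {n ρ : M} (hn : IsNat n) (h : IsT L (succ n) ρ) :
    ∃ u τ, Pre L u τ ρ := by
  obtain ⟨τ, hτ, hc⟩ := exists_isT (L := L) (fun i => co L ρ (succ i)) hn
    (fun i _ => co_sub _ _ _)
  exact ⟨co L ρ empty, τ, n, hτ, h, rfl, fun i hi => (hc i hi).symm⟩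

/-- Appending at the end commutes with prepending at the front. -/
theorem App.pre {τ v τ' u ρ ρ' : M} (h : App L τ v τ') (h1 : Pre L u τ ρ) (h2 : Pre L u τ' ρ') :
    App L ρ v ρ' := by
  obtain ⟨n, a1, a2, a3, a4⟩ := h
  obtain ⟨m, b1, b2, b3, b4⟩ := h1
  obtain ⟨p, c1, c2, c3, c4⟩ := h2
  obtain rfl := a1.len_unique b1
  obtain rfl := a2.len_unique c1
  refine ⟨succ n, b2, c2, fun i hi => ?_, by rw [c4 n (mem_succ_self n), a4]⟩
  rcases a1.1.mem_succ_cases hi with rfl | ⟨p, hp, rfl⟩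
  · rw [b3, c3]
  · rw [b4 p hp, c4 p (mem_succ.2 (Or.inl hp)), a3 p hp]

theorem App.exists_of_pre [Ambient L] {τ v u ρ ρ' : M} (h : App L ρ v ρ') (h1 : Pre L u τ ρ) :
    ∃ τ', App L τ v τ' ∧ Pre L u τ' ρ' := by
  obtain ⟨n, hn⟩ := h1.isT_left
  obtain ⟨τ', hτ'⟩ := exists_app hn h.sub
  obtain ⟨m, hm⟩ := hτ'.isT_right
  obtain ⟨ρ'', hρ''⟩ := KunenTree.exists_pre hm h1.sub
  obtain rfl := (hτ'.pre h1 hρ'').right_unique h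
  exact ⟨τ', hτ', hρ''⟩

theorem Ini.pre {τ' τ u ρ' ρ : M} (h : Ini L τ' τ) (h1 : Pre L u τ' ρ') (h2 : Pre L u τ ρ) :
    Ini L ρ' ρ := by
  obtain ⟨m, n, a1, a2, a3, a4⟩ := h
  obtain ⟨_, b1, b2, b3, b4⟩ := h1
  obtain ⟨_, c1, c2, c3, c4⟩ := h2
  obtain rfl := a1.len_unique b1
  obtain rfl := a2.len_unique c1
  refine ⟨_, _, b2, c2, a2.1.succ_mem_succ a3, fun i hi => ?_⟩
  rcases a1.1.mem_succ_cases hi with rfl | ⟨p, hp, rfl⟩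
  · rw [b3, c3]
  · rw [b4 p hp, c4 p (a2.1.1.1 m a3 p hp), a4 p hp]

theorem Ini.eq_nil_or [Ambient L] {σ ρ u τ : M} (h : Ini L σ ρ) (h1 : Pre L u τ ρ) :
    σ = nil ∨ ∃ τ', Pre L u τ' σ ∧ Ini L τ' τ := by
  obtain ⟨m, n, a1, a2, a3, a4⟩ := h
  rcases a1.1.cases with rfl | ⟨p, hp, rfl⟩
  · exact Or.inl a1.eq_nil
  · right
    obtain ⟨u', τ', h'⟩ := a1.exists_pre hp
    obtain ⟨q, b1, b2, b3, b4⟩ := h'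
    obtain ⟨r, c1, c2, c3, c4⟩ := h1
    obtain rfl := succ_inj (a1.len_unique b2)
    obtain rfl := a2.len_unique c2
    have hpr := c1.1.1.of_succ_mem_succ a3
    refine ⟨τ', ⟨p, b1, b2, ?_, b4⟩, p, r, b1, c1, hpr, fun i hi => ?_⟩
    · rw [a4 _ hp.empty_mem_succ, c3]
    · rw [← b4 i hi, a4 _ (hp.succ_mem_succ hi), c4 i (c1.1.1.1 p hpr i hi)]

end Tuples

/-! ### Trees and their collapses -/

section Trees

variable {M : Type u} [SetStructure M] {α : Type} [Nonempty M]

/-- `T` is a tree of tuples of subsets of `L`. -/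
def Tree (L T : M) : Prop := (∀ σ, σ ∈ₘ T → ∃ n, IsT L n σ) ∧
  (∀ ρ, ρ ∈ₘ T → ∀ σ, Ini L σ ρ → σ ∈ₘ T) ∧ nil ∈ₘ T

/-- `T` is a well-founded tree of tuples of subsets of `L`. -/
def Suit (L T : M) : Prop := Tree L T ∧
  ∀ Z, Sub Z T → (∃ σ, σ ∈ₘ Z) → ∃ σ, σ ∈ₘ Z ∧ ∀ u ρ, App L σ u ρ → ¬ ρ ∈ₘ Z

/-- `G` collapses the nodes of the tree `T`. -/
def NodeColl (L T G : M) : Prop := IsFun G T ∧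
  ∀ σ, σ ∈ₘ T → ∀ x, x ∈ₘ ap G σ ↔ ∃ u ρ, App L σ u ρ ∧ ρ ∈ₘ T ∧ x = ap G ρ

/-- `a` is the collapse of the root of the tree `T`. -/
def RootColl (L T a : M) : Prop := ∃ G, NodeColl L T G ∧ ap G nil = a

variable [hM : Fact (ModelsZF M)]

instance MD.suit [Finite α] {L : M} {s : (α → M) → M} [DTm id Set.univ s] :
    Dfn id Set.univ fun v => Suit L (s v) :=
  Dfn.comp1 (by unfold Suit Tree; infer_instance)

instance MD.nodeColl [Finite α] {L : M} {s t : (α → M) → M} [DTm id Set.univ s]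
    [DTm id Set.univ t] : Dfn id Set.univ fun v => NodeColl L (s v) (t v) :=
  Dfn.comp2 (by unfold NodeColl; infer_instance)

instance MD.rootColl [Finite α] {L : M} {s t : (α → M) → M} [DTm id Set.univ s]
    [DTm id Set.univ t] : Dfn id Set.univ fun v => RootColl L (s v) (t v) :=
  Dfn.comp2 (by unfold RootColl; infer_instance)

variable {L T a : M}

theorem isTreeOver_iff : IsTreeOver (pow L) T ↔ Tree L T := by
  constructor
  · rintro ⟨h1, h2, h3⟩
    have h1' : ∀ σ, σ ∈ₘ T → ∃ n, IsT L n σ := by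
      intro σ hσ
      obtain ⟨n, g, hg, hs, rfl⟩ := h1 σ hσ
      exact ⟨n, isT_tup hg fun i hi => mem_pow.1 (hs i hi)⟩
    refine ⟨h1', ?_, h3⟩
    rintro ρ hρ σ ⟨m, n, a1, a2, a3, a4⟩
    obtain ⟨g, hg, hg', rfl⟩ := a2.exists_seq
    obtain ⟨e, he, he', rfl⟩ := a1.exists_seq
    exact h2 n g m e hg hρ a3 he fun i hi => by
      rw [hg' i (a2.1.1.1 m a3 i hi), he' i hi, a4 i hi]
  · rintro ⟨h1, h2, h3⟩
    refine ⟨?_, ?_, h3⟩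
    · intro σ hσ
      obtain ⟨n, hn⟩ := h1 σ hσ
      obtain ⟨g, hg, hg', e⟩ := hn.exists_seq
      exact ⟨n, g, hg, fun i hi => by rw [mem_pow, hg' i hi]; exact co_sub _ _ _, e⟩
    · intro n g m h hg hT hm hh e
      obtain ⟨n', hn'⟩ := h1 _ hT
      obtain ⟨rfl, hs⟩ := hn'.of_tup hg
      have hmn := hg.1.1.1 m hm
      have hs' : ∀ i, i ∈ₘ m → Sub (app h i) L := fun i hi => e i hi ▸ hs i (hmn i hi)
      refine h2 _ hT _ ⟨m, n', isT_tup hh hs', hn', hm, fun i hi => ?_⟩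
      rw [co_tup hh hi (hs' i hi), co_tup hg (hmn i hi) (hs i (hmn i hi)), e i hi]

theorem isSuitable_iff : IsSuitable (pow L) T ↔ Suit L T := by
  unfold IsSuitable Suit
  rw [isTreeOver_iff]
  refine and_congr_right fun hT => forall₂_congr fun Z hZ => imp_congr_right fun _ =>
    exists_congr fun σ => and_congr_right fun _ => forall₂_congr fun u ρ => ?_
  constructor
  · intro h happ hρ
    obtain ⟨n, hn⟩ := hT.1 ρ (hZ ρ hρ)
    exact h ((isAppend_iff hn).2 happ) hρ
  · intro h happ hρ
    obtain ⟨n, hn⟩ := hT.1 ρ (hZ ρ hρ)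
    exact h ((isAppend_iff hn).1 happ) hρ

theorem Tree.sub [Ambient L] (h : Tree L T) : Sub T (pow L) := by
  intro σ hσ
  obtain ⟨n, hn⟩ := h.1 σ hσ
  exact mem_pow.2 hn.sub

/-- The comprehension defining `down` succeeds by Separation from `pow L`, as all tuples involved
are subsets of `L`. -/
theorem Tree.mem_down [Ambient L] (h : Tree L T) {u τ : M} :
    τ ∈ₘ down T u ↔ ∃ ρ, ρ ∈ₘ T ∧ Pre L u τ ρ := by
  have : down T u = compr fun τ => ∃ ρ, ρ ∈ₘ T ∧ Pre L u τ ρ := by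
    unfold down
    congr 1
    funext τ
    refine propext (exists_congr fun ρ => and_congr_right fun hρ => ?_)
    obtain ⟨n, hn⟩ := h.1 ρ hρ
    exact isPrepend_iff hn
  rw [this]
  refine compr_sep (P := fun τ => ∃ ρ, ρ ∈ₘ T ∧ Pre L u τ ρ) (a := pow L) ?_ τ
  rintro τ ⟨ρ, -, hρ⟩
  obtain ⟨n, hn⟩ := hρ.isT_left
  exact mem_pow.2 hn.sub

theorem Tree.sub_of_tup1 (h : Tree L T) {u : M} (hu : tup1 u ∈ₘ T) : Sub u L := by
  obtain ⟨n, hn⟩ := h.1 _ hu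
  exact hn.sub_of_tup1

theorem Suit.down [Ambient L] (h : Suit L T) {u : M} (hu : tup1 u ∈ₘ T) :
    Suit L (down T u) := by
  have hu' := h.1.sub_of_tup1 hu
  refine ⟨⟨?_, ?_, ?_⟩, ?_⟩
  · intro τ hτ
    obtain ⟨ρ, -, hρ⟩ := h.1.mem_down.1 hτ
    exact hρ.isT_left
  · intro τ hτ τ' hini
    obtain ⟨ρ, hρT, hρ⟩ := h.1.mem_down.1 hτ
    obtain ⟨ρ', hρ'⟩ := exists_pre hini.choose_spec.choose_spec.1 hu'
    exact h.1.mem_down.2 ⟨ρ', h.1.2.1 ρ hρT ρ' (hini.pre hρ' hρ), hρ'⟩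
  · exact h.1.mem_down.2 ⟨_, hu, pre_nil hu'⟩
  · rintro Z hZ ⟨τ0, hτ0⟩
    -- `Z` is transported into `T` by prepending `u`; a terminal node found there yields one of `Z`
    -- on removing its first entry.
    obtain ⟨Z', hZ'⟩ := sep (fun ρ => ∃ τ, τ ∈ₘ Z ∧ Pre L u τ ρ) T
    obtain ⟨ρ, hρ, hmax⟩ := h.2 Z' (fun ρ hρ => ((hZ' ρ).1 hρ).1) (by
      obtain ⟨ρ, hρT, hρ⟩ := h.1.mem_down.1 (hZ τ0 hτ0)
      exact ⟨ρ, (hZ' ρ).2 ⟨hρT, τ0, hτ0, hρ⟩⟩)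
    obtain ⟨-, τ, hτ, hpre⟩ := (hZ' ρ).1 hρ
    refine ⟨τ, hτ, fun v τ' happ hτ' => ?_⟩
    obtain ⟨ρ', hρT', hρ'⟩ := h.1.mem_down.1 (hZ τ' hτ')
    exact hmax v ρ' (happ.pre hpre hρ') ((hZ' ρ').2 ⟨hρT', τ', hτ', hρ'⟩)

/-! #### Collapses of nodes -/

/-- Well-foundedness in the form required by `exists_solvesRec`: extensions count as smaller than
the nodes they extend. -/
theorem Suit.wf (h : Suit L T) : ∀ Z, Sub Z T → (∃ σ, σ ∈ₘ Z) →
    ∃ σ, σ ∈ₘ Z ∧ ∀ ρ, ρ ∈ₘ Z → ¬ ∃ u, App L σ u ρ := by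
  intro Z hZ hne
  obtain ⟨σ, hσ, hm⟩ := h.2 Z hZ hne
  exact ⟨σ, hσ, fun ρ hρ ⟨u, hu⟩ => hm u ρ hu hρ⟩

theorem solvesRec_app_iff {G : M} :
    SolvesRec (fun ρ σ => ∃ u, App L σ u ρ) (fun y => upair y y) T G ↔
    ∀ σ, σ ∈ₘ T → ∀ x, x ∈ₘ ap G σ ↔ ∃ u ρ, App L σ u ρ ∧ ρ ∈ₘ T ∧ x = ap G ρ := by
  unfold SolvesRec
  refine forall₂_congr fun σ _ => forall_congr' fun x => iff_congr Iff.rfl ?_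
  simp only [mem_upair, or_self]
  constructor
  · rintro ⟨ρ, hρ, ⟨u, hu⟩, e⟩
    exact ⟨u, ρ, hu, hρ, e⟩
  · rintro ⟨u, ρ, hu, hρ, e⟩
    exact ⟨ρ, hρ, ⟨u, hu⟩, e⟩

theorem Suit.exists_nodeColl (h : Suit L T) : ∃ G, NodeColl L T G := by
  obtain ⟨G, hG, hr⟩ := exists_solvesRec (fun ρ σ => ∃ u, App L σ u ρ) (fun y => upair y y) h.wf
  exact ⟨G, hG, solvesRec_app_iff.1 hr⟩

theorem Suit.nodeColl_unique (h : Suit L T) {G G' σ : M} (hG : NodeColl L T G)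
    (hG' : NodeColl L T G') (hσ : σ ∈ₘ T) : ap G σ = ap G' σ :=
  (solvesRec_app_iff.2 hG.2).agree (solvesRec_app_iff.2 hG'.2) (fun _ _ _ _ _ => Iff.rfl)
    h.wf hσ hσ

theorem Suit.exists_rootColl (h : Suit L T) : ∃ a, RootColl L T a := by
  obtain ⟨G, hG⟩ := h.exists_nodeColl
  exact ⟨_, G, hG, rfl⟩

theorem RootColl.unique {b : M} (h : Suit L T) (ha : RootColl L T a) (hb : RootColl L T b) :
    a = b := by
  obtain ⟨G, hG, rfl⟩ := ha
  obtain ⟨G', hG', rfl⟩ := hb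
  exact h.nodeColl_unique hG hG' h.1.2.2

/-- The map `τ ↦ G(⌈u⌉⌢τ)` collapses the nodes of the subtree, because appending at the end commutes
with prepending `u`. -/
theorem NodeColl.rootColl_down [Ambient L] {G u : M} (h : Suit L T) (hG : NodeColl L T G)
    (hu : tup1 u ∈ₘ T) : RootColl L (KunenTree.down T u) (ap G (tup1 u)) := by
  have hu' := h.1.sub_of_tup1 hu
  obtain ⟨G', hG', he⟩ := exists_fun_rel (fun τ y => ∃ ρ, ρ ∈ₘ T ∧ Pre L u τ ρ ∧ y = ap G ρ)
    (A := KunenTree.down T u) (by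
      intro τ hτ
      obtain ⟨ρ, hρT, hρ⟩ := h.1.mem_down.1 hτ
      refine ⟨_, ⟨ρ, hρT, hρ, rfl⟩, ?_⟩
      rintro _ ⟨ρ', -, hρ', rfl⟩
      rw [hρ.right_unique hρ'])
  have key : ∀ τ ρ, Pre L u τ ρ → ρ ∈ₘ T → ap G' τ = ap G ρ := by
    intro τ ρ hρ hρT
    have hτ := h.1.mem_down.2 ⟨ρ, hρT, hρ⟩
    obtain ⟨ρ', -, hρ', e⟩ := he τ hτ
    rw [hG'.ap_eq hτ, e, hρ.right_unique hρ']
  refine ⟨G', ⟨hG', fun τ hτ x => ?_⟩, key _ _ (pre_nil hu') hu⟩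
  obtain ⟨ρ, hρT, hρ⟩ := h.1.mem_down.1 hτ
  rw [key τ ρ hρ hρT, hG.2 ρ hρT]
  constructor
  · rintro ⟨v, ρ', happ, hρT', rfl⟩
    obtain ⟨τ', h1, h2⟩ := happ.exists_of_pre hρ
    exact ⟨v, τ', h1, h.1.mem_down.2 ⟨ρ', hρT', h2⟩, (key τ' ρ' h2 hρT').symm⟩
  · rintro ⟨v, τ', happ, hτ', rfl⟩
    obtain ⟨ρ', hρT', hρ'⟩ := h.1.mem_down.1 hτ'
    exact ⟨v, ρ', happ.pre hρ hρ', hρT', key τ' ρ' hρ' hρT'⟩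

theorem RootColl.mem_iff [Ambient L] {x : M} (h : Suit L T) (ha : RootColl L T a) :
    x ∈ₘ a ↔ ∃ u, tup1 u ∈ₘ T ∧ RootColl L (KunenTree.down T u) x := by
  obtain ⟨G, hG, rfl⟩ := ha
  rw [hG.2 _ h.1.2.2]
  constructor
  · rintro ⟨u, ρ, happ, hρ, rfl⟩
    obtain rfl := happ.right_unique (app_nil happ.sub)
    exact ⟨u, hρ, hG.rootColl_down h hρ⟩
  · rintro ⟨u, hu, hx⟩
    exact ⟨u, _, app_nil (h.1.sub_of_tup1 hu), hu, hx.unique (h.down hu) (hG.rootColl_down h hu)⟩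

/-- `IsTcoll` recurses over trees, `RootColl` over the nodes of one tree. A solution `F` on any
domain `D` is forced at suitable trees by induction on the collapse: the subtrees `S ↓ ⌈u⌉` need not
be elements of `S`, but their collapses are elements of the collapse of `S`. Conversely, the
suitable trees form a set closed under `down`, on which the root collapse solves the recursion. -/
theorem isTcoll_iff [Ambient L] (h : Suit L T) : IsTcoll T a ↔ RootColl L T a := by
  constructor
  · rintro ⟨D, F, hF, hT, hD, hr, rfl⟩
    obtain ⟨b, hb⟩ := h.exists_rootColl
    suffices app F T = b by rwa [this]
    by_contra hne
    obtain ⟨D', hD'⟩ := sep (fun S => Suit L S) D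
    obtain ⟨R, hR⟩ := repl_rel (fun S y => RootColl L S y) D' (by
      intro S hS y z hy hz
      exact hy.unique ((hD' S).1 hS).2 hz)
    -- `y` is minimal among the root collapses of suitable trees in `D` at which `F` has another
    -- value.
    obtain ⟨y, hy, ⟨S, hSD, hS, hSy, hne⟩, hmin⟩ := exists_minimal
      (fun y => ∃ S, S ∈ₘ D ∧ Suit L S ∧ RootColl L S y ∧ ap F S ≠ y) (a := R) (x := b)
      ((hR b).2 ⟨T, (hD' T).2 ⟨hT, h⟩, hb⟩) ⟨T, hT, h, hb, by rwa [hF.ap_eq hT]⟩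
    have key : ∀ u x, tup1 u ∈ₘ S → RootColl L (KunenTree.down S u) x →
        app F (KunenTree.down S u) = x := by
      intro u x hu hx
      have hd := hD S u hSD hu
      have := hmin x ((hSy.mem_iff hS).2 ⟨u, hu, hx⟩)
        ((hR x).2 ⟨_, (hD' _).2 ⟨hd, hS.down hu⟩, hx⟩)
      push Not at this
      rw [← hF.ap_eq hd]
      exact this _ hd (hS.down hu) hx
    refine hne (ext fun x => ?_)
    rw [hF.ap_eq hSD, hr S hSD, hSy.mem_iff hS]
    refine exists_congr fun u => and_congr_right fun hu => ?_
    constructor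
    · rintro rfl
      obtain ⟨x, hx⟩ := (hS.down hu).exists_rootColl
      rwa [key u x hu hx]
    · exact fun hx => (key u x hu hx).symm
  · intro ha
    obtain ⟨D, hD⟩ := sep (fun S => Suit L S) (pow (pow L))
    have hD' : ∀ S, S ∈ₘ D ↔ Suit L S := by
      intro S
      rw [hD, mem_pow]
      exact ⟨fun h => h.2, fun h => ⟨h.1.sub, h⟩⟩
    obtain ⟨F, hF, hFr⟩ := exists_fun_rel (fun S y => RootColl L S y) (A := D) (by
      intro S hS
      obtain ⟨y, hy⟩ := ((hD' S).1 hS).exists_rootColl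
      exact ⟨y, hy, fun z hz => hz.unique ((hD' S).1 hS) hy⟩)
    refine ⟨D, F, hF, (hD' T).2 h, fun S u hS hu => (hD' _).2 (((hD' S).1 hS).down hu), ?_,
      (hFr T ((hD' T).2 h)).unique h ha⟩
    intro S hS x
    have hS' := (hD' S).1 hS
    rw [(hFr S hS).mem_iff hS']
    refine exists_congr fun u => and_congr_right fun hu => ?_
    have hdn := hS'.down hu
    constructor
    · exact fun hx => hx.unique hdn (hFr _ ((hD' _).2 hdn))
    · rintro rfl
      exact hFr _ ((hD' _).2 hdn)

/-! #### The sets that are collapses -/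

/-- The tree of descending sequences below `a`, through a surjection `f` from a subset of the
power set of `L` onto a transitive set containing `a`. -/
theorem exists_suit_of_surjection [Ambient L] {N S f : M} (hN : IsTrans N) (ha : a ∈ₘ N)
    (hS : Sub S (pow L)) (hf : IsFun f S)
    (hfN : ∀ y, y ∈ₘ N ↔ ∃ x, x ∈ₘ S ∧ kpair x y ∈ₘ f) : ∃ T, Suit L T ∧ RootColl L T a := by
  have hfN' : ∀ y, y ∈ₘ N ↔ ∃ x, x ∈ₘ S ∧ ap f x = y := by
    intro y
    rw [hfN]
    refine exists_congr fun x => and_congr_right fun hx => ?_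
    rw [hf.kpair_mem_iff, hf.ap_eq hx]
    exact ⟨fun h => h.2, fun h => ⟨hx, h⟩⟩
  -- The entries are codes in `S`, the first with value in `a` and each later one with value in the
  -- value of its predecessor.
  let Good : M → M → Prop := fun n σ => ∀ i, i ∈ₘ n → co L σ i ∈ₘ S ∧
      (i = empty → ap f (co L σ i) ∈ₘ a) ∧
      ∀ p, i = succ p → ap f (co L σ i) ∈ₘ ap f (co L σ p)
  have iG : ∀ {β : Type} [Finite β] {s t : (β → M) → M} [DTm id Set.univ s] [DTm id Set.univ t],
    Dfn id Set.univ fun v => Good (s v) (t v) :=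
      Dfn.comp2 (by simp only [Good]; infer_instance)
  obtain ⟨T, hT⟩ := sep (fun σ => ∃ n, IsT L n σ ∧ Good n σ) (pow L)
  have hT' : ∀ n σ, IsT L n σ → (σ ∈ₘ T ↔ Good n σ) := by
    intro n σ hσ
    rw [hT, mem_pow]
    constructor
    · rintro ⟨-, m, hm, h⟩
      exact hm.len_unique hσ ▸ h
    · exact fun h => ⟨hσ.sub, n, hσ, h⟩
  -- The intended collapse of a node: `a` for the empty tuple, otherwise the value under `f` of the
  -- last entry.
  let val : M → M := fun σ => compr fun z =>
    (σ = nil ∧ z ∈ₘ a) ∨ ∃ p, IsT L (succ p) σ ∧ z ∈ₘ ap f (co L σ p)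
  have iv : ∀ {β : Type} [Finite β] {s : (β → M) → M} [DTm id Set.univ s],
    DTm id Set.univ fun v => val (s v) :=
      DTm.comp1 (by simp only [val]; infer_instance)
  have val_nil : val nil = a := by
    refine compr_eq fun z => ⟨fun h => Or.inl ⟨rfl, h⟩, ?_⟩
    rintro (h | ⟨p, h, -⟩)
    · exact h.2
    · exact (succ_ne_empty p (h.len_unique isT_nil)).elim
  have val_succ : ∀ p σ, IsT L (succ p) σ → val σ = ap f (co L σ p) := by
    intro p σ h
    refine compr_eq fun z => ⟨fun hz => Or.inr ⟨p, h, hz⟩, ?_⟩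
    rintro (⟨rfl, -⟩ | ⟨q, h', hz⟩)
    · exact (succ_ne_empty p (h.len_unique isT_nil)).elim
    · obtain rfl := succ_inj (h.len_unique h')
      exact hz
  have val_app : ∀ {σ u ρ}, App L σ u ρ → val ρ = ap f u := by
    rintro σ u ρ ⟨n, h1, h2, h3, h4⟩
    rw [val_succ n ρ h2, h4]
  have val_mem : ∀ σ, σ ∈ₘ T → val σ ∈ₘ N := by
    intro σ hσ
    obtain ⟨-, n, hn, hg⟩ := (hT σ).1 hσ
    rcases hn.1.cases with rfl | ⟨p, hp, rfl⟩
    · rw [hn.eq_nil, val_nil]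
      exact ha
    · rw [val_succ p σ hn]
      exact (hfN' _).2 ⟨_, (hg p (mem_succ_self p)).1, rfl⟩
  have key : ∀ {σ u ρ}, σ ∈ₘ T → App L σ u ρ → (ρ ∈ₘ T ↔ u ∈ₘ S ∧ ap f u ∈ₘ val σ) := by
    rintro σ u ρ hσ ⟨n, h1, h2, h3, h4⟩
    have hg := (hT' n σ h1).1 hσ
    rw [hT' _ ρ h2]
    have hn' : ∀ p, n = succ p → p ∈ₘ n := fun p e => e ▸ mem_succ_self p
    have e : ∀ {P : Prop}, ((n = empty → ap f u ∈ₘ a) ∧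
        (∀ p, n = succ p → ap f u ∈ₘ ap f (co L ρ p)) ↔ ap f u ∈ₘ val σ) := by
      intro _
      rcases h1.1.cases with rfl | ⟨p, hp, rfl⟩
      · rw [h1.eq_nil, val_nil]
        exact ⟨fun h => h.1 rfl, fun h => ⟨fun _ => h, fun p e => (succ_ne_empty p e.symm).elim⟩⟩
      · rw [val_succ p σ h1, ← h3 p (mem_succ_self p)]
        refine ⟨fun h => h.2 p rfl, fun h => ⟨fun e => (succ_ne_empty p e).elim, fun q e => ?_⟩⟩
        exact succ_inj e ▸ h
    rw [← e (P := True)]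
    constructor
    · intro h
      have := h n (mem_succ_self n)
      rwa [h4] at this
    · intro h i hi
      rcases mem_succ.1 hi with hi | rfl
      · have := hg i hi
        rw [h3 i hi]
        refine ⟨this.1, this.2.1, fun p hp => ?_⟩
        have hpn : p ∈ₘ n := h1.1.1.1 i hi p (hp ▸ mem_succ_self p)
        rw [h3 p hpn]
        exact this.2.2 p hp
      · rw [h4]
        exact h
  have hnil : nil ∈ₘ T := (hT' _ _ isT_nil).2 fun i hi => (mem_empty i hi).elim
  have hsuit : Suit L T := by
    refine ⟨⟨fun σ hσ => ?_, ?_, hnil⟩, ?_⟩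
    · obtain ⟨-, n, hn, -⟩ := (hT σ).1 hσ
      exact ⟨n, hn⟩
    · rintro ρ hρ σ ⟨m, n, h1, h2, h3, h4⟩
      rw [hT' m σ h1]
      intro i hi
      have := (hT' n ρ h2).1 hρ i (h2.1.1.1 m h3 i hi)
      rw [h4 i hi]
      refine ⟨this.1, this.2.1, fun p hp => ?_⟩
      rw [h4 p (h1.1.1.1 i hi p (hp ▸ mem_succ_self p))]
      exact this.2.2 p hp
    · rintro Z hZ ⟨σ0, hσ0⟩
      obtain ⟨R, hR⟩ := repl val Z
      -- Extending a node passes to an element of its value, so a node of `Z` with minimal value has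
      -- no extension in `Z`.
      obtain ⟨y, hy, hmin⟩ := hM.out.foundation R ⟨_, (hR _).2 ⟨σ0, hσ0, rfl⟩⟩
      obtain ⟨σ, hσ, rfl⟩ := (hR y).1 hy
      refine ⟨σ, hσ, fun u ρ happ hρ => ?_⟩
      refine hmin (val ρ) ?_ ((hR _).2 ⟨ρ, hρ, rfl⟩)
      rw [val_app happ]
      exact ((key (hZ σ hσ) happ).1 (hZ ρ hρ)).2
  obtain ⟨G, hG, hGv⟩ := exists_fun val T
  have hGv' : ∀ σ, σ ∈ₘ T → ap G σ = val σ := fun σ hσ => by rw [hG.ap_eq hσ, hGv σ hσ]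
  refine ⟨T, hsuit, G, ⟨hG, fun σ hσ x => ?_⟩, by rw [hGv' _ hnil, val_nil]⟩
  rw [hGv' σ hσ]
  constructor
  · intro hx
    -- Transitivity of `N` ensures that every element of the value of `σ` has a code in `S`.
    obtain ⟨u, hu, rfl⟩ := (hfN' x).1 (hN _ (val_mem σ hσ) x hx)
    obtain ⟨n, hn⟩ := hsuit.1.1 σ hσ
    obtain ⟨ρ, hρ⟩ := exists_app hn (mem_pow.1 (hS u hu))
    have hρT := (key hσ hρ).2 ⟨hu, hx⟩
    exact ⟨u, ρ, hρ, hρT, by rw [hGv' ρ hρT, val_app hρ]⟩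
  · rintro ⟨u, ρ, happ, hρ, rfl⟩
    rw [hGv' ρ hρ, val_app happ]
    exact ((key hσ happ).1 hρ).2

/-- For the converse of `exists_suit_of_surjection`, the values of a node collapse form a transitive
set, an image of `T`, which is an element of `pow (pow L)`. The comprehension defining `H` succeeds
by Replacement over the set of suitable trees. -/
theorem mem_H_iff [Ambient L] : a ∈ₘ H (pow (pow L)) ↔ ∃ T, Suit L T ∧ RootColl L T a := by
  have key : ∀ a : M, (∃ N, IsTrans N ∧ a ∈ₘ N ∧ ∃ S f, S ∈ₘ pow (pow L) ∧ IsFun f S ∧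
      ∀ y, y ∈ₘ N ↔ ∃ x, x ∈ₘ S ∧ kpair x y ∈ₘ f) ↔ ∃ T, Suit L T ∧ RootColl L T a := by
    intro a
    constructor
    · rintro ⟨N, hN, ha, S, f, hS, hf, hfN⟩
      exact exists_suit_of_surjection hN ha (mem_pow.1 hS) hf hfN
    · rintro ⟨T, hT, G, hG, rfl⟩
      obtain ⟨N, hN⟩ := repl (ap G) T
      refine ⟨N, ?_, (hN _).2 ⟨nil, hT.1.2.2, rfl⟩, T, G, mem_pow.2 hT.1.sub, hG.1, ?_⟩
      · intro y hy x hx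
        obtain ⟨σ, hσ, rfl⟩ := (hN y).1 hy
        obtain ⟨u, ρ, -, hρ, rfl⟩ := (hG.2 σ hσ x).1 hx
        exact (hN _).2 ⟨ρ, hρ, rfl⟩
      · intro y
        rw [hN]
        refine exists_congr fun σ => and_congr_right fun hσ => ?_
        rw [hG.1.kpair_mem_iff, hG.1.ap_eq hσ]
        exact ⟨fun h => ⟨hσ, h.symm⟩, fun h => h.2.symm⟩
  obtain ⟨W, hW⟩ := sep (fun T => Suit L T) (pow (pow L))
  obtain ⟨c, hc⟩ := repl_rel (fun T a => RootColl L T a) W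
    (fun T hT x y hx hy => hx.unique ((hW T).1 hT).2 hy)
  rw [← key]
  refine mem_compr ⟨c, fun a => ?_⟩ a
  rw [key, hc]
  refine exists_congr fun T => and_congr_left fun _ => ?_
  rw [hW, mem_pow]
  exact ⟨fun h => h.2, fun h => ⟨h.1.sub, h⟩⟩

end Trees

/-! ### Definability over `V_{λ+2}` -/

section Bounded

variable {M : Type u} [SetStructure M] {α : Type} [Nonempty M]

/-- The inclusion of the elements of `W`. -/
def inW (W : M) : Ext W → M := fun x => x.1

instance Emb.inW (W : M) : Emb (inW W) := ⟨Subtype.val_injective, fun _ _ => Iff.rfl⟩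

theorem Dfn.map_iff {W : M} (k : Ext W ↪ₑ[setLang] Ext W) {P : (α → M) → Prop}
    (h : Dfn (KunenTree.inW W) ∅ P) (v : α → Ext W) :
    (P fun a => (v a).1) ↔ P fun a => (k (v a)).1 := by
  obtain ⟨φ, hφ⟩ := Set.empty_definable_iff.1 h.out
  have hφ' : ∀ w : α → Ext W, φ.Realize w ↔ P fun a => (w a).1 := fun w => by
    change w ∈ {v : α → Ext W | φ.Realize v} ↔ w ∈ {v : α → Ext W | P fun a => (v a).1}
    rw [show {v : α → Ext W | P fun a => (v a).1} = {v : α → Ext W | φ.Realize v} from hφ]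
  rw [← hφ', ← hφ' fun a => k (v a), ← k.map_formula φ v]
  rfl

/-! ### Quantifiers, constants and basic operations over `W` -/

variable [hM : Fact (ModelsZF M)] {L : M}

theorem Ambient.sub_pow [hL : Ambient L] : Sub L (pow L) := fun x hx => mem_pow.2 (hL.trans x hx)

theorem Ambient.pow_sub_pow [hL : Ambient L] : Sub (pow L) (pow (pow L)) := fun _ hx =>
  mem_pow.2 ((mem_pow.1 hx).trans hL.sub_pow)

theorem Ambient.mem_pow_pow [hL : Ambient L] {x y : M} (hx : x ∈ₘ y) (hy : y ∈ₘ pow (pow L)) :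
    x ∈ₘ pow (pow L) := hL.pow_sub_pow x (mem_pow.1 hy x hx)

theorem Ambient.self_mem [hL : Ambient L] : L ∈ₘ pow (pow L) := mem_pow.2 hL.sub_pow

theorem Ambient.pow_mem [Ambient L] : pow L ∈ₘ pow (pow L) := mem_pow.2 (Sub.refl _)

instance WD.exW [Finite α] {P : (α → M) → M → Prop}
    [h : Dfn (inW (pow (pow L))) ∅ fun w : Option α → M => P (fun a => w (some a)) (w none)] :
    Dfn (inW (pow (pow L))) ∅ fun v => ∃ x, x ∈ₘ pow (pow L) ∧ P v x :=
  h.ex_range.congr fun _ => ⟨fun ⟨x, hx, hP⟩ => ⟨⟨x, hx⟩, hP⟩, fun ⟨x, hP⟩ => ⟨x.1, x.2, hP⟩⟩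

instance WD.allW [Finite α] {P : (α → M) → M → Prop}
    [h : Dfn (inW (pow (pow L))) ∅ fun w : Option α → M => P (fun a => w (some a)) (w none)] :
    Dfn (inW (pow (pow L))) ∅ fun v => ∀ x, x ∈ₘ pow (pow L) → P v x :=
  Dfn.congr (P := fun v => ¬ ∃ x, x ∈ₘ pow (pow L) ∧ ¬ P v x) inferInstance fun _ => by simp

/-- `pow (pow L)` is transitive, so a quantifier bounded by one of its elements never leaves it. -/
instance WD.exB [hL : Ambient L] [Finite α] {t : (α → M) → M} {P : (α → M) → M → Prop}
    [ht : DTm (inW (pow (pow L))) ∅ t]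
    [h : Dfn (inW (pow (pow L))) ∅ fun w : Option α → M => P (fun a => w (some a)) (w none)] :
    Dfn (inW (pow (pow L))) ∅ fun v => ∃ x, x ∈ₘ t v ∧ P v x := by
  have := ht.weaken (some : α → Option α)
  refine Dfn.congr (P := fun v => ∃ x, x ∈ₘ pow (pow L) ∧ x ∈ₘ t v ∧ P v x) inferInstance
    fun v => ?_
  constructor
  · rintro ⟨x, hx, hP⟩
    obtain ⟨n, hn⟩ := ht.total v
    exact ⟨x, hL.mem_pow_pow hx (hn ▸ n.2), hx, hP⟩
  · rintro ⟨x, -, hx, hP⟩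
    exact ⟨x, hx, hP⟩

instance WD.allB [Ambient L] [Finite α] {t : (α → M) → M} {P : (α → M) → M → Prop}
    [ht : DTm (inW (pow (pow L))) ∅ t]
    [h : Dfn (inW (pow (pow L))) ∅ fun w : Option α → M => P (fun a => w (some a)) (w none)] :
    Dfn (inW (pow (pow L))) ∅ fun v => ∀ x, x ∈ₘ t v → P v x :=
  Dfn.congr (P := fun v => ¬ ∃ x, x ∈ₘ t v ∧ ¬ P v x) inferInstance fun _ => by simp

/-- A constant of `W` given by a definable condition is a definable term. -/
theorem WD.const {c : M} (hc : c ∈ₘ pow (pow L)) (P : M → Prop)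
    (hP : Dfn (inW (pow (pow L))) ∅ fun v : Fin 1 → M => P (v 0))
    (h : ∀ x, x ∈ₘ pow (pow L) → (x = c ↔ P x)) :
    DTm (inW (pow (pow L))) ∅ fun _ : α → M => c := by
  refine ⟨fun _ => ⟨⟨c, hc⟩, rfl⟩, ?_⟩
  have : Dfn (inW (pow (pow L))) ∅ fun v : Option α → M => P (v none) := hP.comp1
  exact (this.congr (Q := fun v : Option α → M => v none = c) fun v => h _ (v none).2).out

variable [hL : Ambient L]

/-- `pow L` consists of all elements of elements of `W`, and `L` is in turn the union of `pow L`.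
Thus both are definable over `W` without parameters and may occur in statements transferred by `k`.
-/
instance WD.const_pow : DTm (inW (pow (pow L))) ∅ fun _ : α → M => pow L := by
  refine WD.const hL.pow_mem (fun y => ∀ z, z ∈ₘ pow (pow L) →
    (z ∈ₘ y ↔ ∃ w, w ∈ₘ pow (pow L) ∧ z ∈ₘ w)) inferInstance fun x hx => ?_
  constructor
  · rintro rfl z hz
    exact ⟨fun h => ⟨_, hL.pow_mem, h⟩, fun ⟨w, hw, h⟩ => mem_pow.1 hw z h⟩
  · intro h
    refine ext fun z => ⟨fun hz => mem_pow.1 hx z hz, fun hz => ?_⟩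
    exact (h z (hL.mem_pow_pow hz hL.pow_mem)).2 ⟨_, hL.pow_mem, hz⟩

instance WD.const_self : DTm (inW (pow (pow L))) ∅ fun _ : α → M => L := by
  refine WD.const hL.self_mem (fun y => (∀ z, z ∈ₘ y → ∃ w, w ∈ₘ pow L ∧ z ∈ₘ w) ∧
    ∀ w, w ∈ₘ pow L → ∀ z, z ∈ₘ w → z ∈ₘ y) inferInstance fun x hx => ?_
  constructor
  · rintro rfl
    exact ⟨fun z hz => ⟨_, mem_pow.2 (Sub.refl x), hz⟩, fun w hw z hz => mem_pow.1 hw z hz⟩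
  · rintro ⟨h1, h2⟩
    refine Sub.antisymm (fun z hz => ?_) (h2 _ (mem_pow.2 (Sub.refl _)))
    obtain ⟨w, hw, hz⟩ := h1 z hz
    exact mem_pow.1 hw z hz

local notation "ιW" => inW (pow (pow L))

variable {r s t q : (α → M) → M}

instance WD.sub [Finite α] [DTm ιW ∅ s] [DTm ιW ∅ t] : Dfn ιW ∅ fun v => Sub (s v) (t v) :=
  Dfn.comp2 (by unfold Sub; infer_instance)

instance WD.isTrans [Finite α] [DTm ιW ∅ t] : Dfn ιW ∅ fun v => IsTrans (t v) :=
  Dfn.comp1 (by unfold IsTrans; infer_instance)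

instance WD.isOrd [Finite α] [DTm ιW ∅ t] : Dfn ιW ∅ fun v => IsOrd (t v) :=
  Dfn.comp1 (by unfold IsOrd; infer_instance)

theorem Ambient.empty_mem : (empty : M) ∈ₘ L := hL.nat _ isNat_empty

theorem Ambient.mem_of_mem {x : M} (hx : x ∈ₘ L) : x ∈ₘ pow (pow L) :=
  hL.pow_sub_pow x (hL.sub_pow x hx)

instance WD.const_empty : DTm ιW ∅ fun _ : α → M => (empty : M) :=
  WD.const (hL.mem_of_mem hL.empty_mem) (fun y => ∀ z, z ∈ₘ y → ¬ z = z) inferInstance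
    fun _ _ => ⟨by rintro rfl z hz; exact (mem_empty z hz).elim,
      fun h => eq_empty fun z hz => h z hz rfl⟩

-- `W` is not closed under operations such as successor and pairing, so these are not total terms
-- over `W`. Only their graphs are treated, through descriptions with bounded quantifiers.
omit hL in
theorem eq_succ_iff {a b : M} :
    a = succ b ↔ (∀ x, x ∈ₘ a → x ∈ₘ b ∨ x = b) ∧ Sub b a ∧ b ∈ₘ a := by
  constructor
  · rintro rfl
    exact ⟨fun x => mem_succ.1, fun x hx => mem_succ.2 (Or.inl hx), mem_succ_self b⟩
  · rintro ⟨h1, h2, h3⟩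
    refine ext fun x => ⟨fun hx => mem_succ.2 (h1 x hx), fun hx => ?_⟩
    rcases mem_succ.1 hx with hx | rfl
    exacts [h2 x hx, h3]

instance WD.eqSucc [Finite α] [DTm ιW ∅ s] [DTm ιW ∅ t] : Dfn ιW ∅ fun v => s v = succ (t v) :=
  Dfn.comp2 (p := fun a b => a = succ b) (by simp only [eq_succ_iff]; infer_instance)

instance WD.const_one : DTm ιW ∅ fun _ : α → M => succ (empty : M) :=
  WD.const (hL.mem_of_mem (hL.nat _ isNat_one)) (fun y => y = succ empty) inferInstance
    fun _ _ => Iff.rfl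

omit hL in
theorem isNat_iff_bounded {n : M} : IsNat n ↔ IsOrd n ∧
    (n = empty ∨ ∃ p, p ∈ₘ n ∧ n = succ p) ∧
    ∀ m, m ∈ₘ n → m = empty ∨ ∃ p, p ∈ₘ m ∧ m = succ p := by
  have : ∀ m : M, (m = empty ∨ ∃ p, p ∈ₘ m ∧ m = succ p) ↔
      (m = empty ∨ ∃ p, m = succ p) := fun m =>
    or_congr Iff.rfl (exists_congr fun p => ⟨fun h => h.2, fun h => ⟨h ▸ mem_succ_self p, h⟩⟩)
  simp only [this]
  refine and_congr_right fun _ => ⟨fun h => ⟨h n (mem_succ_self n), fun m hm =>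
    h m (mem_succ.2 (Or.inl hm))⟩, fun h m hm => ?_⟩
  rcases mem_succ.1 hm with hm | rfl
  exacts [h.2 m hm, h.1]

instance WD.isNat [Finite α] [DTm ιW ∅ t] : Dfn ιW ∅ fun v => IsNat (t v) :=
  Dfn.comp1 (by simp only [isNat_iff_bounded]; infer_instance)

omit hL in
theorem eq_upair_iff {a b c : M} :
    a = upair b c ↔ (∀ x, x ∈ₘ a → x = b ∨ x = c) ∧ b ∈ₘ a ∧ c ∈ₘ a := by
  constructor
  · rintro rfl
    simp
  · rintro ⟨h1, h2, h3⟩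
    refine ext fun x => ⟨fun hx => mem_upair.2 (h1 x hx), fun hx => ?_⟩
    rcases mem_upair.1 hx with rfl | rfl
    exacts [h2, h3]

instance WD.eqUpair [Finite α] [DTm ιW ∅ s] [DTm ιW ∅ t] [DTm ιW ∅ r] :
    Dfn ιW ∅ fun v => s v = upair (t v) (r v) :=
  Dfn.comp3 (p := fun a b c => a = upair b c) (by simp only [eq_upair_iff]; infer_instance)

omit hL in
theorem eq_kpair_iff {a b c : M} : a = kpair b c ↔ ∃ x, x ∈ₘ a ∧ ∃ y, y ∈ₘ a ∧
    a = upair x y ∧ x = upair b b ∧ y = upair b c := by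
  constructor
  · rintro rfl
    exact ⟨_, mem_upair.2 (Or.inl rfl), _, mem_upair.2 (Or.inr rfl), rfl, rfl, rfl⟩
  · rintro ⟨x, -, y, -, rfl, rfl, rfl⟩
    rfl

instance WD.eqKpair [Finite α] [DTm ιW ∅ s] [DTm ιW ∅ t] [DTm ιW ∅ r] :
    Dfn ιW ∅ fun v => s v = kpair (t v) (r v) :=
  Dfn.comp3 (p := fun a b c => a = kpair b c) (by simp only [eq_kpair_iff]; infer_instance)

/-! #### The flat coding operations -/

theorem Ambient.kpair_mem {a b : M} (ha : a ∈ₘ L) (hb : b ∈ₘ L) : kpair a b ∈ₘ L :=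
  hL.upair _ _ (hL.upair _ _ ha ha) (hL.upair _ _ ha hb)

theorem Ambient.of_kpair_mem {a b : M} (h : kpair a b ∈ₘ L) : a ∈ₘ L ∧ b ∈ₘ L := by
  have := hL.trans _ h _ (mem_upair.2 (Or.inr rfl))
  exact ⟨hL.trans _ this _ (mem_upair.2 (Or.inl rfl)),
    hL.trans _ this _ (mem_upair.2 (Or.inr rfl))⟩

/-- `m` is the double of the natural number `n`. -/
def IsDbl (n m : M) : Prop := IsNat n ∧ m = dbl n

/-- The chain `f` need not be a function: if every pair other than `(0, 0)` has its predecessor in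
`f`, induction on the first coordinate forces the second to be its double. A suitable chain lies in
`L`, as it is built by inserting one pair at a time. -/
theorem isDbl_iff_chain {n m : M} : IsDbl n m ↔ IsNat n ∧ ∃ f, f ∈ₘ L ∧ kpair n m ∈ₘ f ∧
    ∀ p, p ∈ₘ f → p = kpair empty empty ∨
      ∃ i d, kpair i d ∈ₘ f ∧ p = kpair (succ i) (succ (succ d)) := by
  refine and_congr_right fun hn => ?_
  constructor
  · rintro rfl
    refine IsNat.induct (fun n => ∃ f, f ∈ₘ L ∧ kpair n (dbl n) ∈ₘ f ∧
      ∀ p, p ∈ₘ f → p = kpair empty empty ∨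
        ∃ i d, kpair i d ∈ₘ f ∧ p = kpair (succ i) (succ (succ d))) ?_ ?_ hn
    · have h0 := hL.kpair_mem hL.empty_mem hL.empty_mem
      refine ⟨upair (kpair empty empty)
        (kpair empty empty), hL.upair _ _ h0 h0, ?_, fun p hp => Or.inl ?_⟩
      · rw [dbl_empty]; simp
      · simpa using hp
    · rintro n hn ⟨f, hf, hnf, hr⟩
      obtain ⟨g, hg⟩ := exists_insert f (kpair (succ n) (dbl (succ n)))
      refine ⟨g, hL.insert _ _ _ hf (hL.kpair_mem (hL.nat _ hn.succ)
        (hL.nat _ hn.succ.dbl)) hg, (hg _).2 (Or.inr rfl), fun p hp => ?_⟩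
      rcases (hg p).1 hp with hp | rfl
      · rcases hr p hp with h | ⟨i, d, h, e⟩
        · exact Or.inl h
        · exact Or.inr ⟨i, d, (hg _).2 (Or.inl h), e⟩
      · exact Or.inr ⟨n, dbl n, (hg _).2 (Or.inl hnf), by rw [dbl_succ hn]⟩
  · rintro ⟨f, hf, hnf, hr⟩
    refine IsNat.induct (fun n => ∀ m, kpair n m ∈ₘ f → m = dbl n) ?_ ?_ hn m hnf
    · intro m hm
      rcases hr _ hm with e | ⟨i, d, -, e⟩
      · rw [(kpair_inj e).2, dbl_empty]
      · exact (succ_ne_empty _ (kpair_inj e).1.symm).elim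
    · intro n hn ih m hm
      rcases hr _ hm with e | ⟨i, d, h, e⟩
      · exact (succ_ne_empty _ (kpair_inj e).1).elim
      · obtain ⟨e1, rfl⟩ := kpair_inj e
        obtain rfl := succ_inj e1
        rw [ih d h, dbl_succ hn]

theorem isDbl_iff_bounded {n m : M} : IsDbl n m ↔ IsNat n ∧ ∃ f, f ∈ₘ L ∧
    (∃ p, p ∈ₘ f ∧ p = kpair n m) ∧
    ∀ p, p ∈ₘ f → p = kpair empty empty ∨
      ∃ i, i ∈ₘ L ∧ ∃ d, d ∈ₘ L ∧ (∃ q, q ∈ₘ f ∧ q = kpair i d) ∧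
        ∃ i', i' ∈ₘ L ∧ i' = succ i ∧ ∃ d', d' ∈ₘ L ∧ d' = succ d ∧
          ∃ d'', d'' ∈ₘ L ∧ d'' = succ d' ∧ p = kpair i' d'' := by
  rw [isDbl_iff_chain (L := L)]
  refine and_congr_right fun hn => exists_congr fun f => and_congr_right fun hf => ?_
  refine and_congr ⟨fun h => ⟨_, h, rfl⟩, fun ⟨p, hp, e⟩ => e ▸ hp⟩
    (forall₂_congr fun p hp => or_congr Iff.rfl ?_)
  constructor
  · rintro ⟨i, d, h, rfl⟩
    obtain ⟨hi, hd⟩ := hL.of_kpair_mem (hL.trans f hf _ h)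
    obtain ⟨hi', hd'⟩ := hL.of_kpair_mem (hL.trans f hf _ hp)
    exact ⟨i, hi, d, hd, ⟨_, h, rfl⟩, _, hi', rfl, _, hL.trans _ hd' _ (mem_succ_self _), rfl,
      _, hd', rfl, rfl⟩
  · rintro ⟨i, -, d, -, ⟨q, hq, rfl⟩, _, -, rfl, _, -, rfl, _, -, rfl, rfl⟩
    exact ⟨i, d, hq, rfl⟩

instance WD.isDbl [Finite α] [DTm ιW ∅ s] [DTm ιW ∅ t] : Dfn ιW ∅ fun v => IsDbl (s v) (t v) :=
  Dfn.comp2 (by simp only [isDbl_iff_bounded (L := L)]; infer_instance)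

omit hL in
theorem eq_sh_iff {x y : M} : y = sh x ↔
    (IsNat x ∧ ∃ d, d ∈ₘ y ∧ IsDbl x d ∧ y = succ d) ∨ (¬ IsNat x ∧ y = x) := by
  by_cases hx : IsNat x
  · rw [sh_of_isNat hx]
    simp only [hx, true_and, not_true_eq_false, false_and, or_false]
    constructor
    · rintro rfl
      exact ⟨_, mem_succ_self _, ⟨hx, rfl⟩, rfl⟩
    · rintro ⟨d, -, ⟨-, rfl⟩, rfl⟩
      rfl
  · rw [sh_of_not_isNat hx]
    simp [hx]

instance WD.eqSh [Finite α] [DTm ιW ∅ s] [DTm ιW ∅ t] : Dfn ιW ∅ fun v => s v = sh (t v) :=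
  Dfn.comp2 (p := fun a b => a = sh b) (by simp only [eq_sh_iff]; infer_instance)

omit hL in
theorem eq_fl_iff {z n x : M} : z = fl n x ↔
    (∀ y, y ∈ₘ z → (∃ w, w ∈ₘ x ∧ y = sh w) ∨ ∃ i, i ∈ₘ n ∧ IsDbl i y) ∧
    (∀ w, w ∈ₘ x → ∃ y, y ∈ₘ z ∧ y = sh w) ∧
    ∀ i, i ∈ₘ n → IsNat i → ∃ y, y ∈ₘ z ∧ IsDbl i y := by
  constructor
  · rintro rfl
    refine ⟨fun y hy => mem_fl.1 hy, fun w hw => ⟨_, sh_mem_fl.2 hw, rfl⟩, fun i hi hn =>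
      ⟨_, (dbl_mem_fl hn).2 hi, hn, rfl⟩⟩
  · rintro ⟨h1, h2, h3⟩
    refine ext fun y => ⟨fun hy => mem_fl.2 (h1 y hy), fun hy => ?_⟩
    rcases mem_fl.1 hy with ⟨w, hw, rfl⟩ | ⟨i, hi, hn, rfl⟩
    · obtain ⟨y, hy, rfl⟩ := h2 w hw
      exact hy
    · obtain ⟨y, hy, -, rfl⟩ := h3 i hi hn
      exact hy

instance WD.eqFl [Finite α] [DTm ιW ∅ s] [DTm ιW ∅ t] [DTm ιW ∅ r] :
    Dfn ιW ∅ fun v => s v = fl (t v) (r v) :=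
  Dfn.comp3 (p := fun a b c => a = fl b c) (by simp only [eq_fl_iff]; infer_instance)

/-! #### Tuples and trees -/

/-- `x` is an element of the entry of index `i` of `σ`. -/
def Ent (L σ i x : M) : Prop :=
  ∃ y, y ∈ₘ L ∧ y = fl i x ∧ ∃ z, z ∈ₘ σ ∧ z = fl (succ empty) y

instance WD.ent [Finite α] [DTm ιW ∅ s] [DTm ιW ∅ t] [DTm ιW ∅ r] :
    Dfn ιW ∅ fun v => Ent L (s v) (t v) (r v) :=
  Dfn.comp3 (by unfold Ent; infer_instance)

theorem mem_co_iff_ent {σ i x : M} (hi : IsNat i) (hx : x ∈ₘ L) :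
    x ∈ₘ co L σ i ↔ Ent L σ i x := by
  rw [mem_co]
  constructor
  · rintro ⟨-, h⟩
    exact ⟨_, hL.fl _ _ hi hx, rfl, _, h, rfl⟩
  · rintro ⟨_, -, rfl, _, h, rfl⟩
    exact ⟨hx, h⟩

theorem co_eq_iff {σ τ i j : M} (hi : IsNat i) (hj : IsNat j) :
    co L σ i = co L τ j ↔ ∀ x, x ∈ₘ L → (Ent L σ i x ↔ Ent L τ j x) := by
  constructor
  · intro e x hx
    rw [← mem_co_iff_ent hi hx, e, mem_co_iff_ent hj hx]
  · intro h
    refine ext fun x => ?_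
    by_cases hx : x ∈ₘ L
    · rw [mem_co_iff_ent hi hx, h x hx, mem_co_iff_ent hj hx]
    · exact ⟨fun h => (hx (mem_co.1 h).1).elim, fun h => (hx (mem_co.1 h).1).elim⟩

theorem co_eq_iff' {σ u i : M} (hi : IsNat i) :
    co L σ i = u ↔ Sub u L ∧ ∀ x, x ∈ₘ L → (Ent L σ i x ↔ x ∈ₘ u) := by
  constructor
  · rintro rfl
    exact ⟨co_sub _ _ _, fun x hx => (mem_co_iff_ent hi hx).symm⟩
  · rintro ⟨hu, h⟩
    refine ext fun x => ⟨fun hx => ?_, fun hx => ?_⟩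
    · have := (mem_co.1 hx).1
      rwa [mem_co_iff_ent hi this, h x this] at hx
    · rwa [mem_co_iff_ent hi (hu x hx), h x (hu x hx)]

theorem isT_iff_bounded {n σ : M} : IsT L n σ ↔ IsNat n ∧
    (∀ z, z ∈ₘ σ → (∃ i, i ∈ₘ n ∧ z = fl empty i) ∨
      ∃ i, i ∈ₘ n ∧ ∃ x, x ∈ₘ L ∧ ∃ y, y ∈ₘ L ∧ y = fl i x ∧ z = fl (succ empty) y) ∧
    ∀ i, i ∈ₘ n → ∃ z, z ∈ₘ σ ∧ z = fl empty i := by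
  refine and_congr_right fun hn => and_congr (forall₂_congr fun z _ => or_congr Iff.rfl
    (exists_congr fun i => and_congr_right fun hi => exists_congr fun x =>
      and_congr_right fun hx => ?_)) (forall₂_congr fun i _ => ?_)
  · exact ⟨fun e => ⟨_, hL.fl _ _ (hn.mem hi) hx, rfl, e⟩, by rintro ⟨_, -, rfl, e⟩; exact e⟩
  · exact ⟨fun h => ⟨_, h, rfl⟩, by rintro ⟨_, h, rfl⟩; exact h⟩

instance WD.isT [Finite α] [DTm ιW ∅ s] [DTm ιW ∅ t] :
    Dfn ιW ∅ fun v => IsT L (s v) (t v) :=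
  Dfn.comp2 (by simp only [isT_iff_bounded]; infer_instance)

theorem IsT.len_mem {n σ : M} (h : IsT L n σ) : n ∈ₘ L := hL.nat n h.1

theorem app_iff_bounded {σ u ρ : M} : App L σ u ρ ↔ ∃ n, n ∈ₘ L ∧ ∃ n', n' ∈ₘ L ∧ n' = succ n ∧
    IsT L n σ ∧ IsT L n' ρ ∧
    (∀ i, i ∈ₘ n → ∀ x, x ∈ₘ L → (Ent L ρ i x ↔ Ent L σ i x)) ∧
    Sub u L ∧ ∀ x, x ∈ₘ L → (Ent L ρ n x ↔ x ∈ₘ u) := by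
  constructor
  · rintro ⟨n, h1, h2, h3, h4⟩
    refine ⟨n, h1.len_mem, _, h2.len_mem, rfl, h1, h2, fun i hi => ?_, (co_eq_iff' h1.1).1 h4⟩
    exact (co_eq_iff (h1.1.mem hi) (h1.1.mem hi)).1 (h3 i hi)
  · rintro ⟨n, -, _, -, rfl, h1, h2, h3, h4⟩
    refine ⟨n, h1, h2, fun i hi => ?_, (co_eq_iff' h1.1).2 h4⟩
    exact (co_eq_iff (h1.1.mem hi) (h1.1.mem hi)).2 (h3 i hi)

instance WD.app [Finite α] [DTm ιW ∅ s] [DTm ιW ∅ t] [DTm ιW ∅ r] :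
    Dfn ιW ∅ fun v => App L (s v) (t v) (r v) :=
  Dfn.comp3 (by simp only [app_iff_bounded]; infer_instance)

theorem pre_iff_bounded {u τ ρ : M} : Pre L u τ ρ ↔ ∃ n, n ∈ₘ L ∧ ∃ n', n' ∈ₘ L ∧ n' = succ n ∧
    IsT L n τ ∧ IsT L n' ρ ∧
    (Sub u L ∧ ∀ x, x ∈ₘ L → (Ent L ρ empty x ↔ x ∈ₘ u)) ∧
    ∀ i, i ∈ₘ n → ∃ i', i' ∈ₘ n' ∧ i' = succ i ∧
      ∀ x, x ∈ₘ L → (Ent L ρ i' x ↔ Ent L τ i x) := by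
  constructor
  · rintro ⟨n, h1, h2, h3, h4⟩
    refine ⟨n, h1.len_mem, _, h2.len_mem, rfl, h1, h2, (co_eq_iff' isNat_empty).1 h3,
      fun i hi => ⟨_, h1.1.succ_mem_succ hi, rfl, ?_⟩⟩
    exact (co_eq_iff (h1.1.mem hi).succ (h1.1.mem hi)).1 (h4 i hi)
  · rintro ⟨n, -, _, -, rfl, h1, h2, h3, h4⟩
    refine ⟨n, h1, h2, (co_eq_iff' isNat_empty).2 h3, fun i hi => ?_⟩
    obtain ⟨_, -, rfl, h⟩ := h4 i hi
    exact (co_eq_iff (h1.1.mem hi).succ (h1.1.mem hi)).2 h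

instance WD.pre [Finite α] [DTm ιW ∅ s] [DTm ιW ∅ t] [DTm ιW ∅ r] :
    Dfn ιW ∅ fun v => Pre L (s v) (t v) (r v) :=
  Dfn.comp3 (by simp only [pre_iff_bounded]; infer_instance)

theorem ini_iff_bounded {σ ρ : M} : Ini L σ ρ ↔ ∃ m, m ∈ₘ L ∧ ∃ n, n ∈ₘ L ∧ IsT L m σ ∧
    IsT L n ρ ∧ m ∈ₘ n ∧ ∀ i, i ∈ₘ m → ∀ x, x ∈ₘ L → (Ent L σ i x ↔ Ent L ρ i x) := by
  constructor
  · rintro ⟨m, n, h1, h2, h3, h4⟩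
    exact ⟨m, h1.len_mem, n, h2.len_mem, h1, h2, h3, fun i hi =>
      (co_eq_iff (h1.1.mem hi) (h1.1.mem hi)).1 (h4 i hi)⟩
  · rintro ⟨m, -, n, -, h1, h2, h3, h4⟩
    exact ⟨m, n, h1, h2, h3, fun i hi => (co_eq_iff (h1.1.mem hi) (h1.1.mem hi)).2 (h4 i hi)⟩

instance WD.ini [Finite α] [DTm ιW ∅ s] [DTm ιW ∅ t] :
    Dfn ιW ∅ fun v => Ini L (s v) (t v) :=
  Dfn.comp2 (by simp only [ini_iff_bounded]; infer_instance)

theorem nil_mem : nil ∈ₘ pow L := mem_pow.2 (isT_nil (L := L)).sub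

instance WD.const_nil : DTm ιW ∅ fun _ : α → M => (nil : M) :=
  WD.const (hL.pow_sub_pow _ nil_mem) (fun y => IsT L empty y) inferInstance
    fun _ _ => ⟨fun h => h ▸ isT_nil, fun h => h.eq_nil⟩

/-- Every subset `Z` of `T` is an element of `pow (pow L)`, so well-foundedness as seen in `W` is
well-foundedness in `M`. The conjunct `σ = σ` only gives the existential the shape of a bounded
quantifier. -/
theorem suit_iff_bounded {T : M} (hT : Sub T (pow L)) : Suit L T ↔
    ((∀ σ, σ ∈ₘ T → ∃ n, n ∈ₘ L ∧ IsT L n σ) ∧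
      (∀ ρ, ρ ∈ₘ T → ∀ σ, σ ∈ₘ pow L → Ini L σ ρ → σ ∈ₘ T) ∧ nil ∈ₘ T) ∧
    ∀ Z, Z ∈ₘ pow (pow L) → Sub Z T → (∃ σ, σ ∈ₘ Z ∧ σ = σ) →
      ∃ σ, σ ∈ₘ Z ∧ ∀ u, u ∈ₘ pow L → ∀ ρ, ρ ∈ₘ pow L →
        App L σ u ρ → ¬ ρ ∈ₘ Z := by
  refine and_congr (and_congr (forall₂_congr fun σ _ => exists_congr fun n => ?_)
    (and_congr (forall₂_congr fun ρ _ => forall_congr' fun σ => ?_) Iff.rfl)) ?_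
  · exact ⟨fun h => ⟨h.len_mem, h⟩, fun h => h.2⟩
  · exact ⟨fun h _ => h, fun h hi => h (mem_pow.2 hi.choose_spec.choose_spec.1.sub) hi⟩
  · constructor
    · intro h Z _ hZ ⟨σ, hσ, _⟩
      obtain ⟨σ, hσ, h⟩ := h Z hZ ⟨σ, hσ⟩
      exact ⟨σ, hσ, fun u _ ρ _ => h u ρ⟩
    · intro h Z hZ ⟨σ, hσ⟩
      obtain ⟨σ, hσ, h⟩ := h Z (mem_pow.2 (hZ.trans hT)) hZ ⟨σ, hσ, rfl⟩
      exact ⟨σ, hσ, fun u ρ happ hρ =>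
        h u (mem_pow.2 happ.sub) ρ (hT ρ (hZ ρ hρ)) happ hρ⟩

instance WD.suit [Finite α] [DTm ιW ∅ t] : Dfn ιW ∅ fun v => Suit L (t v) :=
  Dfn.comp1 (Dfn.congr (P := fun v : Fin 1 → M =>
    ((∀ σ, σ ∈ₘ v 0 → ∃ n, n ∈ₘ L ∧ IsT L n σ) ∧
      (∀ ρ, ρ ∈ₘ v 0 → ∀ σ, σ ∈ₘ pow L → Ini L σ ρ → σ ∈ₘ v 0) ∧ nil ∈ₘ v 0) ∧
    ∀ Z, Z ∈ₘ pow (pow L) → Sub Z (v 0) → (∃ σ, σ ∈ₘ Z ∧ σ = σ) →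
      ∃ σ, σ ∈ₘ Z ∧ ∀ u, u ∈ₘ pow L → ∀ ρ, ρ ∈ₘ pow L →
        App L σ u ρ → ¬ ρ ∈ₘ Z) inferInstance fun v => suit_iff_bounded (mem_pow.1 (v 0).2))

instance WD.lev [Finite α] [DTm ιW ∅ t] : Dfn ιW ∅ fun v => Lev L (t v) :=
  Dfn.comp1 (by unfold Lev; infer_instance)

end Bounded

/-! ### Bisimulations of trees -/

section Bisimulation

variable {M : Type u} [SetStructure M] {α : Type} [Nonempty M]

/-- The pairs `(σ, τ)` with `⌈σ⌉⌢τ ∈ R`, for some `R`, are a bisimulation of `T` and `T'` relating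
the roots. -/
def Bisimilar (L T T' : M) : Prop := ∃ R, R ∈ₘ pow (pow L) ∧ (∃ ρ, ρ ∈ₘ R ∧ Pre L nil nil ρ) ∧
  ∀ σ, σ ∈ₘ T → ∀ τ, τ ∈ₘ T' → (∃ ρ, ρ ∈ₘ R ∧ Pre L σ τ ρ) →
    (∀ u, u ∈ₘ pow L → ∀ σ', σ' ∈ₘ T → App L σ u σ' →
      ∃ v, v ∈ₘ pow L ∧ ∃ τ', τ' ∈ₘ T' ∧ App L τ v τ' ∧ ∃ ρ, ρ ∈ₘ R ∧ Pre L σ' τ' ρ) ∧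
    (∀ v, v ∈ₘ pow L → ∀ τ', τ' ∈ₘ T' → App L τ v τ' →
      ∃ u, u ∈ₘ pow L ∧ ∃ σ', σ' ∈ₘ T ∧ App L σ u σ' ∧ ∃ ρ, ρ ∈ₘ R ∧ Pre L σ' τ' ρ)

variable [hM : Fact (ModelsZF M)] {L T T' a : M} [hL : Ambient L]

instance WD.bisimilar [Finite α] {s t : (α → M) → M} [DTm (inW (pow (pow L))) ∅ s]
    [DTm (inW (pow (pow L))) ∅ t] :
    Dfn (inW (pow (pow L))) ∅ fun v => Bisimilar L (s v) (t v) :=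
  Dfn.comp2 (by unfold Bisimilar; infer_instance)

/-- The bisimulation relates nodes with equal collapses. It is an element of `W` because each pair
is coded by a single tuple, hence by a subset of `L`. -/
theorem bisimilar_of_rootColl_eq (hT : Suit L T) (hT' : Suit L T') (h : RootColl L T a)
    (h' : RootColl L T' a) : Bisimilar L T T' := by
  obtain ⟨G, hG, hGa⟩ := h
  obtain ⟨G', hG', rfl⟩ := h'
  obtain ⟨R, hR⟩ := sep (fun ρ => ∃ σ, σ ∈ₘ T ∧ ∃ τ, τ ∈ₘ T' ∧ Pre L σ τ ρ ∧ ap G σ = ap G' τ)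
    (pow L)
  have key : ∀ σ, σ ∈ₘ T → ∀ τ, τ ∈ₘ T' →
      ((∃ ρ, ρ ∈ₘ R ∧ Pre L σ τ ρ) ↔ ap G σ = ap G' τ) := by
    intro σ hσ τ hτ
    constructor
    · rintro ⟨ρ, hρ, hpre⟩
      obtain ⟨-, σ', -, τ', -, hpre', e⟩ := (hR ρ).1 hρ
      obtain ⟨rfl, rfl⟩ := hpre.left_unique hpre'
      exact e
    · intro e
      obtain ⟨n, hn⟩ := hT'.1.1 τ hτ
      obtain ⟨ρ, hρ⟩ := exists_pre hn (mem_pow.1 (hT.1.sub σ hσ))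
      obtain ⟨m, hm⟩ := hρ.isT_right
      exact ⟨ρ, (hR ρ).2 ⟨mem_pow.2 hm.sub, σ, hσ, τ, hτ, hρ, e⟩, hρ⟩
  refine ⟨R, mem_pow.2 fun ρ hρ => ((hR ρ).1 hρ).1, (key _ hT.1.2.2 _ hT'.1.2.2).2 hGa, ?_⟩
  intro σ hσ τ hτ h
  have e := (key σ hσ τ hτ).1 h
  constructor
  · intro u _ σ' hσ' happ
    have : ap G σ' ∈ₘ ap G' τ := e ▸ (hG.2 σ hσ _).2 ⟨u, σ', happ, hσ', rfl⟩
    obtain ⟨v, τ', happ', hτ', e'⟩ := (hG'.2 τ hτ _).1 this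
    exact ⟨v, mem_pow.2 happ'.sub, τ', hτ', happ', (key σ' hσ' τ' hτ').2 e'⟩
  · intro v _ τ' hτ' happ
    have : ap G' τ' ∈ₘ ap G σ := e ▸ (hG'.2 τ hτ _).2 ⟨v, τ', happ, hτ', rfl⟩
    obtain ⟨u, σ', happ', hσ', e'⟩ := (hG.2 σ hσ _).1 this
    exact ⟨u, mem_pow.2 happ'.sub, σ', hσ', happ', (key σ' hσ' τ' hτ').2 e'.symm⟩

/-- Take a node `σ` of `T` terminal among those related to some `τ` with a different collapse. The
one-step extensions of `σ` and `τ` are matched with equal collapses, so extensionality gives a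
contradiction. -/
theorem Bisimilar.rootColl_eq {b : M} (hT : Suit L T) (hT' : Suit L T') (h : Bisimilar L T T')
    (ha : RootColl L T a) (hb : RootColl L T' b) : a = b := by
  obtain ⟨G, hG, rfl⟩ := ha
  obtain ⟨G', hG', rfl⟩ := hb
  obtain ⟨R, -, h0, hR⟩ := h
  by_contra hne
  obtain ⟨Z, hZ⟩ := sep
    (fun σ => ∃ τ, τ ∈ₘ T' ∧ (∃ ρ, ρ ∈ₘ R ∧ Pre L σ τ ρ) ∧ ap G σ ≠ ap G' τ) T
  obtain ⟨σ, hσZ, hmax⟩ := hT.2 Z (fun σ hσ => ((hZ σ).1 hσ).1)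
    ⟨nil, (hZ nil).2 ⟨hT.1.2.2, nil, hT'.1.2.2, h0, hne⟩⟩
  obtain ⟨hσ, τ, hτ, hρ, hne⟩ := (hZ σ).1 hσZ
  obtain ⟨h1, h2⟩ := hR σ hσ τ hτ hρ
  have key : ∀ u σ' τ', App L σ u σ' → σ' ∈ₘ T → τ' ∈ₘ T' → (∃ ρ, ρ ∈ₘ R ∧ Pre L σ' τ' ρ) →
      ap G σ' = ap G' τ' := by
    intro u σ' τ' happ hσ' hτ' hρ'
    by_contra hne'
    exact hmax u σ' happ ((hZ σ').2 ⟨hσ', τ', hτ', hρ', hne'⟩)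
  refine hne (ext fun x => ?_)
  rw [hG.2 σ hσ, hG'.2 τ hτ]
  constructor
  · rintro ⟨u, σ', happ, hσ', rfl⟩
    obtain ⟨v, -, τ', hτ', happ', hρ'⟩ := h1 u (mem_pow.2 happ.sub) σ' hσ' happ
    exact ⟨v, τ', happ', hτ', key u σ' τ' happ hσ' hτ' hρ'⟩
  · rintro ⟨v, τ', happ, hτ', rfl⟩
    obtain ⟨u, -, σ', hσ', happ', hρ'⟩ := h2 v (mem_pow.2 happ.sub) τ' hτ' happ
    exact ⟨u, σ', happ', hσ', (key u σ' τ' happ' hσ' hτ' hρ').symm⟩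

end Bisimulation

/-! ### The tree of all preimages of a tree under coded maps -/

section Preimages

variable {M : Type u} [SetStructure M] {α : Type} [Nonempty M]

/-- `y` is the value at `τ` of the map on subsets of `L` coded by `e`, namely
`τ ↦ {w ∈ L | (z, w) ∈ e for some z ⊆ τ in L}`. -/
def IsExtension (L e τ y : M) : Prop := ∀ w, w ∈ₘ L →
  (w ∈ₘ y ↔ ∃ z, z ∈ₘ L ∧ Sub z τ ∧ ∃ p, p ∈ₘ e ∧ p = kpair z w)

/-- `s` is the preimage of `T` under the map coded by `e`. -/
def IsPreimage (L T e s : M) : Prop := ∀ τ, τ ∈ₘ pow L →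
  (τ ∈ₘ s ↔ ∃ y, y ∈ₘ T ∧ IsExtension L e τ y)

/-- `B` consists of the empty tuple and of the `⌈e⌉⌢σ` with `σ` in the preimage of `T` under the
map coded by `e`, for those `e` for which this preimage is a suitable tree. -/
def IsPreimageTree (L T B : M) : Prop := ∀ ρ, ρ ∈ₘ pow L → (ρ ∈ₘ B ↔ ρ = nil ∨
  ∃ e, e ∈ₘ pow L ∧ ∃ σ, σ ∈ₘ pow L ∧ ∃ s, s ∈ₘ pow (pow L) ∧
    IsPreimage L T e s ∧ Suit L s ∧ σ ∈ₘ s ∧ Pre L e σ ρ)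

variable [hM : Fact (ModelsZF M)] {L T B : M}

instance MD.isExtension [Finite α] {r s t : (α → M) → M} [DTm id Set.univ r]
    [DTm id Set.univ s] [DTm id Set.univ t] :
    Dfn id Set.univ fun v => IsExtension L (r v) (s v) (t v) :=
  Dfn.comp3 (by unfold IsExtension; infer_instance)

instance MD.isPreimage [Finite α] {r s t : (α → M) → M} [DTm id Set.univ r]
    [DTm id Set.univ s] [DTm id Set.univ t] :
    Dfn id Set.univ fun v => IsPreimage L (r v) (s v) (t v) :=
  Dfn.comp3 (by unfold IsPreimage; infer_instance)

theorem exists_isPreimageTree (L T : M) : ∃ B, Sub B (pow L) ∧ IsPreimageTree L T B := by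
  obtain ⟨B, hB⟩ := sep (fun ρ : M => ρ = nil ∨
    ∃ e, e ∈ₘ pow L ∧ ∃ σ, σ ∈ₘ pow L ∧ ∃ s, s ∈ₘ pow (pow L) ∧
      IsPreimage L T e s ∧ Suit L s ∧ σ ∈ₘ s ∧ Pre L e σ ρ) (pow L)
  exact ⟨B, fun ρ hρ => ((hB ρ).1 hρ).1, fun ρ hρ => by rw [hB]; simp [hρ]⟩

variable [hL : Ambient L]

instance WD.isExtension [Finite α] {r s t : (α → M) → M} [DTm (inW (pow (pow L))) ∅ r]
    [DTm (inW (pow (pow L))) ∅ s] [DTm (inW (pow (pow L))) ∅ t] :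
    Dfn (inW (pow (pow L))) ∅ fun v => IsExtension L (r v) (s v) (t v) :=
  Dfn.comp3 (by unfold IsExtension; infer_instance)

instance WD.isPreimage [Finite α] {r s t : (α → M) → M} [DTm (inW (pow (pow L))) ∅ r]
    [DTm (inW (pow (pow L))) ∅ s] [DTm (inW (pow (pow L))) ∅ t] :
    Dfn (inW (pow (pow L))) ∅ fun v => IsPreimage L (r v) (s v) (t v) :=
  Dfn.comp3 (by unfold IsPreimage; infer_instance)

instance WD.isPreimageTree [Finite α] {s t : (α → M) → M} [DTm (inW (pow (pow L))) ∅ s]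
    [DTm (inW (pow (pow L))) ∅ t] :
    Dfn (inW (pow (pow L))) ∅ fun v => IsPreimageTree L (s v) (t v) :=
  Dfn.comp2 (by unfold IsPreimageTree; infer_instance)

omit hL in
theorem IsPreimage.unique {e s s' : M} (h : IsPreimage L T e s) (h' : IsPreimage L T e s')
    (hs : Sub s (pow L)) (hs' : Sub s' (pow L)) : s = s' :=
  ext fun τ => ⟨fun hτ => (h' τ (hs τ hτ)).2 ((h τ (hs τ hτ)).1 hτ),
    fun hτ => (h τ (hs' τ hτ)).2 ((h' τ (hs' τ hτ)).1 hτ)⟩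

theorem IsPreimageTree.nil_mem (h : IsPreimageTree L T B) : nil ∈ₘ B :=
  (h _ KunenTree.nil_mem).2 (Or.inl rfl)

theorem IsPreimageTree.mem_of_pre {e s σ ρ : M} (h : IsPreimageTree L T B)
    (hs : IsPreimage L T e s) (hs' : Suit L s) (hσ : σ ∈ₘ s) (hρ : Pre L e σ ρ) : ρ ∈ₘ B := by
  obtain ⟨n, hn⟩ := hρ.isT_right
  exact (h ρ (mem_pow.2 hn.sub)).2 (Or.inr ⟨e, mem_pow.2 hρ.sub, σ, hs'.1.sub σ hσ, s,
    mem_pow.2 hs'.1.sub, hs, hs', hσ, hρ⟩)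

theorem IsPreimageTree.cases {ρ : M} (h : IsPreimageTree L T B) (hB : Sub B (pow L))
    (hρ : ρ ∈ₘ B) : ρ = nil ∨
      ∃ e σ s, IsPreimage L T e s ∧ Suit L s ∧ σ ∈ₘ s ∧ Pre L e σ ρ := by
  rcases (h ρ (hB ρ hρ)).1 hρ with h | ⟨e, -, σ, -, s, -, h⟩
  · exact Or.inl h
  · exact Or.inr ⟨e, σ, s, h⟩

theorem IsPreimageTree.mem_iff_of_pre {e s σ ρ : M} (h : IsPreimageTree L T B)
    (hB : Sub B (pow L)) (hs : IsPreimage L T e s) (hs' : Suit L s) (hρ : Pre L e σ ρ) :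
    ρ ∈ₘ B ↔ σ ∈ₘ s := by
  refine ⟨fun hρB => ?_, fun hσ => h.mem_of_pre hs hs' hσ hρ⟩
  rcases h.cases hB hρB with rfl | ⟨e', σ', s', h1, h2, h3, h4⟩
  · exact hρ.ne_nil.elim
  · obtain ⟨rfl, rfl⟩ := hρ.left_unique h4
    rwa [hs.unique h1 hs'.1.sub h2.1.sub]

/-- Above `⌈e⌉` the tree is a copy of the suitable preimage for `e`, and extending a non-empty tuple
preserves its first entry. So a non-empty `Z` is either just the empty tuple or has a terminal node
within one of these copies. -/
theorem IsPreimageTree.suit (h : IsPreimageTree L T B) (hB : Sub B (pow L)) : Suit L B := by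
  refine ⟨⟨fun ρ hρ => ?_, fun ρ hρ σ hini => ?_, h.nil_mem⟩, ?_⟩
  · rcases h.cases hB hρ with rfl | ⟨e, σ, s, -, -, -, hpre⟩
    · exact ⟨_, isT_nil⟩
    · exact hpre.isT_right
  · rcases h.cases hB hρ with rfl | ⟨e, τ, s, h1, h2, h3, hpre⟩
    · obtain ⟨m, n, -, hn, hm, -⟩ := hini
      obtain rfl := hn.len_unique isT_nil
      exact (mem_empty m hm).elim
    · rcases hini.eq_nil_or hpre with rfl | ⟨τ', hpre', hini'⟩
      · exact h.nil_mem
      · exact h.mem_of_pre h1 h2 (h2.1.2.1 τ h3 τ' hini') hpre'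
  · rintro Z hZ ⟨ρ0, hρ0⟩
    by_cases hex : ∃ ρ, ρ ∈ₘ Z ∧ ρ ≠ nil
    · obtain ⟨ρ, hρ, hne⟩ := hex
      rcases h.cases hB (hZ ρ hρ) with rfl | ⟨e, τ, s, h1, h2, h3, hpre⟩
      · exact (hne rfl).elim
      obtain ⟨Z', hZ'⟩ := sep (fun τ => ∃ ρ, ρ ∈ₘ Z ∧ Pre L e τ ρ) s
      obtain ⟨τ1, hτ1, hmax⟩ := h2.2 Z' (fun τ hτ => ((hZ' τ).1 hτ).1)
        ⟨τ, (hZ' τ).2 ⟨h3, ρ, hρ, hpre⟩⟩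
      obtain ⟨hτ1s, ρ1, hρ1, hpre1⟩ := (hZ' τ1).1 hτ1
      refine ⟨ρ1, hρ1, fun u ρ2 happ hρ2 => ?_⟩
      obtain ⟨τ2, happ2, hpre2⟩ := happ.exists_of_pre hpre1
      exact hmax u τ2 happ2 ((hZ' τ2).2
        ⟨(h.mem_iff_of_pre hB h1 h2 hpre2).1 (hZ ρ2 hρ2), ρ2, hρ2, hpre2⟩)
    · push Not at hex
      refine ⟨ρ0, hρ0, fun u ρ happ hρ => ?_⟩
      obtain rfl := hex ρ hρ
      exact happ.ne_nil

theorem IsPreimageTree.tup1_mem {e s : M} (h : IsPreimageTree L T B) (he : Sub e L)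
    (hs : IsPreimage L T e s) (hs' : Suit L s) : tup1 e ∈ₘ B :=
  h.mem_of_pre hs hs' hs'.1.2.2 (pre_nil he)

theorem IsPreimageTree.down_eq {e s : M} (h : IsPreimageTree L T B) (hB : Sub B (pow L))
    (he : Sub e L) (hs : IsPreimage L T e s) (hs' : Suit L s) : down B e = s := by
  refine ext fun σ => ?_
  rw [(h.suit hB).1.mem_down]
  constructor
  · rintro ⟨ρ, hρ, hpre⟩
    exact (h.mem_iff_of_pre hB hs hs' hpre).1 hρ
  · intro hσ
    obtain ⟨n, hn⟩ := hs'.1.1 σ hσ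
    obtain ⟨ρ, hρ⟩ := exists_pre hn he
    exact ⟨ρ, h.mem_of_pre hs hs' hσ hρ, hρ⟩

end Preimages

/-! ### Elementary embeddings -/

section Elementary

variable {M : Type u} [SetStructure M] {α : Type} [Nonempty M] [hM : Fact (ModelsZF M)] {L : M}

instance MD.lev [Finite α] {t : (α → M) → M} [DTm id Set.univ t] :
    Dfn id Set.univ fun v => Lev L (t v) :=
  Dfn.comp1 (by unfold Lev; infer_instance)

variable [hL : Ambient L] (k : Ext (pow (pow L)) ↪ₑ[setLang] Ext (pow (pow L)))

theorem elementary1 (P : M → Prop) [h : Dfn (inW (pow (pow L))) ∅ fun v : Fin 1 → M => P (v 0)]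
    (x : Ext (pow (pow L))) : P x.1 ↔ P (k x).1 := h.map_iff k ![x]

theorem elementary2 (P : M → M → Prop)
    [h : Dfn (inW (pow (pow L))) ∅ fun v : Fin 2 → M => P (v 0) (v 1)]
    (x y : Ext (pow (pow L))) : P x.1 y.1 ↔ P (k x).1 (k y).1 := h.map_iff k ![x, y]

theorem elementary3 (P : M → M → M → Prop)
    [h : Dfn (inW (pow (pow L))) ∅ fun v : Fin 3 → M => P (v 0) (v 1) (v 2)]
    (x y z : Ext (pow (pow L))) : P x.1 y.1 z.1 ↔ P (k x).1 (k y).1 (k z).1 :=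
  h.map_iff k ![x, y, z]

/-- This makes `j` well defined: equality of collapses is carried across `k` as the existence of a
bisimulation. -/
theorem rootColl_map_unique {T T' : Ext (pow (pow L))} {a x y : M} (hT : Suit L T.1)
    (hT' : Suit L T'.1) (ha : RootColl L T.1 a) (ha' : RootColl L T'.1 a)
    (hx : RootColl L (k T).1 x) (hy : RootColl L (k T').1 y) : x = y :=
  ((elementary2 k (fun T T' => Bisimilar L T T') T T').1
    (bisimilar_of_rootColl_eq hT hT' ha ha')).rootColl_eq
      ((elementary1 k (fun T => Suit L T) T).1 hT) ((elementary1 k (fun T => Suit L T) T').1 hT')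
      hx hy

variable (hk : ∃ c : M, ∀ x y : Ext (pow (pow L)), kpair x.1 y.1 ∈ₘ c ↔ k x = y)
include hk

/-- The assumption that `k` is a set of `M` is exploited here: its graph is definable with a
parameter, so Separation and minimality arguments apply to statements about `k`. -/
theorem exists_graph : ∃ K : M → M → Prop, MD2 K ∧
    ∀ x y, K x y ↔ ∃ h : x ∈ₘ pow (pow L), (k ⟨x, h⟩).1 = y := by
  obtain ⟨c, hc⟩ := hk
  refine ⟨fun x y => x ∈ₘ pow (pow L) ∧ y ∈ₘ pow (pow L) ∧ kpair x y ∈ₘ c, inferInstance,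
    fun x y => ⟨?_, ?_⟩⟩
  · rintro ⟨hx, hy, h⟩
    exact ⟨hx, by rw [(hc ⟨x, hx⟩ ⟨y, hy⟩).1 h]⟩
  · rintro ⟨hx, rfl⟩
    exact ⟨hx, (k ⟨x, hx⟩).2, (hc ⟨x, hx⟩ (k ⟨x, hx⟩)).2 rfl⟩

/-- No level is mapped below itself. -/
theorem Lev.sub_map {v : Ext (pow (pow L))} (hv : v.1 ∈ₘ L) (hlev : Lev L v.1) :
    Sub v.1 (k v).1 := by
  obtain ⟨K, hK, hKk⟩ := exists_graph k hk
  have iK : ∀ {β : Type} [Finite β] {s t : (β → M) → M} [DTm id Set.univ s] [DTm id Set.univ t],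
    Dfn id Set.univ fun v => K (s v) (t v) := Dfn.comp2 hK
  by_contra hne
  -- Let `x` be a minimal level not included in `y = k(x)`. Comparability of levels gives `y ∈ x`,
  -- hence `k(y) ∈ k(x) = y`; minimality gives `y ⊆ k(y)`, so `k(y)` would be an element of itself.
  obtain ⟨x, hx, ⟨hxl, y, hxy, hne⟩, hmin⟩ := exists_minimal
    (fun x => Lev L x ∧ ∃ y, K x y ∧ ¬ Sub x y) hv ⟨hlev, _, (hKk _ _).2 ⟨v.2, rfl⟩, hne⟩
  obtain ⟨hxW, rfl⟩ := (hKk x y).1 hxy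
  set y := k ⟨x, hxW⟩ with hy
  have hyL : y.1 ∈ₘ L := (elementary1 k (fun x => x ∈ₘ L) ⟨x, hxW⟩).1 hx
  have hyl : Lev L y.1 := (elementary1 k (fun x => Lev L x) ⟨x, hxW⟩).1 hxl
  rcases hL.lev_total x y.1 hx hyL hxl hyl with h | h
  · exact hne h
  · have h1 : (k y).1 ∈ₘ y.1 := (elementary2 k (fun a b => a ∈ₘ b) y ⟨x, hxW⟩).1 h
    have h2 : Sub y.1 (k y).1 := by
      by_contra h2
      exact hmin y.1 h hyL ⟨hyl, _, (hKk _ _).2 ⟨y.2, rfl⟩, h2⟩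
    exact mem_irrefl _ (h2 _ h1)

/-- `k` is continuous at the subsets of `L`. -/
theorem mem_map_iff {x : Ext (pow (pow L))} {w : M} (hw : w ∈ₘ L) :
    w ∈ₘ (k x).1 ↔ ∃ z : Ext (pow (pow L)), z.1 ∈ₘ L ∧ Sub z.1 x.1 ∧ w ∈ₘ (k z).1 := by
  constructor
  · intro h
    -- Truncate `x` at a level `v` containing `w`: for `z = x ∩ v` elementarity gives `k(v) ∩ k(x) ⊆
    -- k(z)`, and `w ∈ v ⊆ k(v)`.
    obtain ⟨v, hv, hlev, hwv⟩ := hL.exists_lev w hw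
    obtain ⟨z, hz⟩ := sep (fun y => y ∈ₘ x.1) v
    have hzL : z ∈ₘ L := hL.sub v z hv fun y hy => ((hz y).1 hy).1
    refine ⟨⟨z, hL.mem_of_mem hzL⟩, hzL, fun y hy => ((hz y).1 hy).2, ?_⟩
    have := (elementary3 k (fun z v x => ∀ y, y ∈ₘ v → y ∈ₘ x → y ∈ₘ z) ⟨z, hL.mem_of_mem hzL⟩
      ⟨v, hL.mem_of_mem hv⟩ x).1 fun y hy hyx => (hz y).2 ⟨hy, hyx⟩
    exact this w (Lev.sub_map k hk (v := ⟨v, hL.mem_of_mem hv⟩) hv hlev w hwv) h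
  · rintro ⟨z, -, hzx, hwz⟩
    exact (elementary2 k (fun z x => Sub z x) z x).1 hzx w hwz

/-- Some `e` codes the restriction of `k` to the subsets of `L`. -/
theorem exists_code : ∃ e, Sub e L ∧ ∀ (τ : Ext (pow (pow L))) (y : M), τ.1 ∈ₘ pow L →
    y ∈ₘ pow L → (IsExtension L e τ.1 y ↔ y = (k τ).1) := by
  obtain ⟨K, hK, hKk⟩ := exists_graph k hk
  have iK : ∀ {β : Type} [Finite β] {s t : (β → M) → M} [DTm id Set.univ s] [DTm id Set.univ t],
    Dfn id Set.univ fun v => K (s v) (t v) := Dfn.comp2 hK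
  -- `e` records only the pairs `(z, w)` in `L` with `w ∈ k(z)`; continuity recovers `k` on all
  -- subsets of `L`.
  obtain ⟨e, he⟩ := sep (fun p : M => ∃ z w : M, p = kpair z w ∧ ∃ y, K z y ∧ w ∈ₘ y) L
  have hmem : ∀ (z : Ext (pow (pow L))) (w : M), z.1 ∈ₘ L → w ∈ₘ L →
      ((∃ p, p ∈ₘ e ∧ p = kpair z.1 w) ↔ w ∈ₘ (k z).1) := by
    intro z w hz hw
    constructor
    · rintro ⟨p, hp, rfl⟩
      obtain ⟨-, z', w', e', y, hy, hwy⟩ := (he _).1 hp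
      obtain ⟨rfl, rfl⟩ := kpair_inj e'
      obtain ⟨_, rfl⟩ := (hKk _ _).1 hy
      exact hwy
    · intro h
      exact ⟨_, (he _).2 ⟨hL.kpair_mem hz hw, z.1, w, rfl, _, (hKk _ _).2 ⟨z.2, rfl⟩, h⟩, rfl⟩
  refine ⟨e, fun p hp => ((he p).1 hp).1, fun τ y hτ hy => ?_⟩
  have hcode : ∀ w, w ∈ₘ L → ((∃ z, z ∈ₘ L ∧ Sub z τ.1 ∧ ∃ p, p ∈ₘ e ∧ p = kpair z w) ↔
      w ∈ₘ (k τ).1) := by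
    intro w hw
    rw [mem_map_iff k hk hw]
    constructor
    · rintro ⟨z, hz, hzτ, h⟩
      exact ⟨⟨z, hL.mem_of_mem hz⟩, hz, hzτ, (hmem ⟨z, hL.mem_of_mem hz⟩ w hz hw).1 h⟩
    · rintro ⟨z, hz, hzτ, h⟩
      exact ⟨z.1, hz, hzτ, (hmem z w hz hw).2 h⟩
  have hkτ : (k τ).1 ∈ₘ pow L := (elementary1 k (fun x => x ∈ₘ pow L) τ).1 hτ
  constructor
  · intro h
    refine ext fun w => ⟨fun hw => ?_, fun hw => ?_⟩
    · have hwL := mem_pow.1 hy w hw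
      exact (hcode w hwL).1 ((h w hwL).1 hw)
    · have hwL := mem_pow.1 hkτ w hw
      exact (h w hwL).2 ((hcode w hwL).2 hw)
  · rintro rfl w hw
    exact (hcode w hw).symm

/-- For every suitable tree `T` there is a suitable tree `B` such that `T` is `k(B) ↓ ⌈e⌉` for
some `e`. -/
theorem exists_suit_down_map {T : M} (hT : Suit L T) : ∃ B : Ext (pow (pow L)), Suit L B.1 ∧
    ∃ e, tup1 e ∈ₘ (k B).1 ∧ down (k B).1 e = T := by
  -- The code `e` of `k` need not be in the range of `k`. It still occurs in `k(B)`, because the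
  -- definition of the preimage tree ranges over all codes.
  obtain ⟨B, hB, hBT⟩ := exists_isPreimageTree L T
  let T' : Ext (pow (pow L)) := ⟨T, mem_pow.2 hT.1.sub⟩
  let B' : Ext (pow (pow L)) := ⟨B, mem_pow.2 hB⟩
  obtain ⟨e, he, hek⟩ := exists_code k hk
  have hkB := (elementary2 k (fun T B => IsPreimageTree L T B) T' B').1 hBT
  -- `T` is the preimage of `k(T)` under `k`, since `τ ∈ T` iff `k(τ) ∈ k(T)`.
  have hpre : IsPreimage L (k T').1 e T := by
    intro τ hτ
    let τ' : Ext (pow (pow L)) := ⟨τ, hL.pow_sub_pow τ hτ⟩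
    rw [show τ ∈ₘ T ↔ (k τ').1 ∈ₘ (k T').1 from elementary2 k (fun a b => a ∈ₘ b) τ' T']
    constructor
    · intro h
      exact ⟨_, h, (hek τ' _ hτ (mem_pow.1 (k T').2 _ h)).2 rfl⟩
    · rintro ⟨y, hy, h⟩
      rw [← (hek τ' y hτ (mem_pow.1 (k T').2 y hy)).1 h]
      exact hy
  exact ⟨B', hBT.suit hB, e, hkB.tup1_mem he hpre hT,
    hkB.down_eq (mem_pow.1 (k B').2) he hpre hT⟩

omit hk in
theorem isInduced_iff (j : Ext (H (pow (pow L))) → Ext (H (pow (pow L)))) :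
    IsInduced (pow L) (pow (pow L)) k j ↔ ∀ (a : Ext (H (pow (pow L))))
      (T : Ext (pow (pow L))), Suit L T.1 → RootColl L T.1 a.1 →
        RootColl L (k T).1 (j a).1 := by
  refine forall_congr' fun a => ?_
  simp only [isSuitable_iff]
  constructor
  · rintro ⟨-, h⟩ T hT hTa
    rw [← isTcoll_iff ((elementary1 k (fun T => Suit L T) T).1 hT)]
    exact h T hT ((isTcoll_iff hT).2 hTa)
  · intro h
    constructor
    · obtain ⟨T, hT, hTa⟩ := mem_H_iff.1 a.2
      exact ⟨⟨T, mem_pow.2 hT.1.sub⟩, hT, (isTcoll_iff hT).2 hTa⟩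
    · intro T hT hTa
      rw [isTcoll_iff ((elementary1 k (fun T => Suit L T) T).1 hT)]
      exact h T hT ((isTcoll_iff hT).1 hTa)

omit hk in
theorem existsUnique_isInduced : ∃! j, IsInduced (pow L) (pow (pow L)) k j := by
  have hcode : ∀ a : Ext (H (pow (pow L))), ∃ T : Ext (pow (pow L)), Suit L T.1 ∧
      RootColl L T.1 a.1 := fun a => by
    obtain ⟨T, hT, hTa⟩ := mem_H_iff.1 a.2
    exact ⟨⟨T, mem_pow.2 hT.1.sub⟩, hT, hTa⟩
  -- Codes are chosen outside `M`, so no choice principle in `M` is involved; `rootColl_map_unique`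
  -- makes the selection immaterial.
  choose t ht hta using hcode
  have hkt := fun a => (elementary1 k (fun T => Suit L T) (t a)).1 (ht a)
  choose j hj using fun a => (hkt a).exists_rootColl
  refine ⟨fun a => ⟨j a, mem_H_iff.2 ⟨_, hkt a, hj a⟩⟩, ?_, ?_⟩
  · refine (isInduced_iff k _).2 ?_
    intro a T hT hTa
    have hkT := (elementary1 k (fun T => Suit L T) T).1 hT
    obtain ⟨x, hx⟩ := hkT.exists_rootColl
    have : x = j a := rootColl_map_unique k hT (ht a) hTa (hta a) hx (hj a)
    exact this ▸ hx
  · intro j' hj'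
    replace hj' := (isInduced_iff k j').1 hj'
    funext a
    exact Subtype.ext ((hj' a (t a) (ht a) (hta a)).unique (hkt a) (hj a))

/-- With `b` the collapse of `B`, the set `a` is the collapse of `k(B) ↓ ⌈e⌉`, hence an element of
the collapse of `k(B)`, which is `j(b)`. -/
theorem IsInduced.isCofinalMap {j : Ext (H (pow (pow L))) → Ext (H (pow (pow L)))}
    (hj : IsInduced (pow L) (pow (pow L)) k j) : IsCofinalMap j := by
  rw [isInduced_iff] at hj
  intro a
  obtain ⟨T, hT, hTa⟩ := mem_H_iff.1 a.2
  obtain ⟨B, hB, e, he, hd⟩ := exists_suit_down_map k hk hT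
  obtain ⟨b, hb⟩ := hB.exists_rootColl
  let b' : Ext (H (pow (pow L))) := ⟨b, mem_H_iff.2 ⟨_, hB, hb⟩⟩
  have hkB := (elementary1 k (fun T => Suit L T) B).1 hB
  exact ⟨b', ((hj b' B hB hb).mem_iff hkB).2 ⟨e, he, hd.symm ▸ hTa⟩⟩

end Elementary

end KunenTree

open FirstOrder KunenTree in
/-- In every model `M` of `ZF`: if `lam` is a limit ordinal and `k : V_{lam+2} → V_{lam+2}` is an
elementary embedding which is a set of `M`, then `k` induces a unique map
`j : H(V_{lam+2}) → H(V_{lam+2})` through suitable trees over `V_{lam+1}`, and `j` is cofinal. -/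
theorem mainTheorem4 {M : Type*} [Nonempty M] [SetStructure M] (hM : ModelsZF M)
    (lam : M) (hlam : IsLimit lam)
    (k : Ext (V (succ (succ lam))) ↪ₑ[setLang] Ext (V (succ (succ lam))))
    (hk : ∃ c : M, ∀ x y : Ext (V (succ (succ lam))), kpair x.1 y.1 ∈ₘ c ↔ k x = y) :
    (∃! j : Ext (H (V (succ (succ lam)))) → Ext (H (V (succ (succ lam)))),
      IsInduced (V (succ lam)) (V (succ (succ lam))) k j) ∧
    ∀ j : Ext (H (V (succ (succ lam)))) → Ext (H (V (succ (succ lam)))),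
      IsInduced (V (succ lam)) (V (succ (succ lam))) k j → IsCofinalMap j := by
  have : Fact (ModelsZF M) := ⟨hM⟩
  have : Ambient (V lam) := ambient_V hlam
  have h1 : V (succ lam) = pow (V lam) := V_succ hlam.1
  have h2 : V (succ (succ lam)) = pow (pow (V lam)) := by rw [V_succ hlam.1.succ, h1]
  rw [h1]
  generalize V (succ (succ lam)) = W at k h2
  subst h2
  exact ⟨existsUnique_isInduced k, fun j hj => hj.isCofinalMap k hk⟩
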